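/- Let $V$ be a finite-dimensional complex vector space and let $G\subset GL(V)$ be a complex Lie subgroup (the image of an injective holomorphic immersive homomorphism from a second countable complex Lie group; $G$ need not be closed) with Lie algebra $\mathfrak g\subset\mathfrak{gl}(V)$. For $k\ge 0$ let the $k$-th prolongation $\mathfrak g_k$ be the space of symmetric $(k+1)$-linear maps $T:V^{k+1}\to V$ such that $u\mapsto T(u,v_1,\dots,v_k)$ belongs to $\mathfrak g$ for all $v_1,\dots,v_k\in V$. Assume that $G$ is of finite type, i.e. $\mathfrak g_m=0$ for some $m$. Let $\sigma:M\to\triangle$ be a holomorphic family of complex manifolds over the open unit disk $\triangle\subset\mathbb C$, i.e. a holomorphic submersion, with fibers $M_t=\sigma^{-1}(t)$. Let $\mathcal F_\sigma(M)$ be the relative frame bundle, with fiber $\mathrm{Isom}(V,\mathrm{Ker}\,d\sigma(x))$ at $x\in M$, and let $\mathcal G\subset\mathcal F_\sigma(M)$ be a holomorphic family of $G$-structures, i.e. a holomorphic principal $G$-subbundle; write $\mathcal G_t$ for its restriction to $M_t$. Call $\mathcal G_t$ integrable if $M_t$ has an atlas of holomorphic charts $\varphi_\alpha:U_\alpha\to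 V$ such that, under the identification of the frame bundle of $U_\alpha$ with $GL(V)\times U_\alpha$ given by the coordinates $\varphi_\alpha$, the restriction of $\mathcal G_t$ to $U_\alpha$ is $G\times U_\alpha$. If $\mathcal G_t$ is integrable for every $t\in\triangle$ with $t\ne 0$, then $\mathcal G_0$ is integrable. -/

import Mathlib

open scoped Manifold ContDiff

section ComplexLieSubgroup

variable {V : Type*} [NormedAddCommGroup V] [NormedSpace ℂ V]
  {F : Type*} [NormedAddCommGroup F] [NormedSpace ℂ F]
  {H : Type*} [Group H] [TopologicalSpace H] [ChartedSpace F H]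

/-- The homomorphism `ι : H → GL(V)` exhibits its image as a (not necessarily closed) complex Lie
subgroup of `GL(V)`: it is an injective holomorphic immersion. To be used for a complex Lie group
`H` with a countable base. -/
structure IsComplexLieSubgroup (ι : H →* (V →L[ℂ] V)ˣ) : Prop where
  injective : Function.Injective ι
  holomorphic : ContMDiff 𝓘(ℂ, F) 𝓘(ℂ, V →L[ℂ] V) ω (fun h : H => (ι h : V →L[ℂ] V))
  immersion : ∀ h : H, Function.Injective
    (mfderiv 𝓘(ℂ, F) 𝓘(ℂ, V →L[ℂ] V) (fun h : H => (ι h : V →L[ℂ] V)) h)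

/-- The Lie algebra in `gl(V) = End(V)` of the Lie subgroup `ι(H)`: the image of the differential
of `ι` at the identity. -/
noncomputable def lieSubgroupAlgebra (ι : H →* (V →L[ℂ] V)ˣ) : Submodule ℂ (V →L[ℂ] V) :=
  LinearMap.range (show F →L[ℂ] (V →L[ℂ] V) from
    mfderiv 𝓘(ℂ, F) 𝓘(ℂ, V →L[ℂ] V) (fun h : H => (ι h : V →L[ℂ] V)) 1).toLinearMap

end ComplexLieSubgroup

section Prolongation

variable {V : Type*} [NormedAddCommGroup V] [NormedSpace ℂ V]

/-- The `k`-th prolongation of a linear subspace `𝔤` of `gl(V)`: the space of symmetric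
`(k + 1)`-linear maps `T : V × ⋯ × V → V` such that `u ↦ T (u, v₁, …, vₖ)` belongs to `𝔤` for all
`v₁, …, vₖ`. For `k = 0` it is `𝔤`; an element of the `(k + 1)`-st prolongation is the same as a
linear map `S` from `V` to the `k`-th prolongation with `S u (v, …) = S v (u, …)`. -/
def prolongation (𝔤 : Submodule ℂ (V →L[ℂ] V)) (k : ℕ) :
    Submodule ℂ (MultilinearMap ℂ (fun _ : Fin (k + 1) => V) V) where
  carrier := {T | (∀ (τ : Equiv.Perm (Fin (k + 1))) (v : Fin (k + 1) → V), T (v ∘ τ) = T v) ∧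
    ∀ v : Fin k → V, ∃ A ∈ 𝔤, ∀ u : V, A u = T (Fin.cons u v : Fin (k + 1) → V)}
  zero_mem' := ⟨fun _ _ => rfl, fun _ => ⟨0, 𝔤.zero_mem, fun _ => rfl⟩⟩
  add_mem' := by
    rintro S T ⟨hS, hS'⟩ ⟨hT, hT'⟩
    refine ⟨fun τ v => by simp [hS τ v, hT τ v], fun v => ?_⟩
    obtain ⟨A, hA, hA'⟩ := hS' v
    obtain ⟨B, hB, hB'⟩ := hT' v
    exact ⟨A + B, 𝔤.add_mem hA hB, fun u => by simp [hA' u, hB' u]⟩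
  smul_mem' := by
    rintro c T ⟨hT, hT'⟩
    refine ⟨fun τ v => by simp [hT τ v], fun v => ?_⟩
    obtain ⟨A, hA, hA'⟩ := hT' v
    exact ⟨c • A, 𝔤.smul_mem c hA, fun u => by simp [hA' u]⟩

/-- `𝔤 ⊂ gl(V)` is of finite type if one of its prolongations vanishes. -/
def IsOfFiniteType (𝔤 : Submodule ℂ (V →L[ℂ] V)) : Prop :=
  ∃ m : ℕ, prolongation 𝔤 m = ⊥

end Prolongation

section Families

variable {E : Type*} [NormedAddCommGroup E] [NormedSpace ℂ E]
  {M : Type*} [TopologicalSpace M] [ChartedSpace E M]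

/-- `σ : M → Δ` is a holomorphic family of complex manifolds over the open unit disk: a
holomorphic submersion. Its members are the fibres `M_t = σ⁻¹(t)`. -/
structure IsHolomorphicFamily (σ : M → ℂ) : Prop where
  mem_disk : ∀ x, σ x ∈ Metric.ball (0 : ℂ) 1
  submersion : Manifold.IsSubmersion 𝓘(ℂ, E) 𝓘(ℂ, ℂ) ω σ

/-- The relative tangent space `T_{σ,x}(M) = Ker dσ(x)`, that is, the tangent space at `x` of the
fibre of `σ` through `x`, as a subspace of `T_x(M)`. -/
noncomputable def relTangentSpace (σ : M → ℂ) (x : M) : Submodule ℂ (TangentSpace 𝓘(ℂ, E) x) :=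
  LinearMap.ker (mfderiv 𝓘(ℂ, E) 𝓘(ℂ, ℂ) σ x).toLinearMap

variable (V : Type*) [NormedAddCommGroup V] [NormedSpace ℂ V]

/-- The fibre at `x` of the relative frame bundle: linear isomorphisms `V → Ker dσ(x)`. -/
abbrev RelFrame (σ : M → ℂ) (x : M) : Type _ :=
  V ≃ₗ[ℂ] relTangentSpace (E := E) σ x

variable {V}

/-- The frame field `s` is holomorphic on `U`: for every `v : V` the vector field `x ↦ s x v` is
holomorphic on `U`. -/
def IsHolomorphicFrameFieldOn [IsManifold 𝓘(ℂ, E) ω M] {σ : M → ℂ} (s : ∀ x : M, RelFrame (E := E) V σ x) (U : Set M) :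
    Prop :=
  ∀ v : V, ContMDiffOn 𝓘(ℂ, E) 𝓘(ℂ, E).tangent ω
    (fun x => (⟨x, (s x v : TangentSpace 𝓘(ℂ, E) x)⟩ : TangentBundle 𝓘(ℂ, E) M)) U

/-- `𝒢` is a holomorphic family of `G`-structures on `σ : M → Δ`, i.e. a holomorphic principal
`G`-subbundle of the relative frame bundle: near every point there is a holomorphic frame field `s`
such that the fibre of `𝒢` at `y` is the orbit `s(y) · G`, for all `y` near that point. -/
def IsHolomorphicFamilyOfGStructures [IsManifold 𝓘(ℂ, E) ω M] (G : Subgroup (V →L[ℂ] V)ˣ)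
    {σ : M → ℂ}
    (𝒢 : ∀ x : M, Set (RelFrame (E := E) V σ x)) : Prop :=
  ∀ x : M, ∃ U : Set M, IsOpen U ∧ x ∈ U ∧ ∃ s : ∀ y : M, RelFrame (E := E) V σ y,
    IsHolomorphicFrameFieldOn s U ∧
    ∀ y ∈ U, ∀ f : RelFrame (E := E) V σ y,
      f ∈ 𝒢 y ↔ ∃ g ∈ G, ∀ v : V, f v = s y ((g : V →L[ℂ] V) v)

/-- `φ` is a holomorphic chart with values in `V` on the complex submanifold `M_t = σ⁻¹(t)` of
`M`: a homeomorphism from an open subset of `M_t` to an open subset of `V` whose inverse, as a map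
to `M`, is a holomorphic immersion. -/
structure IsFibreChart (σ : M → ℂ) (t : ℂ) (φ : OpenPartialHomeomorph (σ ⁻¹' {t}) V) : Prop where
  holomorphic : ContMDiffOn 𝓘(ℂ, V) 𝓘(ℂ, E) ω (fun w : V => (φ.symm w : M)) φ.target
  immersion : ∀ w ∈ φ.target, Function.Injective
    (mfderiv 𝓘(ℂ, V) 𝓘(ℂ, E) (fun w : V => (φ.symm w : M)) w)

/-- The `G`-structure `𝒢_t` on the fibre `M_t` is integrable: `M_t` has an atlas of holomorphic
charts `φ : U → V` such that, in terms of the coordinates `φ`, the restriction of `𝒢_t` to `U` is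
the product `G × U`. This says that the members of `𝒢` at the point `φ⁻¹(w)` are the frames
`d(φ⁻¹)(w) ∘ g` with `g ∈ G`. -/
def IsIntegrableAt (G : Subgroup (V →L[ℂ] V)ˣ) {σ : M → ℂ}
    (𝒢 : ∀ x : M, Set (RelFrame (E := E) V σ x)) (t : ℂ) : Prop :=
  ∃ 𝒜 : Set (OpenPartialHomeomorph (σ ⁻¹' {t}) V),
    (∀ x : σ ⁻¹' {t}, ∃ φ ∈ 𝒜, x ∈ φ.source) ∧
    ∀ φ ∈ 𝒜, IsFibreChart (E := E) σ t φ ∧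
      ∀ w ∈ φ.target, ∀ f : RelFrame (E := E) V σ (φ.symm w : M),
        f ∈ 𝒢 (φ.symm w) ↔ ∃ g ∈ G, ∀ v : V,
          (f v : TangentSpace 𝓘(ℂ, E) (φ.symm w : M)) =
            mfderiv 𝓘(ℂ, V) 𝓘(ℂ, E) (fun w' : V => (φ.symm w' : M)) w ((g : V →L[ℂ] V) v)

end Families

/-!
In a chart of `M` adapted to `σ`, with coordinates `(t, y) ∈ ℂ × V`, the family of `G`-structures is
spanned by an analytic family of frames `s(t, y) ∈ GL(V)`, with coframes `θ = s⁻¹`. Integrability of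
the member `t` means that locally there are coordinates `ψ` on `V` with `dψ ∘ s(t, ·) ∈ G`. The
coordinates that exist for `t ≠ 0` need not converge as `t → 0`, so integrability is first
reformulated without them.

Let `L = V ⊕ 𝔤 ⊕ 𝔤₁ ⊕ ⋯` be the Lie algebra of polynomial vector fields with derivatives in `𝔤`. It
is finite-dimensional because `G` is of finite type (`exists_prolongedAlgebra`). Then the member `t`
is integrable if and only if locally `θ` is the `V`-component of a *flat* `L`-valued 1-form `Ω`, one
with `dΩ + [Ω, Ω] / 2 = 0`:

* coordinates `ψ` give the flat form `θ + h⁻¹ dh` with `h = dψ ∘ s`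
  (`ProlongedAlgebra.exists_flat_form_of_map`);
* a flat form gives parallel sections of the trivial bundle with fibre `L`; their values at the
  origin form a function `g` with values in `G` such that `g⁻¹ θ` is closed, and `ψ` is a primitive
  of it (`ProlongedAlgebra.exists_integrating_map`).

Flat forms can be normalized, one filtration degree of `L` at a time. The equation for the next
component of `Ω` involves the Spencer coboundary and the curvature of what has been constructed so
far. A linear choice of a solution depends analytically on `(t, y)`, up to and including `t = 0`;
for `t ≠ 0` two solutions differ by an element of the next prolongation, and a gauge transformation
moves the given flat form to the chosen solution (`ProlongedAlgebra.ApproxFlat.succ`). After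
finitely many steps `Ω` is analytic in `(t, y)` and flat for `t ≠ 0`, hence also for `t = 0`, by
continuity (`ProlongedAlgebra.exists_flat_form_zero`).

Two points need care. The parallel sections come from a Frobenius theorem for analytic linear
systems, `exists_flat_section`, which is proved by solving Volterra equations along rays. And `G`
need not be closed in `GL(V)`: that an analytic map with values in `G` has its logarithmic
derivative in `𝔤` is a Baire category argument based on the second countability of the Lie group
(`IsSubgroupChart.exists_fderiv_eq_mul`).
-/

open Filter Topology Set

/-! ### Analytic solutions of flat linear total differential equations -/

section FlatConnection

variable {E : Type*} [NormedAddCommGroup E] [NormedSpace ℂ E]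
  {W : Type*} [NormedAddCommGroup W] [NormedSpace ℂ W]
  {B : Type*} [NormedAddCommGroup B] [NormedSpace ℂ B]

theorem ContDiffAt.fderiv_omega {f : E → W} {x : E} (hf : ContDiffAt ℂ ω f x) :
    ContDiffAt ℂ ω (fderiv ℂ f) x :=
  hf.fderiv_right (by simp)

theorem ContDiffAt.eventually_omega {f : E → W} {x : E} (hf : ContDiffAt ℂ ω f x) :
    ∀ᶠ y in 𝓝 x, ContDiffAt ℂ ω f y :=
  hf.eventually (by simp)

theorem ContDiffAt.differentiableAt_omega {f : E → W} {x : E} (hf : ContDiffAt ℂ ω f x) :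
    DifferentiableAt ℂ f x :=
  hf.differentiableAt (by simp)

theorem ContDiffAt.fderiv_fderiv_symm {f : E → W} {x : E} (hf : ContDiffAt ℂ ω f x) (u v : E) :
    fderiv ℂ (fderiv ℂ f) x u v = fderiv ℂ (fderiv ℂ f) x v u :=
  hf.isSymmSndFDerivAt_of_omega u v

/-- The continuous curve `τ ↦ τ ^ k • b` on the unit interval, as a linear function of `b`. -/
noncomputable def monomialCurve (B : Type*) [NormedAddCommGroup B] [NormedSpace ℂ B] (k : ℕ) :
    B →L[ℂ] C(unitInterval, B) :=
  LinearMap.mkContinuous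
    { toFun := fun b => ⟨fun τ => ((τ : ℝ) : ℂ) ^ k • b, by fun_prop⟩
      map_add' := fun a b => by ext; simp
      map_smul' := fun c b => by ext τ; simp [smul_comm c] } 1 (by
    intro b
    rw [one_mul, ContinuousMap.norm_le _ (norm_nonneg b)]
    intro τ
    have h : ‖((τ : ℝ) : ℂ) ^ k‖ ≤ 1 := by
      rw [norm_pow, Complex.norm_real, Real.norm_eq_abs, abs_of_nonneg τ.2.1]
      exact pow_le_one₀ τ.2.1 τ.2.2
    calc ‖((τ : ℝ) : ℂ) ^ k • b‖ ≤ ‖((τ : ℝ) : ℂ) ^ k‖ * ‖b‖ := norm_smul_le _ _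
      _ ≤ 1 * ‖b‖ := by gcongr
      _ = ‖b‖ := one_mul _)

@[simp] theorem monomialCurve_apply (k : ℕ) (b : B) (τ : unitInterval) :
    monomialCurve B k b τ = ((τ : ℝ) : ℂ) ^ k • b := rfl

theorem norm_monomialCurve_le (k : ℕ) : ‖monomialCurve B k‖ ≤ 1 :=
  LinearMap.mkContinuous_norm_le _ zero_le_one _

/-- The restriction of an analytic function to the segments `[0, y]` is an analytic function of
`y` with values in the Banach space of continuous curves: multiply the `k`-th term of the power
series by `τ ^ k`. -/
theorem exists_analytic_radial_curves [CompleteSpace B] {A : E → B} (hA : ContDiffAt ℂ ω A 0) :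
    ∃ R : E → C(unitInterval, B), ContDiffAt ℂ ω R 0 ∧
      ∀ᶠ y in 𝓝 (0 : E), ∀ τ : unitInterval, R y τ = A (((τ : ℝ) : ℂ) • y) := by
  obtain ⟨p, r, hp⟩ := hA.analyticAt
  let q : FormalMultilinearSeries ℂ E C(unitInterval, B) := fun k =>
    (monomialCurve B k).compContinuousMultilinearMap (p k)
  have hq : r ≤ q.radius := hp.r_le.trans <| FormalMultilinearSeries.radius_le_of_le fun {n} => by
    calc ‖q n‖ ≤ ‖monomialCurve B n‖ * ‖p n‖ :=
          ContinuousLinearMap.norm_compContinuousMultilinearMap_le _ _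
      _ ≤ 1 * ‖p n‖ := by gcongr; exact norm_monomialCurve_le n
      _ = ‖p n‖ := one_mul _
  refine ⟨q.sum, (q.hasFPowerSeriesOnBall (hp.r_pos.trans_le hq)).analyticAt.contDiffAt, ?_⟩
  filter_upwards [Metric.eball_mem_nhds (0 : E) hp.r_pos] with y hy τ
  have h1 : HasSum (fun n => q n fun _ => y) (q.sum y) :=
    q.hasSum (Metric.eball_subset_eball hq hy)
  have h2 := (ContinuousMap.evalCLM ℂ τ).hasSum h1
  have hy' : ((τ : ℝ) : ℂ) • y ∈ Metric.eball (0 : E) r := by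
    have : ‖((τ : ℝ) : ℂ)‖ ≤ 1 := by
      rw [Complex.norm_real, Real.norm_eq_abs, abs_of_nonneg τ.2.1]; exact τ.2.2
    rw [mem_eball_zero_iff] at hy ⊢
    refine lt_of_le_of_lt ?_ hy
    have h3 : ‖((τ : ℝ) : ℂ) • y‖ ≤ ‖y‖ := by
      rw [norm_smul]; exact mul_le_of_le_one_left (norm_nonneg _) this
    exact enorm_le_iff_norm_le.mpr h3
  have h3 := hp.hasSum hy'
  rw [zero_add] at h3
  refine h2.unique (h3.congr_fun ?_)
  intro n
  have h4 := (p n).map_smul_univ (fun _ => ((τ : ℝ) : ℂ)) (fun _ => y)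
  rw [Finset.prod_const, Finset.card_univ, Fintype.card_fin] at h4
  exact h4.symm

/-- The Volterra operator `f ↦ (τ ↦ ∫₀^τ f)` on continuous curves. -/
noncomputable def volterra (W : Type*) [NormedAddCommGroup W] [NormedSpace ℂ W] :
    C(unitInterval, W) →L[ℂ] C(unitInterval, W) :=
  LinearMap.mkContinuous
    { toFun := fun f => ⟨fun τ => ∫ s in (0 : ℝ)..τ, f (projIcc 0 1 zero_le_one s), by
        have hf : Continuous fun s : ℝ => f (projIcc 0 1 zero_le_one s) := by fun_prop
        exact (intervalIntegral.continuous_primitive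
          (fun a b => hf.intervalIntegrable a b) 0).comp continuous_subtype_val⟩
      map_add' := fun f g => by
        ext τ
        have hf : Continuous fun s : ℝ => f (projIcc 0 1 zero_le_one s) := by fun_prop
        have hg : Continuous fun s : ℝ => g (projIcc 0 1 zero_le_one s) := by fun_prop
        exact intervalIntegral.integral_add (hf.intervalIntegrable _ _) (hg.intervalIntegrable _ _)
      map_smul' := fun c f => by
        ext τ
        exact intervalIntegral.integral_smul c _ } 1 (by
    intro f
    rw [one_mul, ContinuousMap.norm_le _ (norm_nonneg f)]
    intro τ
    have h := intervalIntegral.norm_integral_le_of_norm_le_const (a := 0) (b := (τ : ℝ))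
      (C := ‖f‖) (f := fun s => f (projIcc 0 1 zero_le_one s))
      (fun s _ => ContinuousMap.norm_coe_le_norm f _)
    refine h.trans (mul_le_of_le_one_right (norm_nonneg f) ?_)
    rw [sub_zero, abs_of_nonneg τ.2.1]
    exact τ.2.2)

theorem volterra_apply (f : C(unitInterval, W)) (τ : unitInterval) :
    volterra W f τ = ∫ s in (0 : ℝ)..τ, f (projIcc 0 1 zero_le_one s) := rfl

/-- Pointwise application of a curve of operators to a curve of vectors. -/
noncomputable def curveApply (B W : Type*) [NormedAddCommGroup B] [NormedSpace ℂ B]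
    [NormedAddCommGroup W] [NormedSpace ℂ W] :
    C(unitInterval, B →L[ℂ] W) →L[ℂ] C(unitInterval, B) →L[ℂ] C(unitInterval, W) :=
  LinearMap.mkContinuous₂
    (LinearMap.mk₂ ℂ
      (fun (a : C(unitInterval, B →L[ℂ] W)) (f : C(unitInterval, B)) =>
        (⟨fun τ => a τ (f τ), by fun_prop⟩ : C(unitInterval, W)))
      (fun a b f => by ext; simp) (fun c a f => by ext; simp) (fun a f g => by ext; simp)
      (fun c a f => by ext; simp)) 1 (by
    intro a f
    rw [one_mul, ContinuousMap.norm_le _ (by positivity)]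
    intro τ
    refine ((a τ).le_opNorm _).trans ?_
    gcongr
    exacts [ContinuousMap.norm_coe_le_norm a _, ContinuousMap.norm_coe_le_norm f _])

@[simp] theorem curveApply_apply (a : C(unitInterval, B →L[ℂ] W)) (f : C(unitInterval, B))
    (τ : unitInterval) : curveApply B W a f τ = a τ (f τ) := rfl

theorem hasDerivAt_ofReal_smul (y : E) (τ : ℝ) :
    HasDerivAt (fun τ : ℝ => (τ : ℂ) • y) y τ := by
  have h := (Complex.ofRealCLM.hasDerivAt (x := τ)).smul_const y
  rw [Complex.ofRealCLM_apply, Complex.ofReal_one, one_smul] at h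
  exact h

/-- The differential equation satisfied along rays by a solution of a linear total differential
equation has an analytic solution: on each ray it is a Volterra integral equation, whose
operator depends analytically on the ray. -/
theorem exists_radial_solution [CompleteSpace W] {A : E → E →L[ℂ] W →L[ℂ] W}
    (hA : ContDiffAt ℂ ω A 0) (x₀ : W) :
    ∃ X : E → W, ContDiffAt ℂ ω X 0 ∧ X 0 = x₀ ∧
      ∀ᶠ y in 𝓝 (0 : E), fderiv ℂ X y y = A y y (X y) := by
  obtain ⟨R, hR, hRA⟩ := exists_analytic_radial_curves hA
  let K : E → C(unitInterval, W) →L[ℂ] C(unitInterval, W) := fun y =>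
    (volterra W) ∘L curveApply W W (curveApply E (W →L[ℂ] W) (R y) (monomialCurve E 0 y))
  have hK : ContDiffAt ℂ ω K 0 := by
    have h1 : ContDiffAt ℂ ω (fun y => curveApply E (W →L[ℂ] W) (R y)) 0 :=
      contDiffAt_const.clm_apply hR
    have h2 : ContDiffAt ℂ ω (fun y : E => monomialCurve E 0 y) 0 :=
      contDiffAt_const.clm_apply contDiffAt_id
    exact contDiffAt_const.clm_comp (contDiffAt_const.clm_apply (h1.clm_apply h2))
  have hK0 : K 0 = 0 := by
    ext f : 1
    simp only [K, ContinuousLinearMap.map_zero, ContinuousLinearMap.comp_zero]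
  let c : C(unitInterval, W) := ContinuousMap.const _ x₀
  let F : E → C(unitInterval, W) := fun y => Ring.inverse (1 - K y) c
  have hF : ContDiffAt ℂ ω F 0 := by
    have h1 : ContDiffAt ℂ ω (fun y => 1 - K y) 0 := contDiffAt_const.sub hK
    have h2 : ContDiffAt ℂ ω (Ring.inverse (M₀ := C(unitInterval, W) →L[ℂ] C(unitInterval, W)))
        (1 - K 0) := by
      rw [hK0, sub_zero]
      exact contDiffAt_ringInverse ℂ (R := C(unitInterval, W) →L[ℂ] C(unitInterval, W)) 1
    exact (h2.comp (0 : E) h1).clm_apply contDiffAt_const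
  have hunit : ∀ᶠ y in 𝓝 (0 : E), IsUnit (1 - K y) := by
    have h1 : ContinuousAt (fun y => 1 - K y) 0 := (contDiffAt_const.sub hK).continuousAt
    refine h1.eventually_mem
      ((Units.isOpen (R := C(unitInterval, W) →L[ℂ] C(unitInterval, W))).mem_nhds ?_)
    simp [hK0]
  let X : E → W := fun y => F y 1
  have hX : ContDiffAt ℂ ω X 0 :=
    (ContinuousMap.evalCLM ℂ (M := W) (1 : unitInterval)).contDiff.contDiffAt.comp (0 : E) hF
  have hX0 : X 0 = x₀ := by simp [X, F, hK0, c]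
  refine ⟨X, hX, hX0, ?_⟩
  obtain ⟨δ, hδ, hball⟩ := Metric.eventually_nhds_iff_ball.1
    (hRA.and (hunit.and (hX.eventually_omega)))
  -- On the ray through `y` the equation is the integral equation solved by `F y` alone.
  have hint : ∀ y ∈ Metric.ball (0 : E) δ, ∀ f : C(unitInterval, W),
      (∀ τ : unitInterval, f τ = x₀ + ∫ s in (0 : ℝ)..τ,
        R y (projIcc 0 1 zero_le_one s) y (f (projIcc 0 1 zero_le_one s))) ↔ f = F y := by
    intro y hy f
    have hF' : (1 - K y) (F y) = c := by
      have := congrArg (fun T => T c) (Ring.mul_inverse_cancel _ (hball y hy).2.1)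
      simpa using this
    have hA' : ∀ τ : unitInterval, (1 - K y) f τ = f τ - ∫ s in (0 : ℝ)..τ,
        R y (projIcc 0 1 zero_le_one s) y (f (projIcc 0 1 zero_le_one s)) := by
      intro τ
      have h1 : K y f τ = ∫ s in (0 : ℝ)..τ,
          R y (projIcc 0 1 zero_le_one s) y (f (projIcc 0 1 zero_le_one s)) := by
        simp only [K, ContinuousLinearMap.comp_apply, volterra_apply]
        refine intervalIntegral.integral_congr fun s _ => ?_
        simp
      simp [h1]
    constructor
    · intro h
      have h1 : (1 - K y) f = c := by
        ext τ
        rw [hA', h τ]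
        simp [c]
      have := congrArg (fun T => T f) (Ring.inverse_mul_cancel _ (hball y hy).2.1)
      simp only [mul_apply_eq_comp, h1] at this
      simpa [F] using this.symm
    · rintro rfl τ
      have := hA' τ
      rw [hF'] at this
      rw [← sub_eq_iff_eq_add, ← this]
      simp [c]
  -- By uniqueness, rescaling the curve of `y` by `τ` gives the curve of `τ y`.
  have hray : ∀ y ∈ Metric.ball (0 : E) δ, ∀ τ : unitInterval,
      X (((τ : ℝ) : ℂ) • y) = F y τ := by
    intro y hy τ
    have hy' : ((τ : ℝ) : ℂ) • y ∈ Metric.ball (0 : E) δ := by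
      rw [mem_ball_zero_iff] at hy ⊢
      refine lt_of_le_of_lt ?_ hy
      rw [norm_smul, Complex.norm_real, Real.norm_eq_abs, abs_of_nonneg τ.2.1]
      exact mul_le_of_le_one_left (norm_nonneg _) τ.2.2
    let f : C(unitInterval, W) := ⟨fun s => F y (τ * s), by fun_prop⟩
    have hf : f = F (((τ : ℝ) : ℂ) • y) := by
      rw [← hint _ hy']
      intro s
      have h1 := ((hint y hy (F y)).2 rfl) (τ * s)
      simp only [f, ContinuousMap.coe_mk]
      rw [h1]
      congr 1
      have h2 := intervalIntegral.smul_integral_comp_mul_left (a := 0) (b := (s : ℝ))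
        (fun u : ℝ => R y (projIcc 0 1 zero_le_one u) y (F y (projIcc 0 1 zero_le_one u))) (τ : ℝ)
      rw [mul_zero] at h2
      rw [show ((τ * s : unitInterval) : ℝ) = (τ : ℝ) * s from rfl, ← h2,
        ← intervalIntegral.integral_smul]
      refine intervalIntegral.integral_congr fun u hu => ?_
      rw [uIcc_of_le s.2.1] at hu
      have hu' : u ∈ Icc (0 : ℝ) 1 := ⟨hu.1, hu.2.trans s.2.2⟩
      have h3 : (τ : ℝ) * u ∈ Icc (0 : ℝ) 1 :=
        ⟨mul_nonneg τ.2.1 hu'.1, mul_le_one₀ τ.2.2 hu'.1 hu'.2⟩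
      have h4 : projIcc 0 1 zero_le_one ((τ : ℝ) * u) = τ * projIcc 0 1 zero_le_one u := by
        rw [projIcc_of_mem _ hu', projIcc_of_mem _ h3]
        rfl
      have h5 : R (((τ : ℝ) : ℂ) • y) (projIcc 0 1 zero_le_one u) =
          R y (τ * projIcc 0 1 zero_le_one u) := by
        rw [(hball _ hy').1, (hball _ hy).1, smul_smul, Set.Icc.coe_mul, Complex.ofReal_mul,
          mul_comm]
      simp only [h4, h5, map_smul, smul_apply]
      exact (Complex.coe_smul _ _).symm
    simp only [X, ← hf, f, ContinuousMap.coe_mk, mul_one]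
  -- The curve of `2 y` is differentiated at `1 / 2`, an interior point of the interval.
  filter_upwards [Metric.ball_mem_nhds (0 : E) (half_pos hδ)] with y hy
  have hz : (2 : ℂ) • y ∈ Metric.ball (0 : E) δ := by
    rw [mem_ball_zero_iff] at hy ⊢
    rw [norm_smul, Complex.norm_ofNat]
    linarith
  have hyX : ContDiffAt ℂ ω X y := (hball y (Metric.ball_subset_ball (by linarith) hy)).2.2
  have h1 : HasDerivAt (fun τ : ℝ => X ((τ : ℂ) • (2 : ℂ) • y)) (fderiv ℂ X y ((2 : ℂ) • y))
      (1 / 2) := by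
    have h2 := hasDerivAt_ofReal_smul ((2 : ℂ) • y) (1 / 2)
    have h3 : (((1 / 2 : ℝ) : ℂ) • (2 : ℂ) • y) = y := by
      rw [smul_smul]; norm_num
    have h4 : HasFDerivAt X (fderiv ℂ X y) (((1 / 2 : ℝ) : ℂ) • (2 : ℂ) • y) := by
      rw [h3]; exact hyX.differentiableAt_omega.hasFDerivAt
    exact (h4.restrictScalars ℝ).comp_hasDerivAt (1 / 2 : ℝ) h2
  set z := (2 : ℂ) • y with hzdef
  let G : ℝ → W := fun s => R z (projIcc 0 1 zero_le_one s) z (F z (projIcc 0 1 zero_le_one s))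
  have hG : Continuous G := by fun_prop
  have h2 : HasDerivAt (fun τ : ℝ => x₀ + ∫ s in (0 : ℝ)..τ, G s) (G (1 / 2)) (1 / 2) :=
    (intervalIntegral.integral_hasDerivAt_right (hG.intervalIntegrable _ _)
      (hG.stronglyMeasurableAtFilter _ _) hG.continuousAt).const_add x₀
  have h3 : (fun τ : ℝ => X ((τ : ℂ) • z)) =ᶠ[𝓝 (1 / 2 : ℝ)]
      fun τ : ℝ => x₀ + ∫ s in (0 : ℝ)..τ, G s := by
    filter_upwards [Ioo_mem_nhds (show (0 : ℝ) < 1 / 2 by norm_num)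
      (show (1 / 2 : ℝ) < 1 by norm_num)] with τ hτ
    have h4 := hray z hz ⟨τ, hτ.1.le, hτ.2.le⟩
    rw [((hint z hz (F z)).2 rfl) ⟨τ, hτ.1.le, hτ.2.le⟩] at h4
    exact h4
  have h4 := (h2.congr_of_eventuallyEq h3).unique h1
  have hhalf : (1 / 2 : ℝ) ∈ Icc (0 : ℝ) 1 := by norm_num
  have h5 : ((1 / 2 : ℝ) : ℂ) • z = y := by rw [hzdef, smul_smul]; norm_num
  have h6 : G (1 / 2) = A y z (X y) := by
    have h7 := hray z hz ⟨1 / 2, hhalf⟩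
    have h8 := (hball z hz).1 ⟨1 / 2, hhalf⟩
    simp only [h5] at h7 h8
    simp only [G, projIcc_of_mem zero_le_one hhalf, ← h7, h8]
  rw [h6, hzdef] at h4
  simp only [map_smul, smul_apply] at h4
  exact (smul_right_injective W (two_ne_zero (α := ℂ)) h4).symm

/-- The case of initial point `0` in `exists_flat_section`. -/
theorem exists_flat_section_zero [CompleteSpace W] {A : E → E →L[ℂ] W →L[ℂ] W}
    (hA : ContDiffAt ℂ ω A 0)
    (hflat : ∀ᶠ y in 𝓝 (0 : E), ∀ u v : E, fderiv ℂ A y u v - fderiv ℂ A y v u =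
      A y u ∘L A y v - A y v ∘L A y u) (x₀ : W) :
    ∃ X : E → W, ContDiffAt ℂ ω X 0 ∧ X 0 = x₀ ∧
      ∀ᶠ y in 𝓝 (0 : E), ∀ u, fderiv ℂ X y u = A y u (X y) := by
  obtain ⟨X, hX, hX0, hrad⟩ := exists_radial_solution hA x₀
  refine ⟨X, hX, hX0, ?_⟩
  obtain ⟨δ, hδ, hball⟩ := Metric.eventually_nhds_iff_ball.1
    (hflat.and (hX.eventually_omega.and (hA.eventually_omega.and hrad.eventually_nhds)))
  filter_upwards [Metric.ball_mem_nhds (0 : E) hδ] with y hy u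
  -- the defect `X'(u) - A(u) X`, scaled along the ray through `y`, solves a linear equation
  let D : E → W := fun z => fderiv ℂ X z u - A z u (X z)
  have hmem : ∀ τ ∈ Icc (0 : ℝ) 1, (τ : ℂ) • y ∈ Metric.ball (0 : E) δ := by
    intro τ hτ
    rw [mem_ball_zero_iff] at hy ⊢
    refine lt_of_le_of_lt ?_ hy
    rw [norm_smul, Complex.norm_real, Real.norm_eq_abs, abs_of_nonneg hτ.1]
    exact mul_le_of_le_one_left (norm_nonneg _) hτ.2
  have hDD : ∀ z ∈ Metric.ball (0 : E) δ, ∀ w, HasFDerivAt D (fderiv ℂ D z) z ∧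
      fderiv ℂ D z w = fderiv ℂ (fderiv ℂ X) z w u - (fderiv ℂ A z w u (X z) +
        A z u (fderiv ℂ X z w)) := by
    intro z hz w
    obtain ⟨-, hXz, hAz, -⟩ := hball z hz
    have h1 := hXz.fderiv_omega.differentiableAt_omega.hasFDerivAt.clm_apply
      (hasFDerivAt_const u z)
    have h2 := (hAz.differentiableAt_omega.hasFDerivAt.clm_apply
      (hasFDerivAt_const u z)).clm_apply hXz.differentiableAt_omega.hasFDerivAt
    have h3 : HasFDerivAt D _ z := h1.sub h2
    refine ⟨h3.differentiableAt.hasFDerivAt, ?_⟩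
    rw [h3.fderiv]
    simp [add_comm]
  have hradu : ∀ z ∈ Metric.ball (0 : E) δ, fderiv ℂ (fderiv ℂ X) z u z + fderiv ℂ X z u =
      fderiv ℂ A z u z (X z) + A z u (X z) + A z z (fderiv ℂ X z u) := by
    intro z hz
    obtain ⟨-, hXz, hAz, hrz⟩ := hball z hz
    have h1 := hXz.fderiv_omega.differentiableAt_omega.hasFDerivAt.clm_apply (hasFDerivAt_id z)
    have h2 := (hAz.differentiableAt_omega.hasFDerivAt.clm_apply
      (hasFDerivAt_id z)).clm_apply hXz.differentiableAt_omega.hasFDerivAt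
    have h3 := (h2.congr_of_eventuallyEq hrz).unique h1
    have h4 := congrArg (fun T => T u) h3
    simp only [id] at h4
    simp at h4
    rw [add_comm, ← h4]
    abel
  let J : ℝ → W := fun τ => (τ : ℂ) • D ((τ : ℂ) • y)
  have hJ : ∀ τ ∈ Icc (0 : ℝ) 1, HasDerivAt J (A ((τ : ℂ) • y) y (J τ)) τ := by
    intro τ hτ
    set z := (τ : ℂ) • y with hz
    have hzm := hmem τ hτ
    have h2 : HasDerivAt (fun τ : ℝ => D ((τ : ℂ) • y)) (fderiv ℂ D z y) τ := by
      have h1 := (hDD z hzm y).1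
      exact (h1.restrictScalars ℝ).comp_hasDerivAt τ (hasDerivAt_ofReal_smul y τ)
    have h3 : HasDerivAt J _ τ := (Complex.ofRealCLM.hasDerivAt (x := τ)).smul h2
    convert h3 using 1
    obtain ⟨hfl, hXz, hAz, hrz⟩ := hball z hzm
    have h4 := hradu z hzm
    have h5 := hrz.self_of_nhds
    have h6 := congrArg (fun T => T (X z)) (hfl z u)
    have h7 : (τ : ℂ) • fderiv ℂ D z y = fderiv ℂ D z z := by rw [← map_smul]
    have h8 : A z y (J τ) = A z z (D z) := by
      simp only [J, map_smul, hz, smul_apply]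
    simp only [sub_apply, ContinuousLinearMap.comp_apply] at h6
    simp only [Complex.ofRealCLM_apply, h7, (hDD z hzm z).2, h8, Complex.ofReal_one, one_smul]
    rw [hXz.fderiv_fderiv_symm z u, h5]
    simp only [D, map_sub]
    linear_combination (norm := module) h6 - h4
  have hcont : ContinuousOn (fun τ : ℝ => A ((τ : ℂ) • y) y) (Icc 0 1) := by
    intro τ hτ
    have h1 := (hball _ (hmem τ hτ)).2.2.1.continuousAt
    have h2 : ContinuousAt (fun τ : ℝ => (τ : ℂ) • y) τ := by fun_prop
    exact ((ContinuousAt.comp (f := fun τ : ℝ => (τ : ℂ) • y) h1 h2).clm_apply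
      continuousAt_const).continuousWithinAt
  obtain ⟨C, hC⟩ := isCompact_Icc.exists_bound_of_continuousOn hcont
  have hzero := eq_zero_of_abs_deriv_le_mul_abs_self_of_eq_zero_right
    (f := J) (f' := fun τ => A ((τ : ℂ) • y) y (J τ)) (K := C) (a := 0) (b := 1)
    (fun τ hτ => (hJ τ hτ).continuousAt.continuousWithinAt)
    (fun τ hτ => (hJ τ ⟨hτ.1, hτ.2.le⟩).hasDerivWithinAt) (by simp [J])
    (fun τ hτ => ((A ((τ : ℂ) • y) y).le_opNorm _).trans
      (by gcongr; exact hC τ ⟨hτ.1, hτ.2.le⟩)) 1 (by simp)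
  simpa [J, D, sub_eq_zero] using hzero

/-- **Frobenius theorem for linear systems.** The total differential equation
`dX = A X` with analytic coefficients and vanishing curvature has an analytic local solution with
any prescribed initial value. -/
theorem exists_flat_section [CompleteSpace W] {A : E → E →L[ℂ] W →L[ℂ] W} {y₀ : E}
    (hA : ContDiffAt ℂ ω A y₀)
    (hflat : ∀ᶠ y in 𝓝 y₀, ∀ u v : E, fderiv ℂ A y u v - fderiv ℂ A y v u =
      A y u ∘L A y v - A y v ∘L A y u) (x₀ : W) :
    ∃ X : E → W, ContDiffAt ℂ ω X y₀ ∧ X y₀ = x₀ ∧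
      ∀ᶠ y in 𝓝 y₀, ∀ u, fderiv ℂ X y u = A y u (X y) := by
  have ht : Tendsto (fun y : E => y + y₀) (𝓝 0) (𝓝 y₀) := by
    simpa using (continuous_add_const y₀).tendsto (0 : E)
  have ht' : Tendsto (fun y : E => y - y₀) (𝓝 y₀) (𝓝 0) := by
    simpa using (continuous_sub_right y₀).tendsto y₀
  have hA' : ContDiffAt ℂ ω (fun y => A (y + y₀)) 0 :=
    ContDiffAt.comp (f := fun y : E => y + y₀) (0 : E) (by simpa using hA) (by fun_prop)
  obtain ⟨X, hX, hX0, h⟩ := exists_flat_section_zero hA' (by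
    filter_upwards [ht.eventually hflat] with y hy
    have h1 := fderiv_comp_add_right (𝕜 := ℂ) (f := A) (x := y) y₀
    rw [h1]
    exact hy) x₀
  refine ⟨fun y => X (y - y₀), ?_, by simpa using hX0, ?_⟩
  · exact ContDiffAt.comp (f := fun y : E => y - y₀) y₀ (by simpa using hX) (by fun_prop)
  · filter_upwards [ht'.eventually h] with y hy
    simpa [fderiv_comp_sub] using hy

end FlatConnection

/-! ### Filtered Lie algebras and the Maurer-Cartan equation -/

section FiniteDimensionalSubspaces

variable {E : Type*} [NormedAddCommGroup E] [NormedSpace ℂ E]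
  {W : Type*} [NormedAddCommGroup W] [NormedSpace ℂ W] [FiniteDimensional ℂ W]

/-- A subspace of a finite-dimensional space is the kernel of a continuous linear projection
onto a complement. -/
theorem Submodule.exists_clm_projection (K : Submodule ℂ W) :
    ∃ π : W →L[ℂ] W, (∀ w, π w = 0 ↔ w ∈ K) ∧ ∀ w, π (π w) = π w := by
  obtain ⟨C, hC⟩ := K.exists_isCompl
  refine ⟨LinearMap.toContinuousLinearMap (C.projection K hC.symm), fun w => ?_, fun w => ?_⟩
  · simp [Submodule.projection_apply_eq_zero_iff]
  · simp

theorem fderiv_mem_of_eventually_mem {f : E → W} {y : E} (K : Submodule ℂ W)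
    (hf : DifferentiableAt ℂ f y) (h : ∀ᶠ z in 𝓝 y, f z ∈ K) (u : E) : fderiv ℂ f y u ∈ K := by
  obtain ⟨π, hπ, -⟩ := K.exists_clm_projection
  have h1 : (fun z => π (f z)) =ᶠ[𝓝 y] fun _ => 0 := by
    filter_upwards [h] with z hz
    exact (hπ _).2 hz
  have h2 : HasFDerivAt (fun z => π (f z)) (π ∘L fderiv ℂ f y) y :=
    π.hasFDerivAt.comp y hf.hasFDerivAt
  have h3 := (h2.congr_of_eventuallyEq h1.symm).unique (hasFDerivAt_const (0 : W) y)
  rw [← hπ]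
  exact congrArg (fun T => T u) h3

end FiniteDimensionalSubspaces

/-- The graded Lie algebra `V ⊕ 𝔤 ⊕ 𝔤₁ ⊕ 𝔤₂ ⊕ ⋯` of a linear Lie algebra of finite type, thought of
as an algebra of polynomial vector fields on `V`, in the form in which it is used: a
finite-dimensional Lie algebra `L` with inclusions `const` of `V` (constant fields) and `lin` of
`𝔤` (linear fields, `lin` being extended arbitrarily to `End V`), the value `ev` and the derivative
`jac` of a field at the origin, and the decreasing filtration `Fil` by the order of vanishing at the
origin. The bracket is `[P, Q] = dP(Q) - dQ(P)`, the opposite of the bracket of vector fields, so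
that `lin` is a homomorphism. The field `exact_const` expresses that a symmetric element of
`Hom(V, 𝔤ₖ)` comes from the prolongation `𝔤ₖ₊₁`. -/
structure ProlongedAlgebra {V : Type*} [NormedAddCommGroup V] [NormedSpace ℂ V]
    (𝔤 : Submodule ℂ (V →L[ℂ] V)) (L : Type*) [NormedAddCommGroup L] [NormedSpace ℂ L] where
  br : L →L[ℂ] L →L[ℂ] L
  const : V →L[ℂ] L
  lin : (V →L[ℂ] V) →L[ℂ] L
  ev : L →L[ℂ] V
  jac : L →L[ℂ] V →L[ℂ] V
  Fil : ℕ → Submodule ℂ L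
  order : ℕ
  br_antisymm : ∀ P Q, br P Q = -br Q P
  jacobi : ∀ P Q R, br P (br Q R) = br (br P Q) R + br Q (br P R)
  ev_const : ∀ v, ev (const v) = v
  ev_br : ∀ P Q, ev (br P Q) = jac P (ev Q) - jac Q (ev P)
  jac_mem : ∀ P, jac P ∈ 𝔤
  br_const_const : ∀ u v, br (const u) (const v) = 0
  br_lin_const : ∀ A ∈ 𝔤, ∀ v, br (lin A) (const v) = const (A v)
  br_lin_lin : ∀ A ∈ 𝔤, ∀ B ∈ 𝔤, br (lin A) (lin B) = lin (A ∘L B - B ∘L A)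
  ev_lin : ∀ A ∈ 𝔤, ev (lin A) = 0
  Fil_zero : ∀ P, P ∈ Fil 0
  Fil_one : ∀ P, P ∈ Fil 1 ↔ ev P = 0
  Fil_anti : Antitone Fil
  Fil_order : ∀ P ∈ Fil order, P = 0
  br_mem : ∀ i j P Q, P ∈ Fil (i + 1) → Q ∈ Fil j → br P Q ∈ Fil (i + j)
  exact_const : ∀ k, 1 ≤ k → ∀ γ : V →ₗ[ℂ] L, (∀ v, γ v ∈ Fil k) →
    (∀ u v, br (const u) (γ v) - br (const v) (γ u) ∈ Fil k) →
    ∃ a ∈ Fil (k + 1), ∀ v, γ v - br a (const v) ∈ Fil (k + 1)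

namespace ProlongedAlgebra

variable {V : Type*} [NormedAddCommGroup V] [NormedSpace ℂ V]
  {𝔤 : Submodule ℂ (V →L[ℂ] V)} {L : Type*} [NormedAddCommGroup L] [NormedSpace ℂ L]
  (S : ProlongedAlgebra 𝔤 L)

theorem br_mem_left {i j : ℕ} {P Q : L} (hP : P ∈ S.Fil (i + 1)) (hQ : Q ∈ S.Fil j) :
    S.br P Q ∈ S.Fil (i + j) := S.br_mem i j P Q hP hQ

/-- The curvature `dΩ + [Ω, Ω] / 2` at `y` of an `L`-valued 1-form `Ω` on `V`. -/
noncomputable def curvature (Ω : V → V →L[ℂ] L) (y u v : V) : L :=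
  fderiv ℂ Ω y u v - fderiv ℂ Ω y v u + S.br (Ω y u) (Ω y v)

/-- The coefficients of the expansion in powers of `τ` of the transform of the `L`-valued 1-form `Ω`
by the gauge transformation `exp (τ a)`, that is, of the solution of
`∂Ω/∂τ = [a, Ω] - da`. -/
noncomputable def gaugeTerm (a : V → L) (Ω : V → V →L[ℂ] L) : ℕ → V → V →L[ℂ] L
  | 0 => Ω
  | n + 1 => fun y => ((n + 1 : ℕ) : ℂ)⁻¹ •
      (S.br (a y) ∘L gaugeTerm a Ω n y - if n = 0 then fderiv ℂ a y else 0)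

theorem smul_gaugeTerm_succ (a : V → L) (Ω : V → V →L[ℂ] L) (n : ℕ) (y u : V) :
    ((n + 1 : ℕ) : ℂ) • S.gaugeTerm a Ω (n + 1) y u =
      S.br (a y) (S.gaugeTerm a Ω n y u) - (if n = 0 then fderiv ℂ a y else 0) u := by
  rw [gaugeTerm, smul_apply, smul_smul, mul_inv_cancel₀ (Nat.cast_ne_zero.2 n.succ_ne_zero),
    one_smul]
  rfl

theorem contDiffAt_gaugeTerm {a : V → L} {Ω : V → V →L[ℂ] L} {y : V} (ha : ContDiffAt ℂ ω a y)
    (hΩ : ContDiffAt ℂ ω Ω y) (n : ℕ) : ContDiffAt ℂ ω (S.gaugeTerm a Ω n) y := by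
  induction n with
  | zero => exact hΩ
  | succ n ih =>
    refine ContDiffAt.const_smul _ (((contDiffAt_const.clm_apply ha).clm_comp ih).sub ?_)
    split_ifs
    · exact ha.fderiv_omega
    · exact contDiffAt_const

theorem fderiv_gaugeTerm_succ {a : V → L} {Ω : V → V →L[ℂ] L} {y : V} (ha : ContDiffAt ℂ ω a y)
    (hΩ : ContDiffAt ℂ ω Ω y) (n : ℕ) (u v : V) :
    ((n + 1 : ℕ) : ℂ) • fderiv ℂ (S.gaugeTerm a Ω (n + 1)) y u v =
      S.br (fderiv ℂ a y u) (S.gaugeTerm a Ω n y v) +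
        S.br (a y) (fderiv ℂ (S.gaugeTerm a Ω n) y u v) -
        (if n = 0 then fderiv ℂ (fderiv ℂ a) y u v else 0) := by
  have h1 := (S.contDiffAt_gaugeTerm ha hΩ n).differentiableAt_omega.hasFDerivAt
  have h2 : HasFDerivAt (fun z => S.br (a z)) (S.br ∘L fderiv ℂ a y) y :=
    S.br.hasFDerivAt.comp y ha.differentiableAt_omega.hasFDerivAt
  have h3 : HasFDerivAt (fun z => if n = 0 then fderiv ℂ a z else 0)
      (if n = 0 then fderiv ℂ (fderiv ℂ a) y else 0) y := by
    split_ifs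
    · exact ha.fderiv_omega.differentiableAt_omega.hasFDerivAt
    · exact hasFDerivAt_const _ _
  have h4 := ((h2.clm_comp h1).sub h3).const_smul (((n + 1 : ℕ) : ℂ)⁻¹)
  have h5 : HasFDerivAt (S.gaugeTerm a Ω (n + 1)) _ y := h4
  rw [h5.fderiv, smul_apply, smul_apply, smul_smul,
    mul_inv_cancel₀ (Nat.cast_ne_zero.2 n.succ_ne_zero), one_smul]
  by_cases hn : n = 0
  · simp [hn, add_comm]
  · simp [hn, add_comm]

/-- The coefficient of `τ ^ n` in the curvature of the gauge transform by `exp (τ a)`. -/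
noncomputable def curvatureTerm (a : V → L) (Ω : V → V →L[ℂ] L) (n : ℕ) (y u v : V) : L :=
  fderiv ℂ (S.gaugeTerm a Ω n) y u v - fderiv ℂ (S.gaugeTerm a Ω n) y v u +
    ∑ p ∈ Finset.HasAntidiagonal.antidiagonal n,
      S.br (S.gaugeTerm a Ω p.1 y u) (S.gaugeTerm a Ω p.2 y v)

/-- The curvature `R` of the gauge transform by `exp (τ a)` satisfies `∂R/∂τ = [a, R]`. -/
theorem smul_curvatureTerm_succ {a : V → L} {Ω : V → V →L[ℂ] L} {y : V}
    (ha : ContDiffAt ℂ ω a y) (hΩ : ContDiffAt ℂ ω Ω y) (n : ℕ) (u v : V) :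
    ((n + 1 : ℕ) : ℂ) • S.curvatureTerm a Ω (n + 1) y u v =
      S.br (a y) (S.curvatureTerm a Ω n y u v) := by
  set G := S.gaugeTerm a Ω with hG
  have h1 : ∀ p ∈ Finset.HasAntidiagonal.antidiagonal (n + 1),
      ((n + 1 : ℕ) : ℂ) • S.br (G p.1 y u) (G p.2 y v) =
      S.br ((p.1 : ℂ) • G p.1 y u) (G p.2 y v) + S.br (G p.1 y u) ((p.2 : ℂ) • G p.2 y v) := by
    intro p hp
    rw [← Finset.HasAntidiagonal.mem_antidiagonal.1 hp, map_smul, map_smul, smul_apply, ← add_smul]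
    push_cast
    rfl
  have h2 : ∑ p ∈ Finset.HasAntidiagonal.antidiagonal (n + 1),
      S.br ((p.1 : ℂ) • G p.1 y u) (G p.2 y v) =
      ∑ p ∈ Finset.HasAntidiagonal.antidiagonal n, S.br (S.br (a y) (G p.1 y u)) (G p.2 y v) -
        S.br (fderiv ℂ a y u) (G n y v) := by
    rw [Finset.Nat.antidiagonal_succ, Finset.sum_cons, Finset.sum_map]
    simp only [Nat.cast_zero, zero_smul, map_zero, zero_apply, zero_add]
    have h3 : ∀ p ∈ Finset.HasAntidiagonal.antidiagonal n,
        S.br (((p.1 + 1 : ℕ) : ℂ) • G (p.1 + 1) y u) (G p.2 y v) =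
        S.br (S.br (a y) (G p.1 y u)) (G p.2 y v) -
          (if p = (0, n) then S.br (fderiv ℂ a y u) (G n y v) else 0) := by
      rintro ⟨i, j⟩ hp
      rw [hG, S.smul_gaugeTerm_succ]
      rw [Finset.HasAntidiagonal.mem_antidiagonal] at hp
      rcases Nat.eq_zero_or_pos i with rfl | hi
      · obtain rfl : j = n := by simpa using hp
        simp
      · simp [hi.ne']
    refine (Finset.sum_congr rfl h3).trans ?_
    rw [Finset.sum_sub_distrib, Finset.sum_ite_eq' ]
    simp
  have h3 : ∑ p ∈ Finset.HasAntidiagonal.antidiagonal (n + 1),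
      S.br (G p.1 y u) ((p.2 : ℂ) • G p.2 y v) =
      ∑ p ∈ Finset.HasAntidiagonal.antidiagonal n, S.br (G p.1 y u) (S.br (a y) (G p.2 y v)) -
        S.br (G n y u) (fderiv ℂ a y v) := by
    rw [Finset.Nat.antidiagonal_succ', Finset.sum_cons, Finset.sum_map]
    simp only [Nat.cast_zero, zero_smul, map_zero, zero_add]
    have h3 : ∀ p ∈ Finset.HasAntidiagonal.antidiagonal n,
        S.br (G p.1 y u) (((p.2 + 1 : ℕ) : ℂ) • G (p.2 + 1) y v) =
        S.br (G p.1 y u) (S.br (a y) (G p.2 y v)) -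
          (if p = (n, 0) then S.br (G n y u) (fderiv ℂ a y v) else 0) := by
      rintro ⟨i, j⟩ hp
      rw [hG, S.smul_gaugeTerm_succ]
      rw [Finset.HasAntidiagonal.mem_antidiagonal] at hp
      rcases Nat.eq_zero_or_pos j with rfl | hj
      · obtain rfl : i = n := by simpa using hp
        simp
      · simp [hj.ne']
    refine (Finset.sum_congr rfl h3).trans ?_
    rw [Finset.sum_sub_distrib, Finset.sum_ite_eq' ]
    simp
  have h4 : S.br (a y) (∑ p ∈ Finset.HasAntidiagonal.antidiagonal n, S.br (G p.1 y u) (G p.2 y v)) =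
      ∑ p ∈ Finset.HasAntidiagonal.antidiagonal n, S.br (S.br (a y) (G p.1 y u)) (G p.2 y v) +
      ∑ p ∈ Finset.HasAntidiagonal.antidiagonal n, S.br (G p.1 y u) (S.br (a y) (G p.2 y v)) := by
    rw [map_sum, ← Finset.sum_add_distrib]
    exact Finset.sum_congr rfl fun p _ => S.jacobi _ _ _
  rw [curvatureTerm, curvatureTerm, smul_add, smul_sub, S.fderiv_gaugeTerm_succ ha hΩ,
    S.fderiv_gaugeTerm_succ ha hΩ, Finset.smul_sum, Finset.sum_congr rfl h1,
    Finset.sum_add_distrib, h2, h3, map_add, map_sub, h4, ha.fderiv_fderiv_symm u v,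
    S.br_antisymm (G n y u) (fderiv ℂ a y v)]
  abel

theorem curvatureTerm_eq_zero {a : V → L} {Ω : V → V →L[ℂ] L} {y : V}
    (ha : ContDiffAt ℂ ω a y) (hΩ : ContDiffAt ℂ ω Ω y) (u v : V)
    (h : S.curvature Ω y u v = 0) (n : ℕ) : S.curvatureTerm a Ω n y u v = 0 := by
  induction n with
  | zero => simpa [curvatureTerm, curvature, gaugeTerm] using h
  | succ n ih =>
    have h1 := S.smul_curvatureTerm_succ ha hΩ n u v
    rw [ih, map_zero] at h1
    exact (smul_eq_zero.1 h1).resolve_left (Nat.cast_ne_zero.2 n.succ_ne_zero)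

end ProlongedAlgebra

/-! ### Gauge transformations -/

namespace ProlongedAlgebra

variable {V : Type*} [NormedAddCommGroup V] [NormedSpace ℂ V]
  {𝔤 : Submodule ℂ (V →L[ℂ] V)} {L : Type*} [NormedAddCommGroup L] [NormedSpace ℂ L]
  (S : ProlongedAlgebra 𝔤 L)

theorem gaugeTerm_succ_succ_mem {a : V → L} {Ω : V → V →L[ℂ] L} {y : V} {i j n : ℕ}
    (haF : a y ∈ S.Fil (i + 1)) (h : ∀ u, S.gaugeTerm a Ω (n + 1) y u ∈ S.Fil j) (u : V) :
    S.gaugeTerm a Ω (n + 2) y u ∈ S.Fil (i + j) := by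
  have h1 : S.br (a y) (S.gaugeTerm a Ω (n + 1) y u) ∈ S.Fil (i + j) :=
    S.br_mem_left haF (h u)
  refine (S.Fil (i + j)).smul_mem _ ((S.Fil (i + j)).sub_mem h1 ?_)
  simp

section Gauge

variable [FiniteDimensional ℂ L]

theorem fderiv_mem_Fil {a : V → L} {k : ℕ} {y : V} (ha : ContDiffAt ℂ ω a y)
    (h : ∀ᶠ z in 𝓝 y, a z ∈ S.Fil k) (u : V) : fderiv ℂ a y u ∈ S.Fil k :=
  fderiv_mem_of_eventually_mem (S.Fil k) ha.differentiableAt_omega h u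

theorem gaugeTerm_one_mem {a : V → L} {Ω : V → V →L[ℂ] L} {y : V} {k : ℕ}
    (ha : ContDiffAt ℂ ω a y) (haF : ∀ᶠ z in 𝓝 y, a z ∈ S.Fil (k + 1)) (u : V) :
    S.gaugeTerm a Ω 1 y u ∈ S.Fil k := by
  have h1 : S.br (a y) (S.gaugeTerm a Ω 0 y u) ∈ S.Fil (k + 0) :=
    S.br_mem_left haF.self_of_nhds (S.Fil_zero _)
  exact (S.Fil k).smul_mem _ ((S.Fil k).sub_mem h1
    (S.Fil_anti k.le_succ (S.fderiv_mem_Fil ha haF u)))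

/-- A gauge transformation by the exponential of an element `a` of filtration degree at least `2`
preserves flatness, and changes a flat form `Ω` by `[a, Ω]` modulo higher order terms. The
exponential series is finite because `a` acts nilpotently. -/
theorem exists_gauge_transform {a : V → L} {Ω : V → V →L[ℂ] L} {y₀ : V} {k : ℕ} (hk : 1 ≤ k)
    (ha : ContDiffAt ℂ ω a y₀) (hΩ : ContDiffAt ℂ ω Ω y₀)
    (haF : ∀ᶠ y in 𝓝 y₀, a y ∈ S.Fil (k + 1))
    (hflat : ∀ᶠ y in 𝓝 y₀, ∀ u v, S.curvature Ω y u v = 0) :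
    ∃ Ω' : V → V →L[ℂ] L, ContDiffAt ℂ ω Ω' y₀ ∧ ∀ᶠ y in 𝓝 y₀,
      (∀ u v, S.curvature Ω' y u v = 0) ∧
      ∀ u, Ω' y u - Ω y u - S.br (a y) (Ω y u) ∈ S.Fil (k + 1) := by
  set M := S.order + 2 with hM
  set G := S.gaugeTerm a Ω with hG
  refine ⟨fun y => ∑ n ∈ Finset.range M, G n y,
    ContDiffAt.sum fun n _ => S.contDiffAt_gaugeTerm ha hΩ n, ?_⟩
  -- `a` has degree at least `2`, so each bracket with `a` raises the filtration degree.
  have hvanish : ∀ᶠ y in 𝓝 y₀, ∀ n, M ≤ n → G n y = 0 := by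
    filter_upwards [ha.eventually_omega, haF.eventually_nhds] with y hay hyF n hn
    have hmem : ∀ n u, G (n + 1) y u ∈ S.Fil (n + 1) := by
      intro n
      induction n with
      | zero => exact fun u => S.Fil_anti hk (S.gaugeTerm_one_mem hay hyF u)
      | succ n ih =>
        intro u
        have h := S.gaugeTerm_succ_succ_mem
          (S.Fil_anti (show 1 + 1 ≤ k + 1 by omega) hyF.self_of_nhds) ih u
        rwa [add_comm 1 (n + 1)] at h
    obtain ⟨m, rfl⟩ : ∃ m, n = m + 1 := ⟨n - 1, by omega⟩
    ext u
    exact S.Fil_order _ (S.Fil_anti (by omega) (hmem m u))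
  filter_upwards [ha.eventually_omega, haF.eventually_nhds, hΩ.eventually_omega, hflat,
    hvanish.eventually_nhds] with y hay hyF hΩy hfl hv
  constructor
  · intro u v
    have hGd : ∀ n, HasFDerivAt (G n) (fderiv ℂ (G n) y) y := fun n =>
      (S.contDiffAt_gaugeTerm hay hΩy n).differentiableAt_omega.hasFDerivAt
    have hsum : fderiv ℂ (fun y => ∑ n ∈ Finset.range M, G n y) y =
        ∑ n ∈ Finset.range M, fderiv ℂ (G n) y :=
      (HasFDerivAt.fun_sum fun n _ => hGd n).fderiv
    have hGz : ∀ n, M ≤ n → fderiv ℂ (G n) y = 0 := by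
      intro n hn
      have h1 : G n =ᶠ[𝓝 y] fun _ => 0 := hv.mono fun z hz => hz n hn
      rw [h1.fderiv_eq, fderiv_fun_const]
      rfl
    have h1 : ∀ u v, ∑ n ∈ Finset.range M, fderiv ℂ (G n) y u v =
        ∑ n ∈ Finset.range (2 * M), fderiv ℂ (G n) y u v := by
      intro u v
      refine Finset.sum_subset (Finset.range_mono (by omega)) fun n _ hn => ?_
      rw [hGz n (by simpa using hn)]
      rfl
    have h2 : S.br (∑ n ∈ Finset.range M, G n y u) (∑ n ∈ Finset.range M, G n y v) =
        ∑ n ∈ Finset.range (2 * M), ∑ p ∈ Finset.HasAntidiagonal.antidiagonal n,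
          S.br (G p.1 y u) (G p.2 y v) := by
      have h3 : S.br (∑ n ∈ Finset.range M, G n y u) (∑ n ∈ Finset.range M, G n y v) =
          ∑ p ∈ Finset.range M ×ˢ Finset.range M, S.br (G p.1 y u) (G p.2 y v) := by
        rw [Finset.sum_product, map_sum S.br, sum_apply]
        exact Finset.sum_congr rfl fun i _ => map_sum _ _ _
      rw [h3, ← Finset.sum_fiberwise_of_maps_to (g := fun p : ℕ × ℕ => p.1 + p.2)
        (t := Finset.range (2 * M))]
      · refine Finset.sum_congr rfl fun n _ => Finset.sum_subset ?_ ?_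
        · intro p hp
          simp only [Finset.mem_filter] at hp
          simpa using hp.2
        · rintro ⟨i, j⟩ hp hp'
          rw [Finset.HasAntidiagonal.mem_antidiagonal] at hp
          simp only [Finset.mem_filter, Finset.mem_product, Finset.mem_range, not_and] at hp'
          rcases lt_or_ge i M with hi | hi
          · rcases lt_or_ge j M with hj | hj
            · exact absurd hp (hp' ⟨hi, hj⟩)
            · simp [hv.self_of_nhds j hj]
          · simp [hv.self_of_nhds i hi]
      · intro p hp
        simp only [Finset.mem_product, Finset.mem_range] at hp ⊢
        omega
    rw [curvature, hsum]
    simp only [sum_apply]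
    rw [h1, h1, h2, ← Finset.sum_sub_distrib, ← Finset.sum_add_distrib]
    exact Finset.sum_eq_zero fun n _ => S.curvatureTerm_eq_zero hay hΩy u v (hfl u v) n
  · intro u
    have hmem : ∀ n u, G (n + 2) y u ∈ S.Fil (k + 1) := by
      have h1 : ∀ n u, G (n + 1) y u ∈ S.Fil k := by
        intro n
        induction n with
        | zero => exact S.gaugeTerm_one_mem hay hyF
        | succ n ih =>
          exact fun u => S.Fil_anti (by omega)
            (S.gaugeTerm_succ_succ_mem hyF.self_of_nhds ih u)
      exact fun n u => S.Fil_anti (by omega)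
        (S.gaugeTerm_succ_succ_mem hyF.self_of_nhds (h1 n) u)
    have h2 : G 1 y u = S.br (a y) (Ω y u) - fderiv ℂ a y u := by
      have h := S.smul_gaugeTerm_succ a Ω 0 y u
      rw [show S.gaugeTerm a Ω 0 = Ω from rfl] at h
      simpa using h
    have h3 : (∑ n ∈ Finset.range M, G n y) u - Ω y u - S.br (a y) (Ω y u) =
        ∑ n ∈ Finset.range S.order, G (n + 2) y u - fderiv ℂ a y u := by
      rw [sum_apply, hM, Finset.sum_range_succ', Finset.sum_range_succ', h2]
      simp only [G, gaugeTerm]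
      abel
    rw [h3]
    exact (S.Fil _).sub_mem ((S.Fil _).sum_mem fun n _ => hmem n u) (S.fderiv_mem_Fil hay hyF u)

end Gauge

/-! ### Linear sections of the Spencer coboundary -/

section Normalization

/-- A linear map on a vector space has a linear section over its range. -/
theorem exists_linear_section {A B : Type*} [AddCommGroup A] [Module ℂ A] [AddCommGroup B]
    [Module ℂ B] (f : A →ₗ[ℂ] B) : ∃ g : B →ₗ[ℂ] A, ∀ x, f (g (f x)) = f x := by
  obtain ⟨g, hg⟩ := f.rangeRestrict.exists_rightInverse_of_surjective f.range_rangeRestrict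
  obtain ⟨g', hg'⟩ := g.exists_extend
  refine ⟨g', fun x => ?_⟩
  have h1 : g' (f x) = g (f.rangeRestrict x) := by
    rw [← hg']; rfl
  rw [h1]
  exact congrArg Subtype.val (congrArg (fun T => T (f.rangeRestrict x)) hg)

/-- The 1-forms with values in the `k`-th filtration step. -/
def filHom (k : ℕ) : Submodule ℂ (V →L[ℂ] L) where
  carrier := {β | ∀ v, β v ∈ S.Fil k}
  zero_mem' := fun _ => (S.Fil k).zero_mem
  add_mem' := fun hα hβ v => (S.Fil k).add_mem (hα v) (hβ v)
  smul_mem' := fun c _ hβ v => (S.Fil k).smul_mem c (hβ v)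

/-- The bilinear forms with values in the `k`-th filtration step. -/
def filHom₂ (k : ℕ) : Submodule ℂ (V →L[ℂ] V →L[ℂ] L) where
  carrier := {ρ | ∀ u v, ρ u v ∈ S.Fil k}
  zero_mem' := fun _ _ => (S.Fil k).zero_mem
  add_mem' := fun hα hβ u v => (S.Fil k).add_mem (hα u v) (hβ u v)
  smul_mem' := fun c _ hβ u v => (S.Fil k).smul_mem c (hβ u v)

/-- The Spencer coboundary of `β`: the bilinear form `(u, v) ↦ [u, β v] - [v, β u]`. -/
noncomputable def spencer : (V →L[ℂ] L) →ₗ[ℂ] (V →L[ℂ] V →L[ℂ] L) where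
  toFun β := ((ContinuousLinearMap.compL ℂ V L L).flip β) ∘L S.br ∘L S.const -
    (((ContinuousLinearMap.compL ℂ V L L).flip β) ∘L S.br ∘L S.const).flip
  map_add' α β := by ext; simp; abel
  map_smul' c β := by ext; simp [smul_sub]

theorem spencer_apply (β : V →L[ℂ] L) (u v : V) :
    S.spencer β u v = S.br (S.const u) (β v) - S.br (S.const v) (β u) := by
  simp [spencer]

variable [FiniteDimensional ℂ V] [FiniteDimensional ℂ L]

/-- A linear choice of the element of the prolongation in `exact_const`. -/
theorem exists_prolongation_section {k : ℕ} (hk : 1 ≤ k) :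
    ∃ κ : (V →L[ℂ] L) →L[ℂ] L, ∀ γ ∈ S.filHom k, S.spencer γ ∈ S.filHom₂ k →
      κ γ ∈ S.Fil (k + 1) ∧ ∀ v, γ v - S.br (κ γ) (S.const v) ∈ S.Fil (k + 1) := by
  let f₀ : L →ₗ[ℂ] (V →L[ℂ] L) :=
    { toFun := fun a => S.br a ∘L S.const
      map_add' := fun a b => by ext; simp
      map_smul' := fun c a => by ext; simp }
  let f : S.Fil (k + 1) →ₗ[ℂ] (V →L[ℂ] L) ⧸ S.filHom (k + 1) :=
    (S.filHom (k + 1)).mkQ ∘ₗ f₀ ∘ₗ (S.Fil (k + 1)).subtype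
  obtain ⟨g, hg⟩ := exists_linear_section f
  let κ : (V →L[ℂ] L) →ₗ[ℂ] L := (S.Fil (k + 1)).subtype ∘ₗ g ∘ₗ (S.filHom (k + 1)).mkQ
  refine ⟨LinearMap.toContinuousLinearMap κ, fun γ hγ hγ' => ⟨(g _).2, ?_⟩⟩
  obtain ⟨a, ha, haγ⟩ := S.exact_const k hk γ.toLinearMap hγ
    (fun u v => by simpa [spencer_apply] using hγ' u v)
  have h1 : (S.filHom (k + 1)).mkQ γ = f ⟨a, ha⟩ :=
    (Submodule.Quotient.eq _).2 haγ
  have h2 : (S.filHom (k + 1)).mkQ γ = f (g ((S.filHom (k + 1)).mkQ γ)) := by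
    rw [h1, hg]
  exact (Submodule.Quotient.eq _).1 h2

/-- A linear choice of a solution `β` of the equation `[u, β v] - [v, β u] = -ρ(u, v)` modulo the
`k`-th filtration step, whenever it is solvable. -/
theorem exists_spencer_section (k : ℕ) :
    ∃ Λ : (V →L[ℂ] V →L[ℂ] L) →L[ℂ] (V →L[ℂ] L), ∀ ρ, Λ ρ ∈ S.filHom k ∧
      ∀ β ∈ S.filHom k, ρ + S.spencer β ∈ S.filHom₂ k → ρ + S.spencer (Λ ρ) ∈ S.filHom₂ k := by
  let f : S.filHom k →ₗ[ℂ] (V →L[ℂ] V →L[ℂ] L) ⧸ S.filHom₂ (V := V) k :=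
    (S.filHom₂ k).mkQ ∘ₗ S.spencer ∘ₗ (S.filHom k).subtype
  obtain ⟨g, hg⟩ := exists_linear_section f
  let Λ : (V →L[ℂ] V →L[ℂ] L) →ₗ[ℂ] (V →L[ℂ] L) :=
    -((S.filHom k).subtype ∘ₗ g ∘ₗ (S.filHom₂ k).mkQ)
  refine ⟨LinearMap.toContinuousLinearMap Λ, fun ρ =>
    ⟨(S.filHom k).neg_mem (g _).2, fun β hβ h => ?_⟩⟩
  have h1 : (S.filHom₂ k).mkQ ρ = f (-⟨β, hβ⟩) := by
    refine (Submodule.Quotient.eq _).2 ?_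
    simpa using h
  have h2 : (S.filHom₂ k).mkQ ρ = f (g ((S.filHom₂ k).mkQ ρ)) := by rw [h1, hg]
  have h3 := (Submodule.Quotient.eq _).1 h2
  have h4 : LinearMap.toContinuousLinearMap Λ ρ = -(g ((S.filHom₂ k).mkQ ρ) : V →L[ℂ] L) := rfl
  rw [h4, map_neg, ← sub_eq_add_neg]
  exact h3

/-- The curvature of the restriction to a slice `{t} × V` of a family of 1-forms is an analytic
function on `ℂ × V`. -/
noncomputable def sliceCurvature (Ω : ℂ × V → V →L[ℂ] L) (z : ℂ × V) : V →L[ℂ] V →L[ℂ] L :=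
  (fderiv ℂ Ω z ∘L ContinuousLinearMap.inr ℂ ℂ V) -
    (fderiv ℂ Ω z ∘L ContinuousLinearMap.inr ℂ ℂ V).flip +
  (ContinuousLinearMap.compL ℂ V L L).flip (Ω z) ∘L S.br ∘L Ω z

omit [FiniteDimensional ℂ V] [FiniteDimensional ℂ L] in
theorem fderiv_slice {W : Type*} [NormedAddCommGroup W] [NormedSpace ℂ W] {f : ℂ × V → W}
    {z : ℂ × V} (hf : DifferentiableAt ℂ f z) (u : V) :
    fderiv ℂ (fun y => f (z.1, y)) z.2 u = fderiv ℂ f z (0, u) := by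
  have h1 : HasFDerivAt (fun y : V => (z.1, y)) (ContinuousLinearMap.inr ℂ ℂ V) z.2 :=
    hasFDerivAt_prodMk_right z.1 z.2
  have h2 : HasFDerivAt (fun y => f (z.1, y)) _ z.2 :=
    HasFDerivAt.comp (f := fun y : V => (z.1, y)) z.2 hf.hasFDerivAt h1
  rw [h2.fderiv]
  rfl

omit [FiniteDimensional ℂ V] [FiniteDimensional ℂ L] in
theorem sliceCurvature_apply {Ω : ℂ × V → V →L[ℂ] L} {z : ℂ × V} (hΩ : ContDiffAt ℂ ω Ω z)
    (u v : V) :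
    S.sliceCurvature Ω z u v = S.curvature (fun y => Ω (z.1, y)) z.2 u v := by
  rw [curvature, fderiv_slice hΩ.differentiableAt_omega, fderiv_slice hΩ.differentiableAt_omega]
  rfl

omit [FiniteDimensional ℂ V] [FiniteDimensional ℂ L] in
theorem contDiffAt_sliceCurvature {Ω : ℂ × V → V →L[ℂ] L} {z : ℂ × V} (hΩ : ContDiffAt ℂ ω Ω z) :
    ContDiffAt ℂ ω (S.sliceCurvature Ω) z := by
  have h1 : ContDiffAt ℂ ω (fun z => fderiv ℂ Ω z ∘L ContinuousLinearMap.inr ℂ ℂ V) z :=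
    hΩ.fderiv_omega.clm_comp contDiffAt_const
  have hflip : ContDiff ℂ ω (fun x : V →L[ℂ] V →L[ℂ] L => x.flip) :=
    (ContinuousLinearMap.flipₗᵢ ℂ V V L).contDiff (𝕜 := ℂ) (E := V →L[ℂ] V →L[ℂ] L)
      (F := V →L[ℂ] V →L[ℂ] L)
  have h2 : ContDiffAt ℂ ω
      (fun z => (fderiv ℂ Ω z ∘L ContinuousLinearMap.inr ℂ ℂ V).flip) z :=
    hflip.contDiffAt.comp z h1
  exact (h1.sub h2).add ((contDiffAt_const.clm_apply hΩ).clm_comp (contDiffAt_const.clm_comp hΩ))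

end Normalization

end ProlongedAlgebra

/-! ### Normalization of flat forms -/

namespace ProlongedAlgebra

variable {V : Type*} [NormedAddCommGroup V] [NormedSpace ℂ V]
  {𝔤 : Submodule ℂ (V →L[ℂ] V)} {L : Type*} [NormedAddCommGroup L] [NormedSpace ℂ L]
  (S : ProlongedAlgebra 𝔤 L)

section Normalization

variable [FiniteDimensional ℂ V] [FiniteDimensional ℂ L]

/-- The family of coframes `θ` (the left inverse of the family of frames `s`) extends, up to the
`k`-th filtration step, to an analytic family of flat forms away from `t = 0`: the form `Ω` is
analytic also at `t = 0`, and locally on each slice with `t ≠ 0` it agrees with a flat form modulo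
the `k`-th step. -/
def ApproxFlat (θ : ℂ × V → V →L[ℂ] V) (z₀ : ℂ × V) (k : ℕ) : Prop :=
  ∃ Ω : ℂ × V → V →L[ℂ] L, ContDiffAt ℂ ω Ω z₀ ∧ (∀ᶠ z in 𝓝 z₀, ∀ u, S.ev (Ω z u) = θ z u) ∧
    ∀ᶠ z in 𝓝 z₀, z.1 ≠ 0 → ∃ Ω' : V → V →L[ℂ] L, ContDiffAt ℂ ω Ω' z.2 ∧
      ∀ᶠ y in 𝓝 z.2, (∀ u v, S.curvature Ω' y u v = 0) ∧ ∀ u, Ω' y u - Ω (z.1, y) u ∈ S.Fil k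

omit [FiniteDimensional ℂ V] in
/-- The equation satisfied modulo the `k`-th filtration step by the difference of a form and a flat
form with which it agrees modulo that step. -/
theorem spencer_of_flat {Ω Ω' : V → V →L[ℂ] L} {y : V} {k : ℕ} (hk : 1 ≤ k)
    {s θ : V →L[ℂ] V} (hs : ∀ v, θ (s v) = v) (hΩ : ContDiffAt ℂ ω Ω y)
    (hΩ' : ContDiffAt ℂ ω Ω' y) (hθ : ∀ u, S.ev (Ω y u) = θ u)
    (hflat : ∀ u v, S.curvature Ω' y u v = 0)
    (hcongr : ∀ᶠ z in 𝓝 y, ∀ u, Ω' z u - Ω z u ∈ S.Fil k) (u v : V) :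
    S.curvature Ω y (s u) (s v) + S.spencer ((Ω' y - Ω y) ∘L s) u v ∈ S.Fil k := by
  have hd : ∀ u v, fderiv ℂ Ω' y u v - fderiv ℂ Ω y u v ∈ S.Fil k := by
    intro u v
    have h1 := S.fderiv_mem_Fil ((hΩ'.sub hΩ).clm_apply (contDiffAt_const (c := v)))
      (hcongr.mono fun z hz => hz v) u
    have h2 : HasFDerivAt (fun z => (Ω' z - Ω z) v) _ y :=
      (hΩ'.differentiableAt_omega.hasFDerivAt.sub
        hΩ.differentiableAt_omega.hasFDerivAt).clm_apply (hasFDerivAt_const v y)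
    have h3 : fderiv ℂ (fun z => (Ω' z - Ω z) v) y u =
        fderiv ℂ Ω' y u v - fderiv ℂ Ω y u v := by
      rw [h2.fderiv]
      simp
    rw [← h3]
    exact h1
  set β := (Ω' y - Ω y) ∘L s with hβ
  have hβk : ∀ v, β v ∈ S.Fil k := fun v => hcongr.self_of_nhds (s v)
  have h0 : ∀ v, Ω y (s v) - S.const v ∈ S.Fil 1 := by
    intro v
    rw [S.Fil_one, map_sub, hθ, hs, S.ev_const, sub_self]
  have h1 : ∀ u v, S.br (Ω y (s u) - S.const u) (β v) ∈ S.Fil k := by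
    intro u v
    have := S.br_mem_left (i := 0) (h0 u) (hβk v)
    rwa [zero_add] at this
  have h2 : S.br (β u) (β v) ∈ S.Fil k := by
    obtain ⟨j, rfl⟩ : ∃ j, k = j + 1 := ⟨k - 1, by omega⟩
    exact S.Fil_anti (by omega) (S.br_mem_left (hβk u) (hβk v))
  have h3 := hflat (s u) (s v)
  have h4 : ∀ v, Ω' y (s v) = Ω y (s v) + β v := by
    intro v
    simp [hβ]
  have h5 : S.curvature Ω y (s u) (s v) + S.spencer β u v =
      -((fderiv ℂ Ω' y (s u) (s v) - fderiv ℂ Ω y (s u) (s v)) -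
        (fderiv ℂ Ω' y (s v) (s u) - fderiv ℂ Ω y (s v) (s u)) +
        S.br (Ω y (s u) - S.const u) (β v) - S.br (Ω y (s v) - S.const v) (β u) +
        S.br (β u) (β v)) := by
    rw [curvature, h4, h4] at h3
    rw [curvature, spencer_apply]
    simp only [map_add, map_sub, add_apply, sub_apply] at h3 ⊢
    rw [S.br_antisymm (β u) (Ω y (s v))] at h3
    linear_combination (norm := module) h3
  rw [h5]
  exact (S.Fil k).neg_mem ((S.Fil k).add_mem ((S.Fil k).sub_mem ((S.Fil k).add_mem
    ((S.Fil k).sub_mem (hd _ _) (hd _ _)) (h1 u v)) (h1 v u)) h2)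

/-- The inductive step in the construction of a flat form: the next term is determined, up to the
choice of a complement of the prolongation, by the curvature; the choice is adjusted by a gauge
transformation of the flat forms at `t ≠ 0`. -/
theorem ApproxFlat.succ {θ s : ℂ × V → V →L[ℂ] V} {z₀ : ℂ × V} {k : ℕ} (hk : 1 ≤ k)
    (hs : ContDiffAt ℂ ω s z₀) (hθ : ContDiffAt ℂ ω θ z₀)
    (hθs : ∀ᶠ z in 𝓝 z₀, (∀ v, θ z (s z v) = v) ∧ ∀ v, s z (θ z v) = v)
    (h : S.ApproxFlat θ z₀ k) : S.ApproxFlat θ z₀ (k + 1) := by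
  obtain ⟨Ω, hΩ, hev, hflat⟩ := h
  obtain ⟨Λ, hΛ⟩ := S.exists_spencer_section k
  obtain ⟨κ, hκ⟩ := S.exists_prolongation_section hk
  -- The curvature with respect to the frame `s`.
  let ρ : ℂ × V → V →L[ℂ] V →L[ℂ] L := fun z =>
    (ContinuousLinearMap.compL ℂ V V L).flip (s z) ∘L S.sliceCurvature Ω z ∘L s z
  have hρ : ContDiffAt ℂ ω ρ z₀ :=
    (contDiffAt_const.clm_apply hs).clm_comp ((S.contDiffAt_sliceCurvature hΩ).clm_comp hs)
  let Ω₁ : ℂ × V → V →L[ℂ] L := fun z => Ω z + Λ (ρ z) ∘L θ z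
  have hΩ₁ : ContDiffAt ℂ ω Ω₁ z₀ :=
    hΩ.add ((contDiffAt_const.clm_apply hρ).clm_comp hθ)
  refine ⟨Ω₁, hΩ₁, ?_, ?_⟩
  · filter_upwards [hev] with z hz u
    have h1 : S.ev (Λ (ρ z) (θ z u)) = 0 :=
      (S.Fil_one _).1 (S.Fil_anti hk ((hΛ (ρ z)).1 _))
    simp [Ω₁, h1, hz]
  · filter_upwards [hflat, hΩ.eventually_omega.eventually_nhds, hΩ₁.eventually_omega,
      hev.eventually_nhds, hθs.eventually_nhds, hs.eventually_omega] with
      z hz hΩz hΩ₁z hevz hθsz hsz hz0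
    obtain ⟨Ω', hΩ', hΩ'2⟩ := hz hz0
    have ht : Tendsto (fun y : V => (z.1, y)) (𝓝 z.2) (𝓝 z) :=
      (Continuous.prodMk_right z.1).tendsto z.2
    have hslice : ContDiffAt ℂ ω (fun y : V => (z.1, y)) z.2 := by fun_prop
    let γ : V → V →L[ℂ] L := fun y => (Ω' y - Ω₁ (z.1, y)) ∘L s (z.1, y)
    have hγ : ContDiffAt ℂ ω γ z.2 := by
      refine ContDiffAt.clm_comp (hΩ'.sub ?_) ?_
      · exact ContDiffAt.comp (f := fun y : V => (z.1, y)) z.2 hΩ₁z hslice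
      · exact ContDiffAt.comp (f := fun y : V => (z.1, y)) z.2 hsz hslice
    have hγ2 : ∀ᶠ y in 𝓝 z.2, γ y ∈ S.filHom k ∧ S.spencer (γ y) ∈ S.filHom₂ k := by
      filter_upwards [hΩ'2.eventually_nhds, ht.eventually hΩz, hΩ'.eventually_omega,
        ht.eventually hevz, ht.eventually hθsz] with y hy hΩy hΩ'y hevy hθsy
      let β : V →L[ℂ] L := (Ω' y - Ω (z.1, y)) ∘L s (z.1, y)
      have hβ : β ∈ S.filHom k := fun v => hy.self_of_nhds.2 _
      have hρβ : ρ (z.1, y) + S.spencer β ∈ S.filHom₂ k := by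
        intro u v
        have h1 := S.spencer_of_flat (Ω := fun y => Ω (z.1, y)) (Ω' := Ω') (y := y) hk hθsy.1
          (ContDiffAt.comp (f := fun y : V => (z.1, y)) y hΩy (by fun_prop)) hΩ'y hevy
          (fun u v => hy.self_of_nhds.1 u v) (hy.mono fun y hy => hy.2) u v
        rwa [← S.sliceCurvature_apply (z := (z.1, y)) hΩy] at h1
      have h2 := (hΛ (ρ (z.1, y))).2 β hβ hρβ
      have h3 : γ y = β - Λ (ρ (z.1, y)) := by
        ext v
        simp [γ, β, Ω₁, hθsy.1]
        abel
      refine ⟨?_, ?_⟩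
      · rw [h3]
        exact (S.filHom k).sub_mem hβ (hΛ _).1
      · have h4 : S.spencer (γ y) = (ρ (z.1, y) + S.spencer β) -
            (ρ (z.1, y) + S.spencer (Λ (ρ (z.1, y)))) := by
          rw [h3, map_sub]
          abel
        rw [h4]
        exact (S.filHom₂ k).sub_mem hρβ h2
    have ha : ContDiffAt ℂ ω (fun y => -κ (γ y)) z.2 :=
      (contDiffAt_const.clm_apply hγ).neg
    obtain ⟨Ω'', hΩ'', h''⟩ := S.exists_gauge_transform hk ha hΩ'
      (hγ2.mono fun y hy => (S.Fil _).neg_mem (hκ _ hy.1 hy.2).1)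
      (hΩ'2.mono fun y hy => hy.1)
    refine ⟨Ω'', hΩ'', ?_⟩
    filter_upwards [h'', hγ2, ht.eventually hθsz, ht.eventually hevz, hΩ'2] with
      y hy hγy hθsy hevy hΩ'y
    refine ⟨hy.1, fun u => ?_⟩
    have h1 := (hκ _ hγy.1 hγy.2).2 (θ (z.1, y) u)
    have h2 : γ y (θ (z.1, y) u) = Ω' y u - Ω₁ (z.1, y) u := by
      simp [γ, hθsy.2]
    have h3 : S.br (κ (γ y)) (Ω' y u - S.const (θ (z.1, y) u)) ∈ S.Fil (k + 1) := by
      refine S.br_mem_left (hκ _ hγy.1 hγy.2).1 ?_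
      have h4 : S.ev (Ω' y u - Ω (z.1, y) u) = 0 :=
        (S.Fil_one _).1 (S.Fil_anti hk (hΩ'y.2 u))
      rw [map_sub, sub_eq_zero] at h4
      rw [S.Fil_one, map_sub, h4, hevy, S.ev_const, sub_self]
    have h5 : Ω'' y u - Ω₁ (z.1, y) u = (Ω'' y u - Ω' y u - S.br (-κ (γ y)) (Ω' y u)) +
        (γ y (θ (z.1, y) u) - S.br (κ (γ y)) (S.const (θ (z.1, y) u))) -
        S.br (κ (γ y)) (Ω' y u - S.const (θ (z.1, y) u)) := by
      rw [h2]
      simp only [map_neg, neg_apply, map_sub]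
      abel
    rw [h5]
    exact (S.Fil _).sub_mem ((S.Fil _).add_mem (hy.2 u) h1) h3

/-- If the members with `t ≠ 0` of an analytic family of coframes extend locally to flat forms, then
so does the member with `t = 0`. -/
theorem exists_flat_form_zero {θ s : ℂ × V → V →L[ℂ] V} {y₀ : V}
    (hs : ContDiffAt ℂ ω s (0, y₀)) (hθ : ContDiffAt ℂ ω θ (0, y₀))
    (hθs : ∀ᶠ z in 𝓝 ((0 : ℂ), y₀), (∀ v, θ z (s z v) = v) ∧ ∀ v, s z (θ z v) = v)
    (h : ∀ᶠ z in 𝓝 ((0 : ℂ), y₀), z.1 ≠ 0 → ∃ Ω : V → V →L[ℂ] L, ContDiffAt ℂ ω Ω z.2 ∧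
      ∀ᶠ y in 𝓝 z.2, (∀ u v, S.curvature Ω y u v = 0) ∧ ∀ u, S.ev (Ω y u) = θ (z.1, y) u) :
    ∃ Ω : V → V →L[ℂ] L, ContDiffAt ℂ ω Ω y₀ ∧
      ∀ᶠ y in 𝓝 y₀, (∀ u v, S.curvature Ω y u v = 0) ∧ ∀ u, S.ev (Ω y u) = θ (0, y) u := by
  have hall : ∀ k, S.ApproxFlat θ (0, y₀) (k + 1) := by
    intro k
    induction k with
    | zero =>
      refine ⟨fun z => S.const ∘L θ z, contDiffAt_const.clm_comp hθ,
        Eventually.of_forall fun z u => S.ev_const _, ?_⟩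
      filter_upwards [h] with z hz hz0
      obtain ⟨Ω, hΩ, hΩ2⟩ := hz hz0
      refine ⟨Ω, hΩ, hΩ2.mono fun y hy => ⟨hy.1, fun u => (S.Fil_one _).2 ?_⟩⟩
      simp [hy.2, S.ev_const]
    | succ k ih => exact ih.succ S (by omega) hs hθ hθs
  obtain ⟨Ω, hΩ, hev, hflat⟩ := hall S.order
  have hslice : ContDiffAt ℂ ω (fun y : V => ((0 : ℂ), y)) y₀ := by fun_prop
  have ht : Tendsto (fun y : V => ((0 : ℂ), y)) (𝓝 y₀) (𝓝 (0, y₀)) :=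
    hslice.continuousAt.tendsto
  refine ⟨fun y => Ω (0, y), ContDiffAt.comp (f := fun y : V => ((0 : ℂ), y)) y₀ hΩ hslice, ?_⟩
  have hcurv : ∀ᶠ z in 𝓝 ((0 : ℂ), y₀), z.1 ≠ 0 → S.sliceCurvature Ω z = 0 := by
    filter_upwards [hflat, hΩ.eventually_omega] with z hz hΩz hz0
    obtain ⟨Ω', -, hΩ'2⟩ := hz hz0
    have h1 : (fun y => Ω (z.1, y)) =ᶠ[𝓝 z.2] Ω' := by
      filter_upwards [hΩ'2] with y hy
      ext u
      exact (sub_eq_zero.1 (S.Fil_order _ (S.Fil_anti S.order.le_succ (hy.2 u)))).symm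
    ext u v
    rw [S.sliceCurvature_apply hΩz, curvature, h1.fderiv_eq, h1.eq_of_nhds]
    exact hΩ'2.self_of_nhds.1 u v
  filter_upwards [ht.eventually hev, ht.eventually hcurv.eventually_nhds,
    ht.eventually hΩ.eventually_omega] with y hy hcy hΩy
  refine ⟨fun u v => ?_, hy⟩
  rw [← S.sliceCurvature_apply (z := ((0 : ℂ), y)) hΩy]
  -- The curvature vanishes for `t ≠ 0`, hence by continuity for `t = 0`.
  have h1 : Tendsto (fun t : ℂ => (t, y)) (𝓝[≠] 0) (𝓝 ((0 : ℂ), y)) :=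
    ((Continuous.prodMk_left y).tendsto (0 : ℂ)).mono_left nhdsWithin_le_nhds
  have h2 : Tendsto (fun t : ℂ => S.sliceCurvature Ω (t, y)) (𝓝[≠] 0)
      (𝓝 (S.sliceCurvature Ω (0, y))) :=
    (S.contDiffAt_sliceCurvature hΩy).continuousAt.tendsto.comp h1
  have h3 : Tendsto (fun t : ℂ => S.sliceCurvature Ω (t, y)) (𝓝[≠] 0) (𝓝 0) := by
    refine tendsto_const_nhds.congr' ?_
    filter_upwards [h1.eventually hcy, self_mem_nhdsWithin] with t ht ht0
    exact (ht ht0).symm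
  rw [tendsto_nhds_unique h2 h3]
  rfl

end Normalization

end ProlongedAlgebra

/-! ### Maps into a Lie subgroup that need not be closed -/

section ImmersedSubgroup

/-- A subspace of a finite-dimensional space has a complement, parametrised by `ℂⁿ`. -/
theorem Submodule.exists_clm_complement {W : Type*} [NormedAddCommGroup W] [NormedSpace ℂ W]
    [FiniteDimensional ℂ W] (K : Submodule ℂ W) :
    ∃ (n : ℕ) (j : (Fin n → ℂ) →L[ℂ] W) (ρ : W →L[ℂ] Fin n → ℂ),
      (∀ c, ρ (j c) = c) ∧ ∀ w, ρ w = 0 ↔ w ∈ K := by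
  obtain ⟨C, hC⟩ := K.exists_isCompl
  let e : C ≃ₗ[ℂ] (Fin (Module.finrank ℂ C) → ℂ) := (Module.finBasis ℂ C).equivFun
  refine ⟨_, LinearMap.toContinuousLinearMap (C.subtype ∘ₗ e.symm.toLinearMap),
    LinearMap.toContinuousLinearMap (e.toLinearMap ∘ₗ C.projectionOnto K hC.symm),
    fun c => ?_, fun w => ?_⟩
  · simp
  · simp

variable {V : Type*} [NormedAddCommGroup V] [NormedSpace ℂ V]
  {F : Type*} [NormedAddCommGroup F] [NormedSpace ℂ F]
  {E : Type*} [NormedAddCommGroup E] [NormedSpace ℂ E]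

/-- The germ `κ` at `0` of an analytic immersion is a local parametrisation at the identity of a
Lie subgroup `G` of `GL(V)` with Lie algebra `𝔤`. The clause `countable_cover` records that the
topology of the Lie group has a countable base: `G` is covered by countably many translates of the
image of any neighbourhood of `0`. -/
structure IsSubgroupChart (G : Subgroup (V →L[ℂ] V)ˣ) (𝔤 : Submodule ℂ (V →L[ℂ] V))
    (κ : F → V →L[ℂ] V) : Prop where
  contDiffAt : ContDiffAt ℂ ω κ 0
  apply_zero : κ 0 = 1
  injective : Function.Injective (fderiv ℂ κ 0)
  exists_fderiv_eq : ∀ A ∈ 𝔤, ∃ ξ, fderiv ℂ κ 0 ξ = A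
  fderiv_mem : ∀ᶠ x in 𝓝 0, ∀ ξ, ∃ A ∈ 𝔤, fderiv ℂ κ x ξ = κ x * A
  mem : ∀ᶠ x in 𝓝 0, ∃ g ∈ G, (g : V →L[ℂ] V) = κ x
  countable_cover : ∀ N ∈ 𝓝 (0 : F), ∃ C : Set (V →L[ℂ] V)ˣ, C.Countable ∧
    ∀ g ∈ G, ∃ p ∈ C, ∃ x ∈ N, (g : V →L[ℂ] V) = p * κ x

variable [FiniteDimensional ℂ V] [FiniteDimensional ℂ F]
  {G : Subgroup (V →L[ℂ] V)ˣ} {𝔤 : Submodule ℂ (V →L[ℂ] V)} {κ : F → V →L[ℂ] V}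

/-- Near `0`, the parameter of a point of the subgroup chart is an analytic function `ν` of (the
image under a linear map of) that point. -/
theorem IsSubgroupChart.exists_retraction (hκ : IsSubgroupChart G 𝔤 κ) :
    ∃ (Λ : (V →L[ℂ] V) →L[ℂ] F) (ν : F → F),
      ∀ᶠ x in 𝓝 0, ν (Λ (κ x)) = x ∧ ContDiffAt ℂ ω ν (Λ (κ x)) := by
  obtain ⟨Λ₀, hΛ₀⟩ := (fderiv ℂ κ 0).toLinearMap.exists_leftInverse_of_injective
    (LinearMap.ker_eq_bot.2 hκ.injective)
  let Λ : (V →L[ℂ] V) →L[ℂ] F := LinearMap.toContinuousLinearMap Λ₀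
  have h1 : ContDiffAt ℂ ω (fun x => Λ (κ x)) 0 := contDiffAt_const.clm_apply hκ.contDiffAt
  have h2 : HasFDerivAt (fun x => Λ (κ x))
      ((ContinuousLinearEquiv.refl ℂ F : F ≃L[ℂ] F) : F →L[ℂ] F) 0 := by
    have h3 : HasFDerivAt (fun x => Λ (κ x)) (Λ ∘L fderiv ℂ κ 0) 0 :=
      Λ.hasFDerivAt.comp (0 : F) hκ.contDiffAt.differentiableAt_omega.hasFDerivAt
    convert h3 using 1
    ext x
    exact (congrArg (fun T => T x) hΛ₀).symm
  have h0 : (ω : WithTop ℕ∞) ≠ 0 := by simp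
  refine ⟨Λ, h1.localInverse h2 h0, ?_⟩
  filter_upwards [(h1.hasStrictFDerivAt' h2 h0).eventually_left_inverse,
    h1.continuousAt.eventually (h1.to_localInverse h2 h0).eventually_omega] with x hx hx'
  exact ⟨hx, hx'⟩

/-- An analytic map into `GL(V)` with values in a Lie subgroup has its logarithmic derivative in the
Lie algebra, even if the subgroup is not closed: by Baire's theorem, on a dense open set the map
takes its values locally in a compact piece of the subgroup. -/
theorem IsSubgroupChart.exists_fderiv_eq_mul [FiniteDimensional ℂ E]
    (hκ : IsSubgroupChart G 𝔤 κ) {f : E → V →L[ℂ] V} {y₀ : E} (hf : ContDiffAt ℂ ω f y₀)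
    (hfG : ∀ᶠ y in 𝓝 y₀, ∃ g ∈ G, (g : V →L[ℂ] V) = f y)
    (ξ : E) : ∃ A ∈ 𝔤, fderiv ℂ f y₀ ξ = f y₀ * A := by
  obtain ⟨Λ, ν, hν⟩ := hκ.exists_retraction
  obtain ⟨ε, hε, hεN⟩ := Metric.nhds_basis_closedBall.eventually_iff.1
    (hν.and (hκ.fderiv_mem.and hκ.contDiffAt.eventually_omega))
  obtain ⟨r, hr, hrN⟩ := Metric.nhds_basis_closedBall.eventually_iff.1
    (hf.eventually_omega.and hfG)
  obtain ⟨C, hC, hCG⟩ := hκ.countable_cover _ (Metric.closedBall_mem_nhds 0 hε)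
  have hcompact : IsCompact (Metric.closedBall (0 : F) ε) := by
    have := FiniteDimensional.proper ℂ F
    exact isCompact_closedBall _ _
  have hκc : ContinuousOn κ (Metric.closedBall (0 : F) ε) := fun x hx =>
    (hεN hx).2.2.continuousAt.continuousWithinAt
  have hfc : ContinuousOn f (Metric.closedBall y₀ r) := fun y hy =>
    (hrN hy).1.continuousAt.continuousWithinAt
  -- Closed sets on which `f` takes its values in one compact piece of the subgroup; the extra set
  -- for `none` makes them a cover of the whole space.
  let Z : Option C → Set E := fun o => o.elim {y | r ≤ dist y y₀} fun p =>
    Metric.closedBall y₀ r ∩ f ⁻¹' ((fun x => (p : (V →L[ℂ] V)ˣ) * κ x) '' Metric.closedBall 0 ε)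
  have hZ : ∀ o, IsClosed (Z o) := by
    rintro (_ | p)
    · exact isClosed_le continuous_const (continuous_id.dist continuous_const)
    · refine hfc.preimage_isClosed_of_isClosed Metric.isClosed_closedBall ?_
      exact (hcompact.image_of_continuousOn (continuousOn_const.mul hκc)).isClosed
  have hZU : ⋃ o, Z o = univ := by
    refine eq_univ_of_forall fun y => mem_iUnion.2 ?_
    rcases le_or_gt r (dist y y₀) with h | h
    · exact ⟨none, h⟩
    · have hy : y ∈ Metric.closedBall y₀ r := h.le
      obtain ⟨g, hg, hgy⟩ := (hrN hy).2
      obtain ⟨p, hp, x, hx, hpx⟩ := hCG g hg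
      exact ⟨some ⟨p, hp⟩, hy, x, hx, by rw [← hgy, hpx]⟩
  have : Countable C := hC.to_subtype
  have := FiniteDimensional.complete ℂ E
  have hdense : Dense (⋃ o, interior (Z o)) := dense_iUnion_interior_of_closed hZ hZU
  have hgood : ∀ y ∈ Metric.ball y₀ r, y ∈ ⋃ o, interior (Z o) →
      ∃ A ∈ 𝔤, fderiv ℂ f y ξ = f y * A := by
    intro y hy hyZ
    obtain ⟨o, ho⟩ := mem_iUnion.1 hyZ
    rcases o with _ | p
    · have h1 : y ∈ Z none := interior_subset ho
      exact absurd (show r ≤ dist y y₀ from h1) (not_le.2 hy)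
    · set P : (V →L[ℂ] V)ˣ := (p : (V →L[ℂ] V)ˣ) with hP
      have h1 : ∀ᶠ z in 𝓝 y, ∃ x ∈ Metric.closedBall (0 : F) ε, P * κ x = f z := by
        filter_upwards [isOpen_interior.mem_nhds ho] with z hz
        exact (interior_subset hz).2
      have h2 : (fun z => (↑P⁻¹ : V →L[ℂ] V) * f z) =ᶠ[𝓝 y]
          fun z => κ (ν (Λ ((↑P⁻¹ : V →L[ℂ] V) * f z))) := by
        filter_upwards [h1] with z ⟨x, hx, hxz⟩
        rw [← hxz, ← mul_assoc, Units.inv_mul, one_mul, (hεN hx).1.1]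
      obtain ⟨x, hx, hxy⟩ := h1.self_of_nhds
      have h3 : (↑P⁻¹ : V →L[ℂ] V) * f y = κ x := by
        rw [← hxy, ← mul_assoc, Units.inv_mul, one_mul]
      have hfy := (hrN (Metric.ball_subset_closedBall hy)).1
      have h4 : HasFDerivAt (fun z => (↑P⁻¹ : V →L[ℂ] V) * f z)
          ((ContinuousLinearMap.mul ℂ (V →L[ℂ] V) (↑P⁻¹ : V →L[ℂ] V)) ∘L fderiv ℂ f y) y :=
        (ContinuousLinearMap.mul ℂ (V →L[ℂ] V) (↑P⁻¹ : V →L[ℂ] V)).hasFDerivAt.comp y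
          hfy.differentiableAt_omega.hasFDerivAt
      have h5 : HasFDerivAt (fun z => ν (Λ ((↑P⁻¹ : V →L[ℂ] V) * f z)))
          (fderiv ℂ ν (Λ (κ x)) ∘L Λ ∘L
            (ContinuousLinearMap.mul ℂ (V →L[ℂ] V) (↑P⁻¹ : V →L[ℂ] V)) ∘L fderiv ℂ f y) y := by
        refine HasFDerivAt.comp (g := ν) y ?_ (Λ.hasFDerivAt.comp y h4)
        show HasFDerivAt ν (fderiv ℂ ν (Λ (κ x))) (Λ ((↑P⁻¹ : V →L[ℂ] V) * f y))
        rw [h3]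
        exact (hεN hx).1.2.differentiableAt_omega.hasFDerivAt
      have h6 : HasFDerivAt (fun z => κ (ν (Λ ((↑P⁻¹ : V →L[ℂ] V) * f z))))
          (fderiv ℂ κ x ∘L fderiv ℂ ν (Λ (κ x)) ∘L Λ ∘L
            (ContinuousLinearMap.mul ℂ (V →L[ℂ] V) (↑P⁻¹ : V →L[ℂ] V)) ∘L fderiv ℂ f y) y := by
        refine HasFDerivAt.comp (g := κ) y ?_ h5
        show HasFDerivAt κ (fderiv ℂ κ x) (ν (Λ ((↑P⁻¹ : V →L[ℂ] V) * f y)))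
        rw [h3, (hεN hx).1.1]
        exact (hεN hx).2.2.differentiableAt_omega.hasFDerivAt
      have h7 := congrArg (fun T => T ξ) (h4.unique (h6.congr_of_eventuallyEq h2))
      obtain ⟨A, hA, hAx⟩ := (hεN hx).2.1 (fderiv ℂ ν (Λ (κ x))
        (Λ ((↑P⁻¹ : V →L[ℂ] V) * fderiv ℂ f y ξ)))
      refine ⟨A, hA, ?_⟩
      have h8 : (↑P⁻¹ : V →L[ℂ] V) * fderiv ℂ f y ξ = κ x * A := h7.trans hAx
      rw [← hxy, mul_assoc, ← h8, ← mul_assoc, Units.mul_inv, one_mul]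
  obtain ⟨π, hπ, -⟩ := 𝔤.exists_clm_projection
  obtain ⟨g₀, -, hg₀⟩ := hfG.self_of_nhds
  -- The logarithmic derivative lies in `𝔤` on a dense set, hence by continuity at `y₀`.
  have hcont : ContinuousAt (fun y => π (Ring.inverse (f y) * fderiv ℂ f y ξ)) y₀ := by
    have h1 : ContinuousAt (Ring.inverse (M₀ := V →L[ℂ] V)) (f y₀) := by
      rw [← hg₀]; exact NormedRing.inverse_continuousAt g₀
    have h2 : ContinuousAt (fun y => fderiv ℂ f y ξ) y₀ :=
      hf.fderiv_omega.continuousAt.clm_apply continuousAt_const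
    have h3 : ContinuousAt (fun y => Ring.inverse (f y)) y₀ :=
      ContinuousAt.comp (g := Ring.inverse) h1 hf.continuousAt
    exact π.continuous.continuousAt.comp (h3.mul h2)
  have hzero : π (Ring.inverse (f y₀) * fderiv ℂ f y₀ ξ) = 0 := by
    have h1 : y₀ ∈ closure (Metric.ball y₀ r ∩ ⋃ o, interior (Z o)) :=
      (hdense.open_subset_closure_inter Metric.isOpen_ball) (Metric.mem_ball_self hr)
    have h2 : ∀ y ∈ Metric.ball y₀ r ∩ ⋃ o, interior (Z o),
        π (Ring.inverse (f y) * fderiv ℂ f y ξ) ∈ ({0} : Set (V →L[ℂ] V)) := by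
      rintro y ⟨hy, hyZ⟩
      obtain ⟨A, hA, hAy⟩ := hgood y hy hyZ
      obtain ⟨g, -, hg⟩ := (hrN (Metric.ball_subset_closedBall hy)).2
      rw [mem_singleton_iff, hAy, ← mul_assoc, ← hg, Ring.inverse_unit, Units.inv_mul, one_mul]
      exact (hπ A).2 hA
    have h3 := hcont.continuousWithinAt.mem_closure h1 h2
    rwa [closure_singleton] at h3
  refine ⟨_, (hπ _).1 hzero, ?_⟩
  rw [← mul_assoc, ← hg₀, Ring.inverse_unit, Units.mul_inv, one_mul]

/-- The Lie algebra is stable under the adjoint action of the subgroup. -/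
theorem IsSubgroupChart.conj_mem (hκ : IsSubgroupChart G 𝔤 κ) {p : (V →L[ℂ] V)ˣ} (hp : p ∈ G)
    {A : V →L[ℂ] V} (hA : A ∈ 𝔤) : (p : V →L[ℂ] V) * A * (↑p⁻¹ : V →L[ℂ] V) ∈ 𝔤 := by
  obtain ⟨ξ, rfl⟩ := hκ.exists_fderiv_eq A hA
  have h1 : HasFDerivAt κ (fderiv ℂ κ 0) 0 := hκ.contDiffAt.differentiableAt_omega.hasFDerivAt
  have h2 : HasFDerivAt (fun x => (p : V →L[ℂ] V) * κ x * (↑p⁻¹ : V →L[ℂ] V)) _ 0 :=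
    (h1.const_mul (p : V →L[ℂ] V)).mul_const' (↑p⁻¹ : V →L[ℂ] V)
  obtain ⟨B, hB, hB'⟩ := hκ.exists_fderiv_eq_mul
    (f := fun x => (p : V →L[ℂ] V) * κ x * (↑p⁻¹ : V →L[ℂ] V)) (y₀ := 0)
    ((contDiffAt_const.mul hκ.contDiffAt).mul contDiffAt_const) (by
      filter_upwards [hκ.mem] with x ⟨g, hg, hgx⟩
      exact ⟨p * g * p⁻¹, G.mul_mem (G.mul_mem hp hg) (G.inv_mem hp), by simp [hgx]⟩) ξ
  rw [h2.fderiv] at hB'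
  simp [hκ.apply_zero] at hB'
  rwa [hB']

/-- The Lie algebra of a Lie subgroup is closed under commutators. -/
theorem IsSubgroupChart.lie_mem (hκ : IsSubgroupChart G 𝔤 κ) {A B : V →L[ℂ] V}
    (hA : A ∈ 𝔤) (hB : B ∈ 𝔤) : A * B - B * A ∈ 𝔤 := by
  obtain ⟨ξ, rfl⟩ := hκ.exists_fderiv_eq A hA
  have hκ' : HasFDerivAt κ (fderiv ℂ κ 0) 0 := hκ.contDiffAt.differentiableAt_omega.hasFDerivAt
  let c : F → V →L[ℂ] V := fun x => κ x * B * Ring.inverse (κ x)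
  have hinv : ContDiffAt ℂ ω (fun x => Ring.inverse (κ x)) 0 := by
    refine ContDiffAt.comp (g := Ring.inverse) (0 : F) ?_ hκ.contDiffAt
    rw [hκ.apply_zero]
    exact contDiffAt_ringInverse ℂ (R := V →L[ℂ] V) 1
  have hc : ContDiffAt ℂ ω c 0 := (hκ.contDiffAt.mul contDiffAt_const).mul hinv
  have hc0 : c 0 = B := by simp [c, hκ.apply_zero]
  have h1 : fderiv ℂ c 0 ξ ∈ 𝔤 := by
    refine fderiv_mem_of_eventually_mem 𝔤 hc.differentiableAt_omega ?_ ξ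
    filter_upwards [hκ.mem] with x ⟨g, hg, hgx⟩
    have := hκ.conj_mem hg hB
    simpa [c, ← hgx] using this
  have h2 : (fun x => κ x * B) =ᶠ[𝓝 0] fun x => c x * κ x := by
    filter_upwards [hκ.mem] with x ⟨g, hg, hgx⟩
    simp [c, ← hgx, mul_assoc]
  have h3 : HasFDerivAt (fun x => c x * κ x) _ 0 :=
    hc.differentiableAt_omega.hasFDerivAt.mul' hκ'
  have h4 := congrArg (fun T => T ξ) ((hκ'.mul_const' B).unique (h3.congr_of_eventuallyEq h2))
  change fderiv ℂ κ 0 ξ * B = c 0 * fderiv ℂ κ 0 ξ + fderiv ℂ c 0 ξ * κ 0 at h4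
  rw [h4, hc0, hκ.apply_zero, mul_one, add_sub_cancel_left]
  exact h1

/-- An analytic map into `GL(V)` through the identity whose right logarithmic derivative has values
in the Lie algebra takes its values in the Lie subgroup. In the product coordinates
`κ(x) (1 + c)`, with `c` in a complement of the Lie algebra, the component `c` is constant. -/
theorem IsSubgroupChart.eventually_mem (hκ : IsSubgroupChart G 𝔤 κ) {g : E → V →L[ℂ] V} {y₀ : E}
    (hg : ContDiffAt ℂ ω g y₀) (hg0 : g y₀ = 1)
    (hd : ∀ᶠ y in 𝓝 y₀, ∀ ξ, ∃ B ∈ 𝔤, fderiv ℂ g y ξ = B * g y) :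
    ∀ᶠ y in 𝓝 y₀, ∃ p ∈ G, (p : V →L[ℂ] V) = g y := by
  obtain ⟨n, j, ρ, hρj, hρ⟩ := 𝔤.exists_clm_complement
  let Θ : F × (Fin n → ℂ) → V →L[ℂ] V := fun z => κ z.1 * (1 + j z.2)
  have hκ1 : ContDiffAt ℂ ω (fun z : F × (Fin n → ℂ) => κ z.1) 0 :=
    ContDiffAt.comp (g := κ) (0 : F × (Fin n → ℂ)) hκ.contDiffAt contDiffAt_fst
  have hc1 : ContDiffAt ℂ ω (fun z : F × (Fin n → ℂ) => 1 + j z.2) 0 := by fun_prop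
  have hΘ : ContDiffAt ℂ ω Θ 0 := hκ1.mul hc1
  let T : F × (Fin n → ℂ) →L[ℂ] (V →L[ℂ] V) := (fderiv ℂ κ 0).coprod j
  have hΘ' : HasFDerivAt Θ T 0 := by
    have h1 : HasFDerivAt (fun z : F × (Fin n → ℂ) => κ z.1)
        (fderiv ℂ κ 0 ∘L ContinuousLinearMap.fst ℂ F (Fin n → ℂ)) 0 :=
      HasFDerivAt.comp (g := κ) (f := Prod.fst) (0 : F × (Fin n → ℂ))
        hκ.contDiffAt.differentiableAt_omega.hasFDerivAt hasFDerivAt_fst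
    have h2 : HasFDerivAt (fun z : F × (Fin n → ℂ) => 1 + j z.2)
        (j ∘L ContinuousLinearMap.snd ℂ F (Fin n → ℂ)) 0 :=
      (j.hasFDerivAt.comp (f := Prod.snd) (0 : F × (Fin n → ℂ)) hasFDerivAt_snd).const_add 1
    refine (h1.mul' h2).congr_fderiv (ContinuousLinearMap.ext fun z => ?_)
    change κ 0 * j z.2 + fderiv ℂ κ 0 z.1 * (1 + j 0) = fderiv ℂ κ 0 z.1 + j z.2
    rw [hκ.apply_zero, map_zero, add_zero, one_mul, mul_one, add_comm]
  have hT : Function.Bijective T := by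
    constructor
    · rw [injective_iff_map_eq_zero]
      rintro ⟨x, c⟩ h
      have h0 : fderiv ℂ κ 0 x + j c = 0 := h
      have h1 : fderiv ℂ κ 0 x ∈ 𝔤 := by
        obtain ⟨A, hA, hA'⟩ := hκ.fderiv_mem.self_of_nhds x
        rwa [hA', hκ.apply_zero, one_mul]
      have h2 := congrArg ρ h0
      rw [map_add, (hρ _).2 h1, zero_add, hρj, map_zero] at h2
      rw [h2, map_zero, add_zero] at h0
      rw [h2, hκ.injective (h0.trans (map_zero _).symm)]
      rfl
    · intro w
      have h1 : w - j (ρ w) ∈ 𝔤 := by rw [← hρ, map_sub, hρj, sub_self]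
      obtain ⟨ξ, hξ⟩ := hκ.exists_fderiv_eq _ h1
      exact ⟨(ξ, ρ w), by simp [T, hξ]⟩
  let T' : (F × (Fin n → ℂ)) ≃L[ℂ] (V →L[ℂ] V) :=
    (LinearEquiv.ofBijective T.toLinearMap hT).toContinuousLinearEquiv
  have hT' : (T' : F × (Fin n → ℂ) →L[ℂ] (V →L[ℂ] V)) = T := rfl
  have hΘT : HasFDerivAt Θ (T' : F × (Fin n → ℂ) →L[ℂ] (V →L[ℂ] V)) 0 := by
    rw [hT']; exact hΘ'
  have hω : (ω : WithTop ℕ∞) ≠ 0 := by simp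
  have hΘ0 : Θ 0 = g y₀ := by simp [Θ, hκ.apply_zero, hg0]
  let ν := hΘ.localInverse hΘT hω
  have hν : ContDiffAt ℂ ω ν (g y₀) := by
    rw [← hΘ0]; exact hΘ.to_localInverse hΘT hω
  have hν0 : ν (g y₀) = 0 := by
    rw [← hΘ0]; exact hΘ.localInverse_apply_image hΘT hω
  have hright : ∀ᶠ w in 𝓝 (g y₀), Θ (ν w) = w := by
    rw [← hΘ0]
    exact (hΘ.hasStrictFDerivAt' hΘT hω).eventually_right_inverse
  let x : E → F := fun y => (ν (g y)).1
  let c : E → Fin n → ℂ := fun y => (ν (g y)).2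
  have hνg : ContDiffAt ℂ ω (fun y => ν (g y)) y₀ := hν.comp y₀ hg
  have hx : ContDiffAt ℂ ω x y₀ := hνg.fst
  have hc : ContDiffAt ℂ ω c y₀ := hνg.snd
  have hx0 : x y₀ = 0 := by simp [x, hν0]
  have hc0 : c y₀ = 0 := by simp [c, hν0]
  have hxt : Tendsto x (𝓝 y₀) (𝓝 0) := by simpa [hx0] using hx.continuousAt.tendsto
  have hgeq : ∀ᶠ y in 𝓝 y₀, g y = κ (x y) * (1 + j (c y)) := by
    filter_upwards [hg.continuousAt.eventually hright] with y hy
    exact hy.symm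
  have hsmall : ∀ᶠ y in 𝓝 y₀, (‖j ∘L ρ‖ + 1) * ‖j (c y)‖ < 1 := by
    have h1 : ContinuousAt (fun y => (‖j ∘L ρ‖ + 1) * ‖j (c y)‖) y₀ :=
      continuousAt_const.mul (j.continuous.continuousAt.comp hc.continuousAt).norm
    refine h1.eventually_lt continuousAt_const ?_
    simp [hc0]
  have hcd : ∀ᶠ y in 𝓝 y₀, fderiv ℂ c y = 0 := by
    filter_upwards [hgeq.eventually_nhds, hsmall, hd, hx.eventually_omega, hc.eventually_omega,
      hxt.eventually (hκ.mem.and (hκ.fderiv_mem.and hκ.contDiffAt.eventually_omega))] with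
      y hy hsm hdy hxy hcy ⟨⟨p, hp, hpx⟩, hκd, hκa⟩
    ext1 ξ
    obtain ⟨B, hB, hBg⟩ := hdy ξ
    have h1 : HasFDerivAt (fun y => κ (x y)) (fderiv ℂ κ (x y) ∘L fderiv ℂ x y) y :=
      HasFDerivAt.comp (g := κ) y hκa.differentiableAt_omega.hasFDerivAt
        hxy.differentiableAt_omega.hasFDerivAt
    have h2 : HasFDerivAt (fun y => 1 + j (c y)) (j ∘L fderiv ℂ c y) y :=
      (j.hasFDerivAt.comp y hcy.differentiableAt_omega.hasFDerivAt).const_add 1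
    have h3 : HasFDerivAt g _ y := (h1.mul' h2).congr_of_eventuallyEq hy
    obtain ⟨A, hA, hAx⟩ := hκd (fderiv ℂ x y ξ)
    have h4 : fderiv ℂ g y ξ = p * j (fderiv ℂ c y ξ) + p * A * (1 + j (c y)) := by
      rw [h3.fderiv]
      simp [hAx, hpx]
    rw [hBg, hy.self_of_nhds, ← hpx] at h4
    have hB' := hκ.conj_mem (G.inv_mem hp) hB
    rw [inv_inv] at hB'
    set D : V →L[ℂ] V := (↑p⁻¹ : V →L[ℂ] V) * B * p - A with hD
    have hDg : D ∈ 𝔤 := 𝔤.sub_mem hB' hA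
    have h5 : j (fderiv ℂ c y ξ) = D * (1 + j (c y)) := by
      have h6 := congrArg (fun w => (↑p⁻¹ : V →L[ℂ] V) * w) h4
      simp only [mul_add (↑p⁻¹ : V →L[ℂ] V), ← mul_assoc, Units.inv_mul, one_mul] at h6
      rw [hD, sub_mul, h6]
      abel
    have h6 : fderiv ℂ c y ξ = ρ (D * j (c y)) := by
      rw [← hρj (fderiv ℂ c y ξ), h5, mul_add, mul_one, map_add, (hρ D).2 hDg, zero_add]
    have h7 : D = (j ∘L ρ) (D * j (c y)) - D * j (c y) := by
      rw [ContinuousLinearMap.comp_apply, ← h6, h5]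
      simp [mul_add]
    -- `c` is small, so that `D` vanishes.
    have h9 : ‖D‖ ≤ (‖j ∘L ρ‖ + 1) * ‖j (c y)‖ * ‖D‖ := by
      calc ‖D‖ = ‖(j ∘L ρ) (D * j (c y)) - D * j (c y)‖ := congrArg norm h7
        _ ≤ ‖(j ∘L ρ) (D * j (c y))‖ + ‖D * j (c y)‖ := norm_sub_le _ _
        _ ≤ ‖j ∘L ρ‖ * ‖D * j (c y)‖ + ‖D * j (c y)‖ := by
          gcongr; exact (j ∘L ρ).le_opNorm _
        _ = (‖j ∘L ρ‖ + 1) * ‖D * j (c y)‖ := by ring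
        _ ≤ (‖j ∘L ρ‖ + 1) * (‖D‖ * ‖j (c y)‖) := by gcongr; exact norm_mul_le _ _
        _ = (‖j ∘L ρ‖ + 1) * ‖j (c y)‖ * ‖D‖ := by ring
    have h10 : D = 0 := by
      by_contra h
      have := norm_pos_iff.2 h
      nlinarith
    rw [h6, h10, zero_mul, map_zero]
    rfl
  obtain ⟨r, hr, hrN⟩ := Metric.eventually_nhds_iff_ball.1 (hcd.and hc.eventually_omega)
  filter_upwards [hgeq, hxt.eventually hκ.mem, Metric.ball_mem_nhds y₀ hr] with
    y hy ⟨p, hp, hpx⟩ hyr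
  have h1 : c y = c y₀ := Metric.isOpen_ball.is_const_of_fderiv_eq_zero (𝕜 := ℂ)
    (convex_ball y₀ r).isPreconnected
    (fun z hz => (hrN z hz).2.differentiableAt_omega.differentiableWithinAt)
    (fun z hz => (hrN z hz).1) hyr (Metric.mem_ball_self hr)
  exact ⟨p, hp, by rw [hy, h1, hc0, map_zero, add_zero, mul_one, hpx]⟩

end ImmersedSubgroup

/-! ### Integration of a flat form with invertible soldering part -/

section Integration

variable {E : Type*} [NormedAddCommGroup E] [NormedSpace ℂ E]
  {W : Type*} [NormedAddCommGroup W] [NormedSpace ℂ W]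

/-- Uniqueness for linear total differential equations, uniformly in a family of solutions. -/
theorem eventually_eq_zero_of_fderiv_eq {ι : Type*} {A : E → E →L[ℂ] W →L[ℂ] W} {y₀ : E}
    (hA : ContDiffAt ℂ ω A y₀) {Z : ι → E → W} (hZ0 : ∀ i, Z i y₀ = 0)
    (hZ : ∀ᶠ y in 𝓝 y₀, ∀ i, DifferentiableAt ℂ (Z i) y ∧
      ∀ u, fderiv ℂ (Z i) y u = A y u (Z i y)) :
    ∀ᶠ y in 𝓝 y₀, ∀ i, Z i y = 0 := by
  obtain ⟨δ, hδ, hball⟩ := Metric.eventually_nhds_iff_ball.1 (hZ.and hA.eventually_omega)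
  filter_upwards [Metric.ball_mem_nhds y₀ hδ] with y hy i
  set w := y - y₀ with hw
  have hmem : ∀ τ ∈ Icc (0 : ℝ) 1, (τ : ℂ) • w + y₀ ∈ Metric.ball y₀ δ := by
    intro τ hτ
    rw [mem_ball_iff_norm] at hy ⊢
    refine lt_of_le_of_lt ?_ hy
    rw [add_sub_cancel_right, norm_smul, Complex.norm_real, Real.norm_eq_abs, abs_of_nonneg hτ.1]
    exact mul_le_of_le_one_left (norm_nonneg _) hτ.2
  have hray : ∀ τ : ℝ, HasDerivAt (fun τ : ℝ => (τ : ℂ) • w + y₀) w τ := fun τ =>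
    (hasDerivAt_ofReal_smul w τ).add_const y₀
  let J : ℝ → W := fun τ => Z i ((τ : ℂ) • w + y₀)
  have hJ : ∀ τ ∈ Icc (0 : ℝ) 1, HasDerivAt J (A ((τ : ℂ) • w + y₀) w (J τ)) τ := by
    intro τ hτ
    obtain ⟨h1, h2⟩ := (hball _ (hmem τ hτ)).1 i
    rw [← h2]
    exact (h1.hasFDerivAt.restrictScalars ℝ).comp_hasDerivAt τ (hray τ)
  have hcont : ContinuousOn (fun τ : ℝ => A ((τ : ℂ) • w + y₀) w) (Icc 0 1) := by
    intro τ hτ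
    have h1 := (hball _ (hmem τ hτ)).2.continuousAt
    exact ((ContinuousAt.comp (f := fun τ : ℝ => (τ : ℂ) • w + y₀) h1
      (hray τ).continuousAt).clm_apply continuousAt_const).continuousWithinAt
  obtain ⟨C, hC⟩ := isCompact_Icc.exists_bound_of_continuousOn hcont
  have hzero := eq_zero_of_abs_deriv_le_mul_abs_self_of_eq_zero_right
    (f := J) (f' := fun τ => A ((τ : ℂ) • w + y₀) w (J τ)) (K := C) (a := 0) (b := 1)
    (fun τ hτ => (hJ τ hτ).continuousAt.continuousWithinAt)
    (fun τ hτ => (hJ τ ⟨hτ.1, hτ.2.le⟩).hasDerivWithinAt) (by simp [J, hZ0])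
    (fun τ hτ => ((A ((τ : ℂ) • w + y₀) w).le_opNorm _).trans
      (by gcongr; exact hC τ ⟨hτ.1, hτ.2.le⟩)) 1 (by simp)
  simpa [J, w] using hzero

/-- `exists_flat_section` for the connection induced on `W` by a form with values in `B` and a
linear map `K` from `B` to the endomorphisms of `W`. -/
theorem exists_flat_section_of_clm {B : Type*} [NormedAddCommGroup B] [NormedSpace ℂ B]
    [CompleteSpace W] (K : B →L[ℂ] W →L[ℂ] W) {Ω : E → E →L[ℂ] B} {y₀ : E}
    (hΩ : ContDiffAt ℂ ω Ω y₀)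
    (hflat : ∀ᶠ y in 𝓝 y₀, ∀ u v, K (fderiv ℂ Ω y u v - fderiv ℂ Ω y v u) =
      K (Ω y u) ∘L K (Ω y v) - K (Ω y v) ∘L K (Ω y u)) (x₀ : W) :
    ∃ X : E → W, ContDiffAt ℂ ω X y₀ ∧ X y₀ = x₀ ∧
      ∀ᶠ y in 𝓝 y₀, ∀ u, fderiv ℂ X y u = K (Ω y u) (X y) := by
  have hA : ContDiffAt ℂ ω (fun y => K ∘L Ω y) y₀ := contDiffAt_const.clm_comp hΩ
  refine exists_flat_section hA ?_ x₀
  filter_upwards [hflat, hΩ.eventually_omega] with y hy hΩy u v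
  have h1 : HasFDerivAt (fun y => K ∘L Ω y) _ y :=
    (hasFDerivAt_const K y).clm_comp hΩy.differentiableAt_omega.hasFDerivAt
  have h2 : ∀ u v, fderiv ℂ (fun y => K ∘L Ω y) y u v = K (fderiv ℂ Ω y u v) := by
    intro u v
    rw [h1.fderiv]
    simp
  rw [h2, h2, ← map_sub, hy]
  rfl

/-- The Poincaré lemma for analytic 1-forms, as a case of the Frobenius theorem: a primitive `ψ` of
`η` is a solution `(ψ, 1)` of the linear system `dψ = c η`, `dc = 0`. -/
theorem exists_primitive [CompleteSpace W] {η : E → E →L[ℂ] W} {y₀ : E}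
    (hη : ContDiffAt ℂ ω η y₀)
    (hclosed : ∀ᶠ y in 𝓝 y₀, ∀ u v, fderiv ℂ η y u v = fderiv ℂ η y v u) :
    ∃ ψ : E → W, ContDiffAt ℂ ω ψ y₀ ∧ ∀ᶠ y in 𝓝 y₀, fderiv ℂ ψ y = η y := by
  let C : W →L[ℂ] (W × ℂ →L[ℂ] W × ℂ) :=
    ContinuousLinearMap.compL ℂ (W × ℂ) W (W × ℂ) (ContinuousLinearMap.inl ℂ W ℂ) ∘L
      ContinuousLinearMap.smulRightL ℂ (W × ℂ) W (ContinuousLinearMap.snd ℂ W ℂ)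
  have hC : ∀ w p, C w p = (p.2 • w, 0) := fun w p => rfl
  obtain ⟨X, hX, hX0, h⟩ := exists_flat_section_of_clm C hη (by
    filter_upwards [hclosed] with y hy u v
    rw [hy u v, sub_self, map_zero]
    ext p <;> simp [hC]) ((0 : W), (1 : ℂ))
  refine ⟨fun y => (X y).1, hX.fst, ?_⟩
  obtain ⟨r, hr, hrN⟩ := Metric.eventually_nhds_iff_ball.1 (h.and hX.eventually_omega)
  have hd : ∀ y ∈ Metric.ball y₀ r,
      HasFDerivAt (fun y => (X y).2) (ContinuousLinearMap.snd ℂ W ℂ ∘L fderiv ℂ X y) y :=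
    fun y hy => (hrN y hy).2.differentiableAt_omega.hasFDerivAt.snd
  filter_upwards [Metric.ball_mem_nhds y₀ hr] with y hy
  have h1 : (X y).2 = (X y₀).2 := Metric.isOpen_ball.is_const_of_fderiv_eq_zero (𝕜 := ℂ)
    (f := fun y => (X y).2) (convex_ball y₀ r).isPreconnected
    (fun z hz => (hd z hz).differentiableAt.differentiableWithinAt)
    (fun z hz => by
      rw [(hd z hz).fderiv]
      ext u
      change (fderiv ℂ X z u).2 = 0
      rw [(hrN z hz).1 u, hC]) hy (Metric.mem_ball_self hr)
  have h2 : HasFDerivAt (fun y => (X y).1) _ y :=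
    (hrN y hy).2.differentiableAt_omega.hasFDerivAt.fst
  rw [h2.fderiv]
  ext u
  change (fderiv ℂ X y u).1 = η y u
  rw [(hrN y hy).1 u, hC, h1, hX0, one_smul]

variable {V : Type*} [NormedAddCommGroup V] [NormedSpace ℂ V]
  {𝔤 : Submodule ℂ (V →L[ℂ] V)} {L : Type*} [NormedAddCommGroup L] [NormedSpace ℂ L]
  [FiniteDimensional ℂ L] {F : Type*} [NormedAddCommGroup F] [NormedSpace ℂ F]
  [FiniteDimensional ℂ F]

/-- A flat form `Ω` on `V` admits a full family of commuting parallel sections `X v` of the trivial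
bundle with fibre `L`, where `X v` is the constant field `v` at the given point. -/
theorem ProlongedAlgebra.exists_parallel_sections (S : ProlongedAlgebra 𝔤 L)
    {Ω : V → V →L[ℂ] L} {y₀ : V} (hΩ : ContDiffAt ℂ ω Ω y₀)
    (hflat : ∀ᶠ y in 𝓝 y₀, ∀ u v, S.curvature Ω y u v = 0) :
    ∃ X : V → V →L[ℂ] L, ContDiffAt ℂ ω X y₀ ∧ X y₀ = S.const ∧
      ∀ᶠ y in 𝓝 y₀, (∀ u v, fderiv ℂ X y u v = -S.br (Ω y u) (X y v)) ∧
        ∀ v w, S.br (X y v) (X y w) = 0 := by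
  have := FiniteDimensional.complete ℂ L
  have hjac : ∀ P Q R, S.br (S.br P Q) R = S.br P (S.br Q R) - S.br Q (S.br P R) := fun P Q R => by
    rw [S.jacobi P Q R, add_sub_cancel_right]
  let K : L →L[ℂ] ((V →L[ℂ] L) →L[ℂ] (V →L[ℂ] L)) := -(ContinuousLinearMap.compL ℂ V L L ∘L S.br)
  have hK : ∀ P Y v, K P Y v = -S.br P (Y v) := fun P Y v => rfl
  obtain ⟨X, hX, hX0, h⟩ := exists_flat_section_of_clm K hΩ (by
    filter_upwards [hflat] with y hy u v
    have h3 : fderiv ℂ Ω y u v - fderiv ℂ Ω y v u = -S.br (Ω y u) (Ω y v) :=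
      eq_neg_of_add_eq_zero_left (hy u v)
    rw [h3]
    ext Y w
    simp [hK, hjac]) S.const
  have hXd : ∀ᶠ y in 𝓝 y₀, ∀ u v, fderiv ℂ X y u v = -S.br (Ω y u) (X y v) := by
    filter_upwards [h] with y hy u v
    rw [hy u]
    rfl
  refine ⟨X, hX, hX0, hXd.and ?_⟩
  have h1 := eventually_eq_zero_of_fderiv_eq (ι := V × V) (A := fun y => (-S.br) ∘L Ω y)
    (y₀ := y₀) (contDiffAt_const.clm_comp hΩ) (Z := fun p y => S.br (X y p.1) (X y p.2))
    (fun p => by simp [hX0, S.br_const_const]) (by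
      filter_upwards [hXd, hX.eventually_omega] with y hy hXy p
      have h2 := hXy.differentiableAt_omega.hasFDerivAt
      have h3 := h2.clm_apply (hasFDerivAt_const p.1 y)
      have h4 := h2.clm_apply (hasFDerivAt_const p.2 y)
      have h5 : HasFDerivAt (fun y => S.br (X y p.1) (X y p.2)) _ y :=
        (S.br.hasFDerivAt.comp y h3).clm_apply h4
      refine ⟨h5.differentiableAt, fun u => ?_⟩
      rw [h5.fderiv]
      simp [hy, S.jacobi (Ω y u)])
  filter_upwards [h1] with y hy v w
  exact hy (v, w)

/-- A flat form whose component along `V` is the coframe `θ` comes from local coordinates `ψ` in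
which the frame `s = θ⁻¹` takes its values in `G`. If `X` is a full family of commuting parallel
sections, then `g = ev ∘ X` has values in `G` and `g⁻¹ θ` is closed. -/
theorem ProlongedAlgebra.exists_integrating_map [FiniteDimensional ℂ V] (S : ProlongedAlgebra 𝔤 L)
    {G : Subgroup (V →L[ℂ] V)ˣ} {κ : F → V →L[ℂ] V} (hκ : IsSubgroupChart G 𝔤 κ)
    {Ω : V → V →L[ℂ] L} {θ s : V → V →L[ℂ] V} {y₀ : V} (hΩ : ContDiffAt ℂ ω Ω y₀)
    (hθs : ∀ᶠ y in 𝓝 y₀, (∀ v, θ y (s y v) = v) ∧ ∀ v, s y (θ y v) = v)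
    (h : ∀ᶠ y in 𝓝 y₀, (∀ u v, S.curvature Ω y u v = 0) ∧ ∀ u, S.ev (Ω y u) = θ y u) :
    ∃ ψ : V → V, ContDiffAt ℂ ω ψ y₀ ∧
      ∀ᶠ y in 𝓝 y₀, ∃ p ∈ G, (p : V →L[ℂ] V) = fderiv ℂ ψ y * s y := by
  obtain ⟨X, hX, hX0, hXd⟩ := S.exists_parallel_sections hΩ (h.mono fun y hy => hy.1)
  let g : V → V →L[ℂ] V := fun y => S.ev ∘L X y
  have hg : ContDiffAt ℂ ω g y₀ := contDiffAt_const.clm_comp hX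
  have hg0 : g y₀ = 1 := by
    ext v
    simp [g, hX0, S.ev_const]
  let gi : V → V →L[ℂ] V := fun y => Ring.inverse (g y)
  have hgi : ContDiffAt ℂ ω gi y₀ := by
    refine ContDiffAt.comp (g := Ring.inverse) y₀ ?_ hg
    rw [hg0]
    exact contDiffAt_ringInverse ℂ (R := V →L[ℂ] V) 1
  have hunit : ∀ᶠ y in 𝓝 y₀, IsUnit (g y) :=
    hg.continuousAt.eventually (by rw [hg0]; exact Units.nhds 1)
  let η : V → V →L[ℂ] V := fun y => gi y * (S.ev ∘L Ω y)
  have hη : ContDiffAt ℂ ω η y₀ := hgi.mul (contDiffAt_const.clm_comp hΩ)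
  have hgη : ∀ᶠ y in 𝓝 y₀, ∀ u, g y (η y u) = S.ev (Ω y u) := by
    filter_upwards [hunit] with y hy u
    have h1 : g y * (gi y * (S.ev ∘L Ω y)) = S.ev ∘L Ω y := by
      rw [← mul_assoc, Ring.mul_inverse_cancel _ hy, one_mul]
    exact congrArg (fun T => T u) h1
  -- The parallel sections commute, and `ev [X v, X w] = 0` is a symmetry of `jac ∘ X`.
  have hsymm : ∀ᶠ y in 𝓝 y₀, ∀ v w, S.jac (X y v) (g y w) = S.jac (X y w) (g y v) := by
    filter_upwards [hXd] with y hy v w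
    have h1 := S.ev_br (X y v) (X y w)
    rw [hy.2, map_zero] at h1
    exact (sub_eq_zero.1 h1.symm)
  have hgd : ∀ᶠ y in 𝓝 y₀, ∀ u, fderiv ℂ g y u =
      (S.jac (X y (η y u)) - S.jac (Ω y u)) * g y := by
    filter_upwards [hXd, hX.eventually_omega, hgη, hsymm] with y hy hXy hyη hys u
    have h1 : HasFDerivAt g _ y :=
      (hasFDerivAt_const S.ev y).clm_comp hXy.differentiableAt_omega.hasFDerivAt
    rw [h1.fderiv]
    ext v
    have h2 : (S.jac (X y v)) (S.ev (Ω y u)) = S.jac (X y (η y u)) (g y v) := by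
      rw [← hyη, hys]
    simp [hy.1, S.ev_br, h2]
    rfl
  have hgG : ∀ᶠ y in 𝓝 y₀, ∃ p ∈ G, (p : V →L[ℂ] V) = g y := by
    refine hκ.eventually_mem hg hg0 ?_
    filter_upwards [hgd] with y hy u
    exact ⟨_, 𝔤.sub_mem (S.jac_mem _) (S.jac_mem _), hy u⟩
  obtain ⟨ψ, hψ, hψη⟩ := exists_primitive hη (by
    filter_upwards [hgη.eventually_nhds, hη.eventually_omega, hg.eventually_omega,
      hΩ.eventually_omega, hgd, hsymm, h, hunit] with y hy hηy hgy hΩy hyd hys hyΩ hyu u v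
    have h1 := hgy.differentiableAt_omega.hasFDerivAt.clm_comp
      hηy.differentiableAt_omega.hasFDerivAt
    have h2 : HasFDerivAt (fun y => S.ev ∘L Ω y) _ y :=
      (hasFDerivAt_const S.ev y).clm_comp hΩy.differentiableAt_omega.hasFDerivAt
    have h3 : (fun y => g y ∘L η y) =ᶠ[𝓝 y] fun y => S.ev ∘L Ω y := by
      filter_upwards [hy] with z hz
      ext u
      exact hz u
    have h4 : ∀ u v, g y (fderiv ℂ η y u v) + fderiv ℂ g y u (η y v) =
        S.ev (fderiv ℂ Ω y u v) := by
      intro u v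
      have h5 := congrArg (fun T => T u v) (h1.unique (h2.congr_of_eventuallyEq h3))
      simpa using h5
    have h5 := congrArg S.ev (hyΩ.1 u v)
    have hy' := hy.self_of_nhds
    rw [ProlongedAlgebra.curvature, map_add, map_sub, map_zero, S.ev_br, ← hy' u, ← hy' v,
      ← h4, ← h4, hyd, hyd] at h5
    have h6 := hys (η y u) (η y v)
    simp only [mul_apply_eq_comp, sub_apply] at h5
    have h7 : g y (fderiv ℂ η y u v) = g y (fderiv ℂ η y v u) := by
      linear_combination (norm := module) h5 - h6
    obtain ⟨a, ha⟩ := hyu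
    have h8 := congrArg (↑a⁻¹ : V →L[ℂ] V) h7
    rw [← ha] at h8
    have h9 : ∀ w, (↑a⁻¹ : V →L[ℂ] V) ((a : V →L[ℂ] V) w) = w := fun w =>
      congrArg (fun T : V →L[ℂ] V => T w) a.inv_mul
    rwa [h9, h9] at h8)
  refine ⟨ψ, hψ, ?_⟩
  filter_upwards [hψη, hgG, hθs, h] with y hy ⟨p, hp, hpg⟩ hyθ hyΩ
  refine ⟨p⁻¹, G.inv_mem hp, ?_⟩
  have h1 : (S.ev ∘L Ω y) * s y = 1 := by
    ext v
    change S.ev (Ω y (s y v)) = v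
    rw [hyΩ.2, hyθ.1]
  rw [hy, mul_assoc, h1, mul_one]
  simp only [gi, ← hpg, Ring.inverse_unit]

end Integration

/-! ### The flat form of an integrable structure -/

section FlatForm

variable {V : Type*} [NormedAddCommGroup V] [NormedSpace ℂ V]
  {𝔤 : Submodule ℂ (V →L[ℂ] V)} {L : Type*} [NormedAddCommGroup L] [NormedSpace ℂ L]
  {F : Type*} [NormedAddCommGroup F] [NormedSpace ℂ F] [FiniteDimensional ℂ F]

theorem ContDiffAt.mul_clm_comp {R : Type*} [NormedRing R] [NormedAlgebra ℂ R] {f : V → R}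
    {D : V → V →L[ℂ] R} {y : V} (hf : ContDiffAt ℂ ω f y) (hD : ContDiffAt ℂ ω D y) :
    ContDiffAt ℂ ω (fun z => ContinuousLinearMap.mul ℂ R (f z) ∘L D z) y :=
  ((contDiffAt_const (c := ContinuousLinearMap.mul ℂ R)).clm_apply hf).clm_comp hD

/-- Local coordinates `ψ` in which the frame `s = θ⁻¹` takes its values in `G` give a flat form
`Ω = θ + h⁻¹ dh`, where `h = dψ ∘ s`: the pull-back of the Maurer-Cartan form of the affine group
`V ⋊ G`. -/
theorem ProlongedAlgebra.exists_flat_form_of_map [FiniteDimensional ℂ V] (S : ProlongedAlgebra 𝔤 L)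
    {G : Subgroup (V →L[ℂ] V)ˣ} {κ : F → V →L[ℂ] V} (hκ : IsSubgroupChart G 𝔤 κ)
    {θ s : V → V →L[ℂ] V} {ψ : V → V} {y₀ : V} (hθ : ContDiffAt ℂ ω θ y₀)
    (hs : ContDiffAt ℂ ω s y₀)
    (hθs : ∀ᶠ y in 𝓝 y₀, (∀ v, θ y (s y v) = v) ∧ ∀ v, s y (θ y v) = v)
    (hψ : ContDiffAt ℂ ω ψ y₀)
    (hG : ∀ᶠ y in 𝓝 y₀, ∃ p ∈ G, (p : V →L[ℂ] V) = fderiv ℂ ψ y * s y) :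
    ∃ Ω : V → V →L[ℂ] L, ContDiffAt ℂ ω Ω y₀ ∧
      ∀ᶠ y in 𝓝 y₀, (∀ u v, S.curvature Ω y u v = 0) ∧ ∀ u, S.ev (Ω y u) = θ y u := by
  let h : V → V →L[ℂ] V := fun y => fderiv ℂ ψ y * s y
  have hh : ContDiffAt ℂ ω h y₀ := hψ.fderiv_omega.mul hs
  let Λ : V → V →L[ℂ] (V →L[ℂ] V) := fun y =>
    ContinuousLinearMap.mul ℂ (V →L[ℂ] V) (Ring.inverse (h y)) ∘L fderiv ℂ h y
  have hΛ : ContDiffAt ℂ ω Λ y₀ := by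
    obtain ⟨p, -, hp⟩ := hG.self_of_nhds
    have h1 : ContDiffAt ℂ ω (fun y => Ring.inverse (h y)) y₀ := by
      refine ContDiffAt.comp (g := Ring.inverse) y₀ ?_ hh
      change ContDiffAt ℂ ω Ring.inverse (fderiv ℂ ψ y₀ * s y₀)
      rw [← hp]
      exact contDiffAt_ringInverse ℂ (R := V →L[ℂ] V) p
    exact h1.mul_clm_comp hh.fderiv_omega
  have hhΛ : ∀ᶠ y in 𝓝 y₀, ∀ u, h y * Λ y u = fderiv ℂ h y u := by
    filter_upwards [hG] with y ⟨p, _, hp⟩ u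
    change h y * (Ring.inverse (h y) * fderiv ℂ h y u) = _
    rw [← mul_assoc, Ring.mul_inverse_cancel _ ⟨p, hp⟩, one_mul]
  have hΛ𝔤 : ∀ᶠ y in 𝓝 y₀, ∀ u, Λ y u ∈ 𝔤 := by
    filter_upwards [hG.eventually_nhds, hh.eventually_omega] with y hy hhy u
    obtain ⟨A, hA, hA'⟩ := hκ.exists_fderiv_eq_mul hhy hy u
    obtain ⟨p, -, hp⟩ := hy.self_of_nhds
    change Ring.inverse (h y) * fderiv ℂ h y u ∈ 𝔤
    rwa [hA', ← mul_assoc, Ring.inverse_mul_cancel _ ⟨p, hp⟩, one_mul]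
  have hhθ : ∀ᶠ y in 𝓝 y₀, h y ∘L θ y = fderiv ℂ ψ y := by
    filter_upwards [hθs] with y hy
    ext u
    exact congrArg (fderiv ℂ ψ y) (hy.2 u)
  -- The structure equations: `dθ` and `dΛ` from the closedness of `dψ = h θ` and `dh = h Λ`.
  have hcancel : ∀ᶠ y in 𝓝 y₀, ∃ q : V →L[ℂ] V, q * h y = 1 := by
    filter_upwards [hG] with y ⟨p, _, hp⟩
    exact ⟨_, Ring.inverse_mul_cancel _ ⟨p, hp⟩⟩
  have hdθ : ∀ᶠ y in 𝓝 y₀, ∀ u v, fderiv ℂ θ y u v - fderiv ℂ θ y v u =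
      Λ y v (θ y u) - Λ y u (θ y v) := by
    filter_upwards [hhθ.eventually_nhds, hhΛ, hcancel, hψ.eventually_omega, hh.eventually_omega,
      hθ.eventually_omega] with y hy hyΛ ⟨q, hq⟩ hψy hhy hθy u v
    have h1 := (hhy.differentiableAt_omega.hasFDerivAt.clm_comp
      hθy.differentiableAt_omega.hasFDerivAt).unique
        (hψy.fderiv_omega.differentiableAt_omega.hasFDerivAt.congr_of_eventuallyEq hy)
    have h2 : ∀ u v, h y (fderiv ℂ θ y u v + Λ y u (θ y v)) = fderiv ℂ (fderiv ℂ ψ) y u v := by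
      intro u v
      have h3 := congrArg (fun T => T u v) h1
      simp only [add_apply, ContinuousLinearMap.comp_apply, ContinuousLinearMap.compL_apply,
        ContinuousLinearMap.flip_apply, ← hyΛ] at h3
      rw [map_add, ← h3]
      rfl
    have h3 : h y (fderiv ℂ θ y u v + Λ y u (θ y v)) =
        h y (fderiv ℂ θ y v u + Λ y v (θ y u)) := by
      rw [h2, h2, hψy.fderiv_fderiv_symm]
    have h4 : ∀ w, q (h y w) = w := fun w => congrArg (fun T : V →L[ℂ] V => T w) hq
    have h5 := congrArg q h3
    rw [h4, h4] at h5
    linear_combination (norm := module) h5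
  have hdΛ : ∀ᶠ y in 𝓝 y₀, ∀ u v, fderiv ℂ Λ y u v - fderiv ℂ Λ y v u =
      Λ y v * Λ y u - Λ y u * Λ y v := by
    filter_upwards [hhΛ.eventually_nhds, hcancel, hh.eventually_omega, hΛ.eventually_omega] with
      y hy ⟨q, hq⟩ hhy hΛy u v
    have h2 : ∀ u v, h y * (fderiv ℂ Λ y u v + Λ y u * Λ y v) = fderiv ℂ (fderiv ℂ h) y u v := by
      intro u v
      have h1 : HasFDerivAt (fun z => h z * Λ z v) _ y :=
        hhy.differentiableAt_omega.hasFDerivAt.mul'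
          (hΛy.differentiableAt_omega.hasFDerivAt.clm_apply (hasFDerivAt_const v y))
      have h3 := congrArg (fun T => T u) (h1.unique
        ((hhy.fderiv_omega.differentiableAt_omega.hasFDerivAt.clm_apply
          (hasFDerivAt_const v y)).congr_of_eventuallyEq (hy.mono fun z hz => hz v)))
      simp [← hy.self_of_nhds u] at h3
      rw [← h3, mul_add (h y), mul_assoc (h y)]
    have h3 : h y * (fderiv ℂ Λ y u v + Λ y u * Λ y v) =
        h y * (fderiv ℂ Λ y v u + Λ y v * Λ y u) := by
      rw [h2, h2, hhy.fderiv_fderiv_symm]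
    have h5 := congrArg (fun w => q * w) h3
    simp only [← mul_assoc q, hq, one_mul] at h5
    linear_combination (norm := module) h5
  refine ⟨fun y => S.const ∘L θ y + S.lin ∘L Λ y,
    (contDiffAt_const.clm_comp hθ).add (contDiffAt_const.clm_comp hΛ), ?_⟩
  filter_upwards [hΛ𝔤, hdθ, hdΛ, hθ.eventually_omega, hΛ.eventually_omega] with
    y hy hyθ hyΛ hθy hΛy
  refine ⟨fun u v => ?_, fun u => ?_⟩
  · have h1 : HasFDerivAt (fun y => S.const ∘L θ y + S.lin ∘L Λ y) _ y :=
      ((hasFDerivAt_const S.const y).clm_comp hθy.differentiableAt_omega.hasFDerivAt).add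
        ((hasFDerivAt_const S.lin y).clm_comp hΛy.differentiableAt_omega.hasFDerivAt)
    have h2 : ∀ u v, fderiv ℂ (fun y => S.const ∘L θ y + S.lin ∘L Λ y) y u v =
        S.const (fderiv ℂ θ y u v) + S.lin (fderiv ℂ Λ y u v) := by
      intro u v
      rw [h1.fderiv]
      simp
    have h3 := congrArg S.const (hyθ u v)
    have h4 := congrArg S.lin (hyΛ u v)
    have h5 := S.br_lin_lin _ (hy u) _ (hy v)
    have h6 := S.br_antisymm (S.const (θ y u)) (S.lin (Λ y v))
    rw [S.br_lin_const _ (hy v)] at h6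
    change S.br _ _ = S.lin (Λ y u * Λ y v - Λ y v * Λ y u) at h5
    simp only [map_sub] at h3 h4 h5
    rw [ProlongedAlgebra.curvature, h2, h2]
    simp only [add_apply, ContinuousLinearMap.comp_apply, map_add, S.br_const_const, h5, h6,
      S.br_lin_const _ (hy u)]
    linear_combination (norm := module) h3 + h4
  · simp [S.ev_const, S.ev_lin _ (hy u)]

end FlatForm

/-! ### Homogeneous vector fields and prolongations -/

section HomogeneousFields

variable {V : Type*} [NormedAddCommGroup V] [NormedSpace ℂ V]

/-- The analytic vector fields `P` on `V` which are homogeneous of degree `k` and whose derivative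
has values in `𝔤`. For `k ≥ 1` they are the polynomial maps `v ↦ T (v, …, v)` with `T` in the
`(k - 1)`-st prolongation of `𝔤`. -/
noncomputable def homogeneousFields (𝔤 : Submodule ℂ (V →L[ℂ] V)) (k : ℕ) :
    Submodule ℂ (V → V) where
  carrier := {P | ContDiff ℂ ω P ∧ (∀ (c : ℂ) (v : V), P (c • v) = c ^ k • P v) ∧
    ∀ v, fderiv ℂ P v ∈ 𝔤}
  zero_mem' := ⟨contDiff_const, by simp, fun v => by simp⟩
  add_mem' := by
    rintro P Q ⟨hP, hP', hP''⟩ ⟨hQ, hQ', hQ''⟩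
    refine ⟨hP.add hQ, fun c v => by simp [hP', hQ'], fun v => ?_⟩
    rw [fderiv_add (hP.contDiffAt).differentiableAt_omega hQ.contDiffAt.differentiableAt_omega]
    exact 𝔤.add_mem (hP'' v) (hQ'' v)
  smul_mem' := by
    rintro a P ⟨hP, hP', hP''⟩
    refine ⟨hP.const_smul a, fun c v => by simp [hP', smul_comm a], fun v => ?_⟩
    rw [fderiv_const_smul hP.contDiffAt.differentiableAt_omega]
    exact 𝔤.smul_mem a (hP'' v)

variable {𝔤 : Submodule ℂ (V →L[ℂ] V)} {k : ℕ} {P Q : V → V}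

theorem homogeneousFields_apply_zero (hP : P ∈ homogeneousFields 𝔤 (k + 1)) : P 0 = 0 := by
  simpa using hP.2.1 0 0

theorem homogeneousFields_zero_apply (hP : P ∈ homogeneousFields 𝔤 0) (v : V) : P v = P 0 := by
  simpa using (hP.2.1 0 v).symm

theorem homogeneousFields_zero_eq_const (hP : P ∈ homogeneousFields 𝔤 0) : P = fun _ => P 0 :=
  funext (homogeneousFields_zero_apply hP)

theorem const_mem_homogeneousFields (v : V) : (fun _ => v) ∈ homogeneousFields 𝔤 0 :=
  ⟨contDiff_const, by simp, by simp⟩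

theorem clm_mem_homogeneousFields {A : V →L[ℂ] V} (hA : A ∈ 𝔤) :
    (A : V → V) ∈ homogeneousFields 𝔤 1 :=
  ⟨A.contDiff, by simp, by simpa using hA⟩

theorem homogeneousFields_differentiableAt (hP : P ∈ homogeneousFields 𝔤 k) (v : V) :
    DifferentiableAt ℂ P v := hP.1.contDiffAt.differentiableAt_omega

theorem homogeneousFields_contDiff_fderiv (hP : P ∈ homogeneousFields 𝔤 k) :
    ContDiff ℂ ω (fderiv ℂ P) :=
  contDiff_iff_contDiffAt.2 fun _ => hP.1.contDiffAt.fderiv_omega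

/-- Euler's formula. -/
theorem homogeneousFields_euler (hP : P ∈ homogeneousFields 𝔤 (k + 1)) (v : V) :
    fderiv ℂ P v v = ((k + 1 : ℕ) : ℂ) • P v := by
  have h1 : HasDerivAt (fun c : ℂ => c • v) v 1 := by
    simpa using (hasDerivAt_id (1 : ℂ)).smul_const v
  have h2 : HasDerivAt (fun c : ℂ => P (c • v)) (fderiv ℂ P v v) 1 := by
    refine HasFDerivAt.comp_hasDerivAt (1 : ℂ) ?_ h1
    rw [one_smul]
    exact (homogeneousFields_differentiableAt hP v).hasFDerivAt
  have h3 : HasDerivAt (fun c : ℂ => c ^ (k + 1) • P v) (((k + 1 : ℕ) : ℂ) • P v) 1 := by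
    simpa using (hasDerivAt_pow (k + 1) (1 : ℂ)).smul_const (P v)
  simp only [← hP.2.1] at h3
  exact h2.unique h3

theorem homogeneousFields_fderiv_smul (hP : P ∈ homogeneousFields 𝔤 (k + 1)) (c : ℂ) (v : V) :
    fderiv ℂ P (c • v) = c ^ k • fderiv ℂ P v := by
  have hc : Continuous (fderiv ℂ P) := (homogeneousFields_contDiff_fderiv hP).continuous
  have h1 : Continuous fun c : ℂ => fderiv ℂ P (c • v) := by fun_prop
  have h2 : Continuous fun c : ℂ => c ^ k • fderiv ℂ P v := by fun_prop
  refine congrFun (Continuous.ext_on (dense_compl_singleton (0 : ℂ)) h1 h2 fun a ha => ?_) c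
  have h3 : HasFDerivAt (fun w => P (a • w)) (a • fderiv ℂ P (a • v)) v := by
    have h4 := ((homogeneousFields_differentiableAt hP (a • v)).hasFDerivAt).comp v
      ((hasFDerivAt_id v).const_smul a)
    refine h4.congr_fderiv ?_
    ext w
    simp
  have h4 : HasFDerivAt (fun w => a ^ (k + 1) • P w) (a ^ (k + 1) • fderiv ℂ P v) v :=
    (homogeneousFields_differentiableAt hP v).hasFDerivAt.const_smul _
  simp only [← hP.2.1] at h4
  have h5 := h3.unique h4
  rw [pow_succ', mul_smul] at h5
  exact smul_right_injective _ ha h5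

theorem fderiv_fderiv_mem [FiniteDimensional ℂ V] (hP : P ∈ homogeneousFields 𝔤 k) (v u : V) :
    fderiv ℂ (fderiv ℂ P) v u ∈ 𝔤 :=
  fderiv_mem_of_eventually_mem 𝔤
    (homogeneousFields_contDiff_fderiv hP).contDiffAt.differentiableAt_omega
    (Eventually.of_forall hP.2.2) u

theorem fderiv_fderiv_apply (hP : P ∈ homogeneousFields 𝔤 k) (u v : V) :
    fderiv ℂ (fun x => fderiv ℂ P x u) v = fderiv ℂ (fderiv ℂ P) v u := by
  have h1 := (homogeneousFields_contDiff_fderiv hP).contDiffAt.differentiableAt_omega (x := v)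
  have h2 : HasFDerivAt (fun x => fderiv ℂ P x u) _ v :=
    h1.hasFDerivAt.clm_apply (hasFDerivAt_const u v)
  rw [h2.fderiv]
  ext w
  simp [hP.1.contDiffAt.fderiv_fderiv_symm w u]

theorem fderiv_apply_mem_homogeneousFields [FiniteDimensional ℂ V]
    (hP : P ∈ homogeneousFields 𝔤 (k + 1)) (u : V) :
    (fun v => fderiv ℂ P v u) ∈ homogeneousFields 𝔤 k := by
  refine ⟨(homogeneousFields_contDiff_fderiv hP).clm_apply contDiff_const, fun c v => ?_,
    fun v => ?_⟩
  · simp only [homogeneousFields_fderiv_smul hP, smul_apply]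
  · rw [fderiv_fderiv_apply hP]
    exact fderiv_fderiv_mem hP v u

theorem eq_zero_of_fderiv_eq_zero (hP : P ∈ homogeneousFields 𝔤 (k + 1))
    (h : ∀ u v, fderiv ℂ P v u = 0) : P = 0 := by
  funext v
  have h1 := homogeneousFields_euler hP v
  rw [h] at h1
  exact (smul_eq_zero.1 h1.symm).resolve_left (Nat.cast_ne_zero.2 k.succ_ne_zero)

theorem finiteDimensional_homogeneousFields [FiniteDimensional ℂ V]
    (𝔤 : Submodule ℂ (V →L[ℂ] V)) (k : ℕ) : FiniteDimensional ℂ (homogeneousFields 𝔤 k) := by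
  induction k with
  | zero =>
    let f : homogeneousFields 𝔤 0 →ₗ[ℂ] V :=
      { toFun := fun P => (P : V → V) 0, map_add' := fun _ _ => rfl, map_smul' := fun _ _ => rfl }
    refine Module.Finite.of_injective f fun P Q h => Subtype.ext ?_
    rw [homogeneousFields_zero_eq_const P.2, homogeneousFields_zero_eq_const Q.2]
    exact funext fun _ => h
  | succ k ih =>
    let f : homogeneousFields 𝔤 (k + 1) →ₗ[ℂ] (V →ₗ[ℂ] homogeneousFields 𝔤 k) :=
      LinearMap.mk₂ ℂ (fun P u => ⟨fun v => fderiv ℂ (P : V → V) v u,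
        fderiv_apply_mem_homogeneousFields P.2 u⟩)
        (fun P Q u => Subtype.ext (funext fun v => by
          change fderiv ℂ ((P : V → V) + (Q : V → V)) v u = _
          rw [fderiv_add (homogeneousFields_differentiableAt P.2 v)
            (homogeneousFields_differentiableAt Q.2 v)]
          rfl))
        (fun c P u => Subtype.ext (funext fun v => by
          change fderiv ℂ (c • (P : V → V)) v u = _
          rw [fderiv_const_smul (homogeneousFields_differentiableAt P.2 v)]
          rfl))
        (fun P u w => Subtype.ext (funext fun v => map_add _ _ _))
        (fun c P u => Subtype.ext (funext fun v => map_smul _ _ _))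
    refine Module.Finite.of_injective f ((injective_iff_map_eq_zero f).2 fun P h => Subtype.ext ?_)
    refine eq_zero_of_fderiv_eq_zero P.2 fun u v => ?_
    exact congrFun (congrArg Subtype.val (LinearMap.congr_fun h u)) v

/-- A homogeneous field is recovered from its Taylor coefficient at the origin. -/
theorem iteratedFDeriv_homogeneousFields [FiniteDimensional ℂ V]
    (hP : P ∈ homogeneousFields 𝔤 k) (v : V) :
    iteratedFDeriv ℂ k P 0 (fun _ => v) = (k.factorial : ℂ) • P v := by
  induction k generalizing P with
  | zero => simp [homogeneousFields_zero_apply hP v]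
  | succ k ih =>
    have h1 := ih (fderiv_apply_mem_homogeneousFields hP v)
    rw [homogeneousFields_euler hP, smul_smul] at h1
    rw [iteratedFDeriv_succ_apply_right, Nat.factorial_succ, mul_comm, Nat.cast_mul, ← h1]
    have h2 := (ContinuousLinearMap.apply ℂ V v).iteratedFDeriv_comp_left
      ((homogeneousFields_contDiff_fderiv hP).contDiffAt (x := 0)) (i := k) le_top
    exact (congrArg (fun T => T fun _ => v) h2).symm

theorem iteratedFDeriv_mem {W : Type*} [NormedAddCommGroup W] [NormedSpace ℂ W]
    [FiniteDimensional ℂ W] (K : Submodule ℂ W) {f : V → W} (hf : ContDiff ℂ ω f)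
    (h : ∀ x, f x ∈ K) (n : ℕ) (x : V) (v : Fin n → V) : iteratedFDeriv ℂ n f x v ∈ K := by
  obtain ⟨π, hπ, -⟩ := K.exists_clm_projection
  have h1 := π.iteratedFDeriv_comp_left (hf.contDiffAt (x := x)) (i := n) le_top
  have h2 : π ∘ f = fun _ => 0 := funext fun x => (hπ _).2 (h x)
  rw [← hπ]
  have h3 := congrArg (fun T => T v) h1
  rw [h2] at h3
  simpa using h3.symm

/-- The Taylor coefficient of a homogeneous field of degree `m + 1` lies in the `m`-th prolongation,
so there are no such fields if that prolongation vanishes. -/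
theorem homogeneousFields_eq_bot [FiniteDimensional ℂ V] {m : ℕ} (hm : prolongation 𝔤 m = ⊥) :
    homogeneousFields 𝔤 (m + 1) = ⊥ := by
  rw [eq_bot_iff]
  intro P hP
  have hT : (iteratedFDeriv ℂ (m + 1) P 0).toMultilinearMap ∈ prolongation 𝔤 m := by
    refine ⟨fun τ v => ?_, fun v => ?_⟩
    · exact hP.1.contDiffAt.iteratedFDeriv_comp_perm v τ
    -- Iterated derivatives split off the last argument, the prolongation the first one.
    · refine ⟨iteratedFDeriv ℂ m (fderiv ℂ P) 0 v, iteratedFDeriv_mem 𝔤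
        (homogeneousFields_contDiff_fderiv hP) hP.2.2 m 0 v, fun u => ?_⟩
      have h1 := hP.1.contDiffAt.iteratedFDeriv_comp_perm (x := (0 : V))
        (Fin.cons u v : Fin (m + 1) → V) (finRotate (m + 1))
      have h2 : (Fin.cons u v : Fin (m + 1) → V) ∘ finRotate (m + 1) = Fin.snoc v u := by
        funext i
        refine Fin.lastCases ?_ (fun j => ?_) i
        · simp
        · simp
      rw [h2, iteratedFDeriv_succ_apply_right] at h1
      simpa using h1
  rw [hm, Submodule.mem_bot] at hT
  have h1 : ∀ v, ((m + 1).factorial : ℂ) • P v = 0 := fun v => by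
    rw [← iteratedFDeriv_homogeneousFields hP v]
    exact congrArg (fun T => T fun _ => v) hT
  exact (Submodule.mem_bot ℂ).2 (funext fun v => (smul_eq_zero.1 (h1 v)).resolve_left
    (Nat.cast_ne_zero.2 (m + 1).factorial_ne_zero))

theorem homogeneousFields_eq_bot_of_le [FiniteDimensional ℂ V] {m i : ℕ}
    (hm : prolongation 𝔤 m = ⊥) (hi : m + 1 ≤ i) : homogeneousFields 𝔤 i = ⊥ := by
  induction i, hi using Nat.le_induction with
  | base => exact homogeneousFields_eq_bot hm
  | succ i hi ih =>
    rw [eq_bot_iff]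
    intro P hP
    refine (Submodule.mem_bot ℂ).2 (eq_zero_of_fderiv_eq_zero hP fun u v => ?_)
    have h1 := fderiv_apply_mem_homogeneousFields hP u
    rw [ih, Submodule.mem_bot] at h1
    exact congrFun h1 v

/-- Homogeneous components are eigenvectors of the dilation by `2`. -/
theorem iSupIndep_homogeneousFields (𝔤 : Submodule ℂ (V →L[ℂ] V)) :
    iSupIndep (homogeneousFields 𝔤) := by
  let T : Module.End ℂ (V → V) := LinearMap.funLeft ℂ V fun v : V => (2 : ℂ) • v
  have h1 := (T.eigenspaces_iSupIndep).comp (f := fun k : ℕ => (2 : ℂ) ^ k)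
    (fun i j (hij : (2 : ℂ) ^ i = 2 ^ j) => Nat.pow_right_injective le_rfl
      (show 2 ^ i = 2 ^ j by exact_mod_cast hij))
  refine h1.mono fun k P hP => ?_
  rw [Function.comp_apply, Module.End.mem_eigenspace_iff]
  exact funext fun v => hP.2.1 2 v

/-- The derivative of a bracket consists of the commutator of the derivatives and of second
derivatives, which have values in the closed subspace `𝔤` as well. -/
theorem lieBracket_mem_homogeneousFields [FiniteDimensional ℂ V] {i j : ℕ}
    (h𝔤 : ∀ A ∈ 𝔤, ∀ B ∈ 𝔤, A * B - B * A ∈ 𝔤) (hP : P ∈ homogeneousFields 𝔤 (i + 1))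
    (hQ : Q ∈ homogeneousFields 𝔤 j) :
    VectorField.lieBracket ℂ Q P ∈ homogeneousFields 𝔤 (i + j) := by
  have hP' := homogeneousFields_contDiff_fderiv hP
  have hQ' := homogeneousFields_contDiff_fderiv hQ
  refine ⟨(hP'.clm_apply hQ.1).sub (hQ'.clm_apply hP.1), fun c v => ?_, fun v => ?_⟩
  · simp only [VectorField.lieBracket]
    rcases j with _ | j
    · have h1 : ∀ v, fderiv ℂ Q v = 0 := fun v => by
        rw [homogeneousFields_zero_eq_const hQ]; simp
      simp [h1, homogeneousFields_fderiv_smul hP, hQ.2.1]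
    · simp only [homogeneousFields_fderiv_smul hP, homogeneousFields_fderiv_smul hQ, hQ.2.1, hP.2.1,
        map_smul, smul_apply, smul_smul, smul_sub]
      congr 2 <;> ring
  · have h1 : HasFDerivAt (fun v => fderiv ℂ P v (Q v)) _ v :=
      (hP'.contDiffAt.differentiableAt_omega.hasFDerivAt).clm_apply
        (homogeneousFields_differentiableAt hQ v).hasFDerivAt
    have h2 : HasFDerivAt (fun v => fderiv ℂ Q v (P v)) _ v :=
      (hQ'.contDiffAt.differentiableAt_omega.hasFDerivAt).clm_apply
        (homogeneousFields_differentiableAt hP v).hasFDerivAt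
    have h3 : HasFDerivAt (VectorField.lieBracket ℂ Q P) _ v := h1.sub h2
    have h4 : fderiv ℂ (VectorField.lieBracket ℂ Q P) v =
        (fderiv ℂ P v * fderiv ℂ Q v - fderiv ℂ Q v * fderiv ℂ P v) +
          (fderiv ℂ (fderiv ℂ P) v (Q v) - fderiv ℂ (fderiv ℂ Q) v (P v)) := by
      rw [h3.fderiv]
      ext w
      have h5 := hP.1.contDiffAt.fderiv_fderiv_symm (x := v) w (Q v)
      have h6 := hQ.1.contDiffAt.fderiv_fderiv_symm (x := v) w (P v)
      simp [h5, h6]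
      abel
    rw [h4]
    exact 𝔤.add_mem (h𝔤 _ (hP.2.2 v) _ (hQ.2.2 v))
      (𝔤.sub_mem (fderiv_fderiv_mem hP v _) (fderiv_fderiv_mem hQ v _))

end HomogeneousFields

/-! ### The Lie algebra of polynomial vector fields of a linear Lie algebra of finite type -/

section FieldAlgebra

variable {V : Type*} [NormedAddCommGroup V] [NormedSpace ℂ V]

/-- The sums of homogeneous fields of degrees at least `k` with derivatives in `𝔤`. -/
noncomputable def fieldFil (𝔤 : Submodule ℂ (V →L[ℂ] V)) (k : ℕ) : Submodule ℂ (V → V) :=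
  ⨆ i : ℕ, homogeneousFields 𝔤 (k + i)

variable {𝔤 : Submodule ℂ (V →L[ℂ] V)} {k : ℕ} {P Q : V → V}

theorem homogeneousFields_le_fieldFil {i : ℕ} (h : k ≤ i) :
    homogeneousFields 𝔤 i ≤ fieldFil 𝔤 k := by
  obtain ⟨j, rfl⟩ := Nat.exists_eq_add_of_le h
  exact le_iSup (fun j => homogeneousFields 𝔤 (k + j)) j

theorem fieldFil_induction {p : (V → V) → Prop} (hP : P ∈ fieldFil 𝔤 k)
    (mem : ∀ i, k ≤ i → ∀ Q ∈ homogeneousFields 𝔤 i, p Q)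
    (add : ∀ Q R, p Q → p R → p (Q + R)) : p P :=
  Submodule.iSup_induction _ (motive := p) hP (fun i Q hQ => mem _ (Nat.le_add_right k i) Q hQ)
    (mem k le_rfl 0 (Submodule.zero_mem _)) add

theorem fieldFil_antitone : Antitone (fieldFil 𝔤) := fun _ _ h =>
  iSup_le fun i => homogeneousFields_le_fieldFil (h.trans (Nat.le_add_right _ i))

theorem fieldFil_regular (hP : P ∈ fieldFil 𝔤 k) : ContDiff ℂ ω P ∧ ∀ v, fderiv ℂ P v ∈ 𝔤 :=
  fieldFil_induction (p := fun P => ContDiff ℂ ω P ∧ ∀ v, fderiv ℂ P v ∈ 𝔤) hP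
    (fun i _ Q hQ => ⟨hQ.1, hQ.2.2⟩) (by
    rintro Q R ⟨hQ, hQ'⟩ ⟨hR, hR'⟩
    refine ⟨hQ.add hR, fun v => ?_⟩
    rw [fderiv_add hQ.contDiffAt.differentiableAt_omega hR.contDiffAt.differentiableAt_omega]
    exact 𝔤.add_mem (hQ' v) (hR' v))

theorem fieldFil_differentiableAt (hP : P ∈ fieldFil 𝔤 k) (v : V) : DifferentiableAt ℂ P v :=
  (fieldFil_regular hP).1.contDiffAt.differentiableAt_omega

/-- The leading homogeneous term of a field. -/
theorem fieldFil_exists_leading (hP : P ∈ fieldFil 𝔤 k) :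
    ∃ Q ∈ homogeneousFields 𝔤 k, P - Q ∈ fieldFil 𝔤 (k + 1) :=
  fieldFil_induction (p := fun P => ∃ Q ∈ homogeneousFields 𝔤 k, P - Q ∈ fieldFil 𝔤 (k + 1)) hP
    (fun i hi Q hQ => by
    rcases hi.eq_or_lt with rfl | hi
    · exact ⟨Q, hQ, by simp⟩
    · exact ⟨0, Submodule.zero_mem _, by
        rw [sub_zero]; exact homogeneousFields_le_fieldFil hi hQ⟩) (by
    rintro Q R ⟨Q', hQ', hQ⟩ ⟨R', hR', hR⟩
    refine ⟨Q' + R', Submodule.add_mem _ hQ' hR', ?_⟩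
    rw [add_sub_add_comm]
    exact Submodule.add_mem _ hQ hR)

/-- The first filtration step consists of the fields that vanish at the origin. -/
theorem mem_fieldFil_one_iff (hP : P ∈ fieldFil 𝔤 0) : P ∈ fieldFil 𝔤 1 ↔ P 0 = 0 := by
  have h1 : ∀ Q ∈ fieldFil 𝔤 1, Q 0 = 0 := fun Q hQ => fieldFil_induction hQ
    (fun i hi R hR => by
      obtain ⟨j, rfl⟩ := Nat.exists_eq_add_of_le' hi
      exact homogeneousFields_apply_zero hR)
    (fun R R' hR hR' => by rw [Pi.add_apply, hR, hR', add_zero])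
  refine ⟨h1 P, fun h => ?_⟩
  obtain ⟨Q, hQ, hPQ⟩ := fieldFil_exists_leading hP
  have h2 := h1 _ hPQ
  rw [Pi.sub_apply, h, zero_sub, neg_eq_zero] at h2
  have h3 : Q = 0 := funext fun v => (homogeneousFields_zero_apply hQ v).trans h2
  rwa [h3, sub_zero] at hPQ

theorem disjoint_fieldFil {j : ℕ} (h : j < k) :
    Disjoint (homogeneousFields 𝔤 j) (fieldFil 𝔤 k) :=
  ((iSupIndep_homogeneousFields 𝔤).disjoint_biSup (y := Ici k) (by simpa using h)).mono_right
    (iSup_le fun i => le_biSup (homogeneousFields 𝔤) (mem_Ici.2 (Nat.le_add_right k i)))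

variable [FiniteDimensional ℂ V]

theorem finiteDimensional_fieldFil {m : ℕ} (hm : prolongation 𝔤 m = ⊥) :
    FiniteDimensional ℂ (fieldFil 𝔤 0) := by
  have := finiteDimensional_homogeneousFields 𝔤
  have h1 : fieldFil 𝔤 0 ≤ ⨆ i : Fin (m + 1), homogeneousFields 𝔤 i := by
    refine iSup_le fun i => ?_
    rw [zero_add]
    rcases lt_or_ge i (m + 1) with h | h
    · exact le_iSup (fun i : Fin (m + 1) => homogeneousFields 𝔤 i) ⟨i, h⟩
    · rw [homogeneousFields_eq_bot_of_le hm h]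
      exact bot_le
  exact Submodule.finiteDimensional_of_le h1

theorem fieldFil_eq_bot {m : ℕ} (hm : prolongation 𝔤 m = ⊥) : fieldFil 𝔤 (m + 1) = ⊥ :=
  eq_bot_iff.2 (iSup_le fun i =>
    (homogeneousFields_eq_bot_of_le hm (Nat.le_add_right (m + 1) i)).le)

theorem lieBracket_mem_fieldFil {i j : ℕ} (h𝔤 : ∀ A ∈ 𝔤, ∀ B ∈ 𝔤, A * B - B * A ∈ 𝔤)
    (hP : P ∈ fieldFil 𝔤 (i + 1)) (hQ : Q ∈ fieldFil 𝔤 j) :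
    VectorField.lieBracket ℂ Q P ∈ fieldFil 𝔤 (i + j) := by
  refine (fieldFil_induction (p := fun P => (∀ v, DifferentiableAt ℂ P v) ∧
    VectorField.lieBracket ℂ Q P ∈ fieldFil 𝔤 (i + j)) hP (fun a ha R hR =>
      ⟨homogeneousFields_differentiableAt hR, ?_⟩) ?_).2
  · refine (fieldFil_induction (p := fun Q => (∀ v, DifferentiableAt ℂ Q v) ∧
      VectorField.lieBracket ℂ Q R ∈ fieldFil 𝔤 (i + j)) hQ (fun b hb T hT =>
        ⟨homogeneousFields_differentiableAt hT, ?_⟩) ?_).2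
    · obtain ⟨c, rfl⟩ := Nat.exists_eq_add_of_le ha
      rw [add_right_comm] at hR
      exact homogeneousFields_le_fieldFil (by omega) (lieBracket_mem_homogeneousFields h𝔤 hR hT)
    · rintro T T' ⟨hT, hTR⟩ ⟨hT', hTR'⟩
      refine ⟨fun v => (hT v).add (hT' v), ?_⟩
      rw [show VectorField.lieBracket ℂ (T + T') R = VectorField.lieBracket ℂ T R +
        VectorField.lieBracket ℂ T' R from
          funext fun v => VectorField.lieBracket_add_left (hT v) (hT' v)]
      exact Submodule.add_mem _ hTR hTR'
  · rintro T T' ⟨hT, hTR⟩ ⟨hT', hTR'⟩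
    refine ⟨fun v => (hT v).add (hT' v), ?_⟩
    rw [show VectorField.lieBracket ℂ Q (T + T') = VectorField.lieBracket ℂ Q T +
      VectorField.lieBracket ℂ Q T' from
        funext fun v => VectorField.lieBracket_add_right (hT v) (hT' v)]
    exact Submodule.add_mem _ hTR hTR'

/-- Two constant fields commute, so the bracket of two fields of the algebra involves no field of
degree `-1`. -/
theorem lieBracket_mem_fieldFil_zero (h𝔤 : ∀ A ∈ 𝔤, ∀ B ∈ 𝔤, A * B - B * A ∈ 𝔤)
    (hP : P ∈ fieldFil 𝔤 0) (hQ : Q ∈ fieldFil 𝔤 0) :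
    VectorField.lieBracket ℂ Q P ∈ fieldFil 𝔤 0 := by
  obtain ⟨P₀, hP₀, hP₁⟩ := fieldFil_exists_leading hP
  obtain ⟨Q₀, hQ₀, hQ₁⟩ := fieldFil_exists_leading hQ
  have hP₀' := homogeneousFields_le_fieldFil le_rfl hP₀
  have h1 := lieBracket_mem_fieldFil h𝔤 hP₁ hQ
  have h2 := lieBracket_mem_fieldFil h𝔤 hQ₁ hP₀'
  have h3 : VectorField.lieBracket ℂ Q P = VectorField.lieBracket ℂ Q (P - P₀) -
      VectorField.lieBracket ℂ P₀ (Q - Q₀) := by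
    funext v
    have h4 : ∀ w, fderiv ℂ P₀ w = 0 := fun w => by
      rw [homogeneousFields_zero_eq_const hP₀]; simp
    have h5 : ∀ w, fderiv ℂ Q₀ w = 0 := fun w => by
      rw [homogeneousFields_zero_eq_const hQ₀]; simp
    simp only [VectorField.lieBracket, Pi.sub_apply]
    rw [fderiv_sub (fieldFil_differentiableAt hP v) (homogeneousFields_differentiableAt hP₀ v),
      fderiv_sub (fieldFil_differentiableAt hQ v) (homogeneousFields_differentiableAt hQ₀ v), h4,
      h5]
    simp only [map_sub, sub_zero, zero_apply]
    abel
  rw [h3]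
  exact Submodule.sub_mem _ h1 h2

theorem fderiv_apply_mem_fieldFil (h𝔤 : ∀ A ∈ 𝔤, ∀ B ∈ 𝔤, A * B - B * A ∈ 𝔤)
    (hP : P ∈ fieldFil 𝔤 (k + 1)) (v : V) : (fun x => fderiv ℂ P x v) ∈ fieldFil 𝔤 k := by
  have h1 := lieBracket_mem_fieldFil h𝔤 hP
    (homogeneousFields_le_fieldFil le_rfl (const_mem_homogeneousFields v))
  have h2 : VectorField.lieBracket ℂ (fun _ => v) P = fun x => fderiv ℂ P x v := by
    funext x
    simp [VectorField.lieBracket]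
  rwa [h2] at h1

/-- A family `γ` of fields, depending linearly on `v ∈ V`, whose leading terms `δ` satisfy the
symmetry `∂ᵥ δ(u) = ∂ᵤ δ(v)`, is to leading order the family of partial derivatives of the field
`x ↦ δ(x)(x) / (k + 1)`. -/
theorem exists_potential (h𝔤 : ∀ A ∈ 𝔤, ∀ B ∈ 𝔤, A * B - B * A ∈ 𝔤) (γ : V →ₗ[ℂ] (V → V))
    (hγ : ∀ v, γ v ∈ fieldFil 𝔤 (k + 1))
    (hsymm : ∀ u v, (fun x => fderiv ℂ (γ u) x v - fderiv ℂ (γ v) x u) ∈ fieldFil 𝔤 (k + 1)) :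
    ∃ a ∈ homogeneousFields 𝔤 (k + 2), ∀ v,
      γ v - (fun x => fderiv ℂ a x v) ∈ fieldFil 𝔤 (k + 2) := by
  let b := Module.finBasis ℂ V
  have hspan : ∀ (f : V →ₗ[ℂ] (V → V)) (K : Submodule ℂ (V → V)), (∀ i, f (b i) ∈ K) →
      ∀ v, f v ∈ K := by
    intro f K h v
    rw [← b.sum_repr v, map_sum]
    exact K.sum_mem fun i _ => by rw [map_smul]; exact K.smul_mem _ (h i)
  choose δ₀ hδ₀ hγδ₀ using fun i => fieldFil_exists_leading (hγ (b i))
  let δ : V →ₗ[ℂ] (V → V) := b.constr ℂ δ₀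
  have hδ : ∀ v, δ v ∈ homogeneousFields 𝔤 (k + 1) :=
    hspan δ _ fun i => by simpa [δ] using hδ₀ i
  have hγδ : ∀ v, γ v - δ v ∈ fieldFil 𝔤 (k + 2) :=
    hspan (γ - δ) _ fun i => by simpa [δ] using hγδ₀ i
  have hδsymm : ∀ u v x, fderiv ℂ (δ u) x v = fderiv ℂ (δ v) x u := by
    intro u v x
    have h1 : (fun x => fderiv ℂ (δ u) x v - fderiv ℂ (δ v) x u) ∈ homogeneousFields 𝔤 k :=
      Submodule.sub_mem _ (fderiv_apply_mem_homogeneousFields (hδ u) v)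
        (fderiv_apply_mem_homogeneousFields (hδ v) u)
    have h2 : ∀ u v x, fderiv ℂ (γ u - δ u) x v = fderiv ℂ (γ u) x v - fderiv ℂ (δ u) x v := by
      intro u v x
      rw [fderiv_sub (fieldFil_differentiableAt (hγ u) x)
        (homogeneousFields_differentiableAt (hδ u) x)]
      rfl
    have h3 : (fun x => fderiv ℂ (δ u) x v - fderiv ℂ (δ v) x u) ∈ fieldFil 𝔤 (k + 1) := by
      have h4 := Submodule.add_mem _ (Submodule.sub_mem _ (hsymm u v)
        (fderiv_apply_mem_fieldFil h𝔤 (hγδ u) v)) (fderiv_apply_mem_fieldFil h𝔤 (hγδ v) u)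
      convert h4 using 1
      funext x
      simp only [Pi.add_apply, Pi.sub_apply, h2]
      abel
    have h4 := (Submodule.disjoint_def.1 (disjoint_fieldFil k.lt_succ_self)) _ h1 h3
    exact sub_eq_zero.1 (congrFun h4 x)
  have hc : ((k + 2 : ℕ) : ℂ) ≠ 0 := Nat.cast_ne_zero.2 (k + 1).succ_ne_zero
  let D : V → V := fun x => δ x x
  have hD : D = fun x => ∑ i, b.repr x i • δ (b i) x := by
    funext x
    have h1 := congrFun (congrArg δ (b.sum_repr x)) x
    rw [map_sum] at h1
    simpa using h1.symm
  have hrepr : ∀ i, ContDiff ℂ ω fun x => b.repr x i := fun i =>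
    (LinearMap.toContinuousLinearMap (b.coord i)).contDiff
  have hDc : ContDiff ℂ ω D := by
    rw [hD]
    exact ContDiff.sum fun i _ => (hrepr i).smul (hδ (b i)).1
  have hDd : ∀ x u, fderiv ℂ D x u = ((k + 2 : ℕ) : ℂ) • δ u x := by
    intro x u
    have h1 : HasFDerivAt D (∑ i, (b.repr x i • fderiv ℂ (δ (b i)) x +
        (LinearMap.toContinuousLinearMap (b.coord i)).smulRight (δ (b i) x))) x := by
      rw [hD]
      exact HasFDerivAt.fun_sum fun i _ =>
        ((LinearMap.toContinuousLinearMap (b.coord i)).hasFDerivAt (x := x)).smul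
          (homogeneousFields_differentiableAt (hδ (b i)) x).hasFDerivAt
    have h2 : ∀ y, ∑ i, b.repr y i • δ (b i) x = δ y x := fun y => by
      have h1 := congrFun (congrArg δ (b.sum_repr y)) x
      rw [map_sum] at h1
      simpa using h1
    have h3 : ∑ i, b.repr x i • fderiv ℂ (δ (b i)) x u = fderiv ℂ (δ x) x u := by
      simp only [fun i => hδsymm (b i) u x, ← map_smul]
      rw [← map_sum, b.sum_repr, hδsymm]
    rw [h1.fderiv]
    simp only [sum_apply, add_apply, smul_apply,
      Finset.sum_add_distrib, h3]
    have h4 : ∑ i, (LinearMap.toContinuousLinearMap (b.coord i)).smulRight (δ (b i) x) u =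
        δ u x := h2 u
    rw [h4, hδsymm, homogeneousFields_euler (hδ u)]
    push_cast
    module
  refine ⟨((k + 2 : ℕ) : ℂ)⁻¹ • D, Submodule.smul_mem _ _ ⟨hDc, fun c v => ?_, fun v => ?_⟩,
    fun v => ?_⟩
  · simp only [D, map_smul, Pi.smul_apply, (hδ v).2.1, smul_smul]
    congr 1
    ring
  · have h1 : fderiv ℂ D v = (((k + 2 : ℕ) : ℂ) * ((k + 1 : ℕ) : ℂ)⁻¹) • fderiv ℂ (δ v) v := by
      ext u
      rw [hDd, smul_apply, hδsymm, homogeneousFields_euler (hδ u), smul_smul, mul_assoc,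
        inv_mul_cancel₀ (Nat.cast_ne_zero.2 k.succ_ne_zero), mul_one]
    rw [h1]
    exact 𝔤.smul_mem _ ((hδ v).2.2 v)
  · have h1 : (fun x => fderiv ℂ (((k + 2 : ℕ) : ℂ)⁻¹ • D) x v) = δ v := by
      funext x
      rw [fderiv_const_smul hDc.contDiffAt.differentiableAt_omega, smul_apply, hDd, smul_smul,
        inv_mul_cancel₀ hc, one_smul]
    rw [h1]
    exact hγδ v

/-- A linear Lie algebra of finite type has a finite-dimensional algebra of polynomial fields. -/
theorem exists_prolongedAlgebra (h𝔤 : ∀ A ∈ 𝔤, ∀ B ∈ 𝔤, A * B - B * A ∈ 𝔤)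
    (hfin : IsOfFiniteType 𝔤) : ∃ n : ℕ, Nonempty (ProlongedAlgebra 𝔤 (Fin n → ℂ)) := by
  obtain ⟨m, hm⟩ := hfin
  have := finiteDimensional_fieldFil hm
  let e : fieldFil 𝔤 0 ≃ₗ[ℂ] (Fin (Module.finrank ℂ (fieldFil 𝔤 0)) → ℂ) :=
    (Module.finBasis ℂ (fieldFil 𝔤 0)).equivFun
  let Φ : (Fin (Module.finrank ℂ (fieldFil 𝔤 0)) → ℂ) →ₗ[ℂ] (V → V) :=
    (fieldFil 𝔤 0).subtype ∘ₗ e.symm.toLinearMap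
  have hΦ : ∀ P, Φ P ∈ fieldFil 𝔤 0 := fun P => (e.symm P).2
  have hΦe : ∀ P, Φ (e P) = P := fun P => by simp [Φ]
  have hinj : Function.Injective Φ := Subtype.val_injective.comp e.symm.injective
  have hd : ∀ P v, DifferentiableAt ℂ (Φ P) v := fun P v => fieldFil_differentiableAt (hΦ P) v
  have hreg : ∀ P, ContDiff ℂ ω (Φ P) := fun P => (fieldFil_regular (hΦ P)).1
  -- The arguments are exchanged: `ProlongedAlgebra` has the opposite of the bracket of fields.
  let br : (Fin (Module.finrank ℂ (fieldFil 𝔤 0)) → ℂ) →ₗ[ℂ]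
      (Fin (Module.finrank ℂ (fieldFil 𝔤 0)) → ℂ) →ₗ[ℂ]
      (Fin (Module.finrank ℂ (fieldFil 𝔤 0)) → ℂ) :=
    LinearMap.mk₂ ℂ (fun P Q => e ⟨VectorField.lieBracket ℂ (Φ Q) (Φ P),
        lieBracket_mem_fieldFil_zero h𝔤 (hΦ P) (hΦ Q)⟩)
      (fun P P' Q => hinj (by
        simp only [map_add, hΦe]
        exact funext fun v => VectorField.lieBracket_add_right (hd P v) (hd P' v)))
      (fun c P Q => hinj (by
        simp only [map_smul, hΦe]
        exact funext fun v => VectorField.lieBracket_const_smul_right (hd P v)))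
      (fun P Q Q' => hinj (by
        simp only [map_add, hΦe]
        exact funext fun v => VectorField.lieBracket_add_left (hd Q v) (hd Q' v)))
      (fun c P Q => hinj (by
        simp only [map_smul, hΦe]
        exact funext fun v => VectorField.lieBracket_const_smul_left (hd Q v)))
  have hbr : ∀ P Q, Φ (br P Q) = VectorField.lieBracket ℂ (Φ Q) (Φ P) := fun P Q => hΦe _
  let const : V →ₗ[ℂ] (Fin (Module.finrank ℂ (fieldFil 𝔤 0)) → ℂ) :=
    e.toLinearMap ∘ₗ
      { toFun := fun v => ⟨fun _ => v,
          homogeneousFields_le_fieldFil le_rfl (const_mem_homogeneousFields v)⟩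
        map_add' := fun _ _ => rfl
        map_smul' := fun _ _ => rfl }
  have hconst : ∀ v, Φ (const v) = fun _ => v := fun v => hΦe _
  obtain ⟨π, hπ, hππ⟩ := 𝔤.exists_clm_projection
  have hπ𝔤 : ∀ A, A - π A ∈ 𝔤 := fun A => by rw [← hπ, map_sub, hππ, sub_self]
  -- The projection to `𝔤` along a complement extends `lin` to all endomorphisms.
  let lin : (V →L[ℂ] V) →ₗ[ℂ] (Fin (Module.finrank ℂ (fieldFil 𝔤 0)) → ℂ) :=
    e.toLinearMap ∘ₗ
      { toFun := fun A => ⟨(A - π A : V →L[ℂ] V),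
          homogeneousFields_le_fieldFil (Nat.zero_le 1) (clm_mem_homogeneousFields (hπ𝔤 A))⟩
        map_add' := fun A B => Subtype.ext (by
          funext v
          simp only [map_add, Submodule.coe_add, Pi.add_apply, sub_apply, add_apply]
          abel)
        map_smul' := fun c A => Subtype.ext (by
          funext v
          simp [smul_sub]) }
  have hlin : ∀ A ∈ 𝔤, Φ (lin A) = A := fun A hA => by
    refine (hΦe _).trans ?_
    change ((A - π A : V →L[ℂ] V) : V → V) = A
    rw [(hπ A).2 hA, sub_zero]
  let ev : (Fin (Module.finrank ℂ (fieldFil 𝔤 0)) → ℂ) →ₗ[ℂ] V :=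
    { toFun := fun P => Φ P 0
      map_add' := fun P Q => by rw [map_add]; rfl
      map_smul' := fun c P => by rw [map_smul]; rfl }
  let jac : (Fin (Module.finrank ℂ (fieldFil 𝔤 0)) → ℂ) →ₗ[ℂ] (V →L[ℂ] V) :=
    { toFun := fun P => fderiv ℂ (Φ P) 0
      map_add' := fun P Q => by rw [map_add, fderiv_add (hd P 0) (hd Q 0)]
      map_smul' := fun c P => by rw [map_smul, fderiv_const_smul (hd P 0)]; rfl }
  refine ⟨_, ⟨{
    br := LinearMap.toContinuousLinearMap
      ((LinearMap.toContinuousLinearMap (𝕜 := ℂ)).toLinearMap ∘ₗ br)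
    const := LinearMap.toContinuousLinearMap const
    lin := LinearMap.toContinuousLinearMap lin
    ev := LinearMap.toContinuousLinearMap ev
    jac := LinearMap.toContinuousLinearMap jac
    Fil := fun k => (fieldFil 𝔤 k).comap Φ
    order := m + 1
    br_antisymm := fun P Q => hinj ?_
    jacobi := fun P Q R => hinj ?_
    ev_const := fun v => congrFun (hconst v) 0
    ev_br := fun P Q => congrFun (hbr P Q) 0
    jac_mem := fun P => (fieldFil_regular (hΦ P)).2 0
    br_const_const := fun u v => hinj ?_
    br_lin_const := fun A hA v => hinj ?_
    br_lin_lin := fun A hA B hB => hinj ?_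
    ev_lin := fun A hA => (congrFun (hlin A hA) 0).trans (map_zero A)
    Fil_zero := hΦ
    Fil_one := fun P => mem_fieldFil_one_iff (hΦ P)
    Fil_anti := fun i j h => Submodule.comap_mono (fieldFil_antitone h)
    Fil_order := fun P hP => hinj ?_
    br_mem := fun i j P Q hP hQ => ?_
    exact_const := fun k hk γ hγ hsymm => ?_ }⟩⟩
  · change Φ (br P Q) = Φ (-br Q P)
    rw [map_neg, hbr, hbr]
    exact funext fun v => VectorField.lieBracket_swap
  · change Φ (br P (br Q R)) = Φ (br (br P Q) R + br Q (br P R))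
    rw [map_add, hbr, hbr, hbr, hbr, hbr, hbr]
    funext v
    have h1 := VectorField.leibniz_identity_lieBracket (𝕜 := ℂ) (n := ω) (x := v) (by simp)
      (hreg R).contDiffAt (hreg Q).contDiffAt (hreg P).contDiffAt
    rw [Pi.add_apply, h1, VectorField.lieBracket_swap (V := Φ Q)]
    abel
  · change Φ (br (const u) (const v)) = Φ 0
    rw [hbr, hconst, hconst, map_zero]
    funext x
    simp [VectorField.lieBracket]
  · change Φ (br (lin A) (const v)) = Φ (const (A v))
    rw [hbr, hconst, hconst, hlin A hA]
    funext x
    simp [VectorField.lieBracket]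
  · change Φ (br (lin A) (lin B)) = Φ (lin (A * B - B * A))
    rw [hbr, hlin A hA, hlin B hB, hlin _ (h𝔤 A hA B hB)]
    funext x
    simp [VectorField.lieBracket]
  · have h1 : Φ P ∈ fieldFil 𝔤 (m + 1) := hP
    rw [fieldFil_eq_bot hm, Submodule.mem_bot] at h1
    rw [h1, map_zero]
  · change Φ (br P Q) ∈ fieldFil 𝔤 (i + j)
    rw [hbr]
    exact lieBracket_mem_fieldFil h𝔤 hP hQ
  · obtain ⟨k, rfl⟩ := Nat.exists_eq_add_of_le' hk
    obtain ⟨a, ha, hγa⟩ := exists_potential h𝔤 (Φ ∘ₗ γ) hγ (fun u v => by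
      have h1 : Φ (br (const v) (γ u) - br (const u) (γ v)) ∈ fieldFil 𝔤 (k + 1) := hsymm v u
      rw [map_sub, hbr, hbr, hconst, hconst] at h1
      convert Submodule.neg_mem _ h1 using 1
      funext x
      simp [VectorField.lieBracket]
      abel)
    have ha' := homogeneousFields_le_fieldFil (le_refl (k + 2)) ha
    refine ⟨e ⟨a, fieldFil_antitone (Nat.zero_le _) ha'⟩, ?_, fun v => ?_⟩
    · change Φ (e _) ∈ fieldFil 𝔤 (k + 2)
      rw [hΦe]
      exact ha'
    · change Φ (γ v - br (e _) (const v)) ∈ fieldFil 𝔤 (k + 2)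
      have h1 : VectorField.lieBracket ℂ (fun _ => v) a = fun x => fderiv ℂ a x v := by
        funext x
        simp [VectorField.lieBracket]
      rw [map_sub, hbr, hconst, hΦe, h1]
      exact hγa v

end FieldAlgebra

/-! ### The chart of a complex Lie subgroup -/

section LieSubgroup

variable {V : Type*} [NormedAddCommGroup V] [NormedSpace ℂ V]
  {F : Type*} [NormedAddCommGroup F] [NormedSpace ℂ F]
  {H : Type*} [Group H] [TopologicalSpace H] [ChartedSpace F H]

/-- A chart at the identity of a Lie group `H` gives a chart of the Lie subgroup `ι(H)` of
`GL(V)`. -/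
theorem IsComplexLieSubgroup.exists_isSubgroupChart [LieGroup 𝓘(ℂ, F) ω H]
    [SecondCountableTopology H] {ι : H →* (V →L[ℂ] V)ˣ} (hι : IsComplexLieSubgroup (F := F) ι) :
    ∃ κ : F → V →L[ℂ] V, IsSubgroupChart ι.range (lieSubgroupAlgebra (F := F) ι) κ := by
  have : IsTopologicalGroup H := topologicalGroup_of_lieGroup 𝓘(ℂ, F) ω
  let f : H → V →L[ℂ] V := fun h => (ι h : V →L[ℂ] V)
  have hf : ContMDiff 𝓘(ℂ, F) 𝓘(ℂ, V →L[ℂ] V) ω f := hι.holomorphic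
  have hω : (ω : WithTop ℕ∞) ≠ 0 := by simp
  let c := chartAt F (1 : H)
  have hc1 : (1 : H) ∈ c.source := mem_chart_source F 1
  let p : F → H := fun x => c.symm (x + c 1)
  have hp0 : p 0 = 1 := by simp only [p, zero_add]; exact c.left_inv hc1
  have htend : Tendsto (fun x : F => x + c 1) (𝓝 0) (𝓝 (c 1)) := by
    simpa using (continuous_add_const (c 1)).tendsto (0 : F)
  have hps : ∀ᶠ x in 𝓝 (0 : F), ContMDiffAt 𝓘(ℂ, F) 𝓘(ℂ, F) ω p x := by
    filter_upwards [htend.eventually (c.open_target.mem_nhds (c.map_source hc1))] with x hx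
    have h1 : ContMDiffAt 𝓘(ℂ, F) 𝓘(ℂ, F) ω c.symm (x + c 1) :=
      (contMDiffOn_chart_symm (I := 𝓘(ℂ, F)) (n := ω) (x := (1 : H))).contMDiffAt
        (c.open_target.mem_nhds hx)
    have h2 : ContMDiffAt 𝓘(ℂ, F) 𝓘(ℂ, F) ω (fun x : F => x + c 1) x :=
      (contDiff_id.add contDiff_const).contMDiff.contMDiffAt
    exact ContMDiffAt.comp x h1 h2
  have hκ : ∀ᶠ x in 𝓝 (0 : F), ContDiffAt ℂ ω (fun x => f (p x)) x := by
    filter_upwards [hps] with x hx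
    exact (hf.contMDiffAt.comp x hx).contDiffAt
  have h𝔤 : ∀ q : H, q = 1 → ∀ η : F, (mfderiv 𝓘(ℂ, F) 𝓘(ℂ, V →L[ℂ] V) f q : F →L[ℂ] V →L[ℂ] V) η ∈
      lieSubgroupAlgebra (F := F) ι := by
    rintro _ rfl η
    exact ⟨η, rfl⟩
  have hd0 : (mfderiv 𝓘(ℂ, F) 𝓘(ℂ, V →L[ℂ] V) f 1 : F →L[ℂ] V →L[ℂ] V) =
      fderiv ℂ (fun x => f (p x)) 0 := by
    have h1 := (hf.mdifferentiable hω (1 : H)).mfderiv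
    have h2 : fderiv ℂ (fun x => f (p x)) 0 = fderiv ℂ (fun x => f (c.symm x)) (c 1) := by
      have h3 := fderiv_comp_add_right (𝕜 := ℂ) (f := fun x => f (c.symm x)) (x := (0 : F)) (c 1)
      rw [zero_add] at h3
      exact h3
    rw [h1, h2]
    simp only [mfld_simps, fderivWithin_univ]
    rfl
  refine ⟨fun x => f (p x), hκ.self_of_nhds, ?_, ?_, ?_, ?_, ?_, ?_⟩
  · simp [f, hp0]
  · rw [← hd0]
    exact hι.immersion 1
  · rintro _ ⟨ξ, rfl⟩
    exact ⟨ξ, by rw [← hd0]; rfl⟩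
  -- Left translation to the identity turns the differential at `x` into one with values in `𝔤`.
  · filter_upwards [hps] with x hx ξ
    let k : F → H := fun x' => (p x)⁻¹ * p x'
    have hk : MDifferentiableAt 𝓘(ℂ, F) 𝓘(ℂ, F) k x :=
      (((contMDiff_mul_left (I := 𝓘(ℂ, F)) (n := ω) (a := (p x)⁻¹)).contMDiffAt).comp x
        hx).mdifferentiableAt hω
    have hkx : k x = 1 := inv_mul_cancel _
    have h1 : HasFDerivAt (f ∘ k)
        ((mfderiv 𝓘(ℂ, F) 𝓘(ℂ, V →L[ℂ] V) f (k x) : F →L[ℂ] V →L[ℂ] V) ∘L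
          (mfderiv 𝓘(ℂ, F) 𝓘(ℂ, F) k x : F →L[ℂ] F)) x :=
      (((hf.mdifferentiable hω (k x)).hasMFDerivAt).comp x hk.hasMFDerivAt).hasFDerivAt
    refine ⟨_, h𝔤 _ hkx ((mfderiv 𝓘(ℂ, F) 𝓘(ℂ, F) k x : F →L[ℂ] F) ξ), ?_⟩
    have h2 : (fun x => f (p x)) = fun x' => f (p x) * (f ∘ k) x' := by
      funext x'
      simp [f, k]
    have h3 := (h1.const_mul (f (p x))).fderiv
    rw [← h2] at h3
    rw [h3]
    rfl
  · exact Eventually.of_forall fun x => ⟨ι (p x), ⟨p x, rfl⟩, rfl⟩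
  · intro N hN
    let U : Set H := c.source ∩ {h | c h - c 1 ∈ N}
    have hU : U ∈ 𝓝 (1 : H) := by
      refine inter_mem (c.open_source.mem_nhds hc1) ?_
      have h1 : ContinuousAt (fun h => c h - c 1) 1 :=
        (c.continuousAt hc1).sub continuousAt_const
      exact h1 (by simpa using hN)
    obtain ⟨s, hs, hsU⟩ := TopologicalSpace.countable_cover_nhds
      (f := fun q : H => (fun h => q⁻¹ * h) ⁻¹' U) (fun q => by
        have h1 : ContinuousAt (fun h : H => q⁻¹ * h) q := (continuous_const_mul _).continuousAt
        exact h1 (by simpa using hU))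
    refine ⟨ι '' s, hs.image _, ?_⟩
    rintro _ ⟨h, rfl⟩
    obtain ⟨q, hq, hqU⟩ := mem_iUnion₂.1 (hsU.symm ▸ mem_univ h : h ∈ _)
    refine ⟨ι q, mem_image_of_mem _ hq, c (q⁻¹ * h) - c 1, hqU.2, ?_⟩
    have h1 : p (c (q⁻¹ * h) - c 1) = q⁻¹ * h := by
      simp only [p, sub_add_cancel]
      exact c.left_inv hqU.1
    simp [f, h1]

end LieSubgroup

/-! ### Integrability passes to the limit -/

section Limit

variable {V : Type*} [NormedAddCommGroup V] [NormedSpace ℂ V] [FiniteDimensional ℂ V]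
  {𝔤 : Submodule ℂ (V →L[ℂ] V)} {L : Type*} [NormedAddCommGroup L] [NormedSpace ℂ L]
  [FiniteDimensional ℂ L] {F : Type*} [NormedAddCommGroup F] [NormedSpace ℂ F]
  [FiniteDimensional ℂ F]

/-- The theorem in local coordinates `(t, y) ∈ ℂ × V`: if the frames `s(t, ·)` are carried into `G`
by local coordinates `ψ` for each `t ≠ 0`, then so is `s(0, ·)`. -/
theorem ProlongedAlgebra.exists_integrating_map_zero (S : ProlongedAlgebra 𝔤 L)
    {G : Subgroup (V →L[ℂ] V)ˣ} {κ : F → V →L[ℂ] V} (hκ : IsSubgroupChart G 𝔤 κ)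
    {s : ℂ × V → V →L[ℂ] V} {y₀ : V} (hs : ContDiffAt ℂ ω s (0, y₀)) (hs0 : IsUnit (s (0, y₀)))
    (h : ∀ᶠ z in 𝓝 ((0 : ℂ), y₀), z.1 ≠ 0 → ∃ ψ : V → V, ContDiffAt ℂ ω ψ z.2 ∧
      ∀ᶠ y in 𝓝 z.2, ∃ p ∈ G, (p : V →L[ℂ] V) = fderiv ℂ ψ y * s (z.1, y)) :
    ∃ ψ : V → V, ContDiffAt ℂ ω ψ y₀ ∧
      ∀ᶠ y in 𝓝 y₀, ∃ p ∈ G, (p : V →L[ℂ] V) = fderiv ℂ ψ y * s (0, y) := by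
  let θ : ℂ × V → V →L[ℂ] V := fun z => Ring.inverse (s z)
  have hθ : ContDiffAt ℂ ω θ (0, y₀) := by
    refine ContDiffAt.comp (g := Ring.inverse) ((0 : ℂ), y₀) ?_ hs
    obtain ⟨u, hu⟩ := hs0
    rw [← hu]
    exact contDiffAt_ringInverse ℂ (R := V →L[ℂ] V) u
  have hθs : ∀ᶠ z in 𝓝 ((0 : ℂ), y₀), (∀ v, θ z (s z v) = v) ∧ ∀ v, s z (θ z v) = v := by
    have h1 : ∀ᶠ z in 𝓝 ((0 : ℂ), y₀), IsUnit (s z) := by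
      refine hs.continuousAt.eventually ?_
      obtain ⟨u, hu⟩ := hs0
      rw [← hu]
      exact Units.nhds u
    filter_upwards [h1] with z hz
    exact ⟨fun v => congrArg (fun T : V →L[ℂ] V => T v) (Ring.inverse_mul_cancel _ hz),
      fun v => congrArg (fun T : V →L[ℂ] V => T v) (Ring.mul_inverse_cancel _ hz)⟩
  have hslice : ∀ z : ℂ × V, ContDiffAt ℂ ω (fun y : V => (z.1, y)) z.2 := fun z =>
    contDiffAt_const.prodMk contDiffAt_id
  have hslice' : ∀ z : ℂ × V, Tendsto (fun y : V => (z.1, y)) (𝓝 z.2) (𝓝 z) := fun z =>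
    (hslice z).continuousAt
  obtain ⟨Ω, hΩ, hΩf⟩ := S.exists_flat_form_zero hs hθ hθs (by
    filter_upwards [h, hθs.eventually_nhds, hs.eventually_omega, hθ.eventually_omega] with
      z hz hθsz hsz hθz hz0
    obtain ⟨ψ, hψ, hψG⟩ := hz hz0
    exact S.exists_flat_form_of_map hκ (θ := fun y => θ (z.1, y)) (s := fun y => s (z.1, y))
      (ContDiffAt.comp (g := θ) z.2 hθz (hslice z)) (ContDiffAt.comp (g := s) z.2 hsz (hslice z))
      ((hslice' z).eventually hθsz) hψ hψG)
  exact S.exists_integrating_map hκ hΩ ((hslice' (0, y₀)).eventually hθs) hΩf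

end Limit

/-! ### Adapted charts of a holomorphic family -/

section AdaptedCharts

variable {E : Type*} [NormedAddCommGroup E] [NormedSpace ℂ E]
  {M : Type*} [TopologicalSpace M] [ChartedSpace E M]
  {V : Type*} [NormedAddCommGroup V] [NormedSpace ℂ V]

/-- A submersion to `ℂ` has a nonzero differential: in suitable charts it is a projection, which has
a holomorphic section `γ`. -/
theorem Manifold.IsSubmersionAt.exists_mfderiv_ne_zero [IsManifold 𝓘(ℂ, E) ω M] {σ : M → ℂ} {x : M}
    (h : Manifold.IsSubmersionAt 𝓘(ℂ, E) 𝓘(ℂ, ℂ) ω σ x) :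
    ∃ e : E, (mfderiv 𝓘(ℂ, E) 𝓘(ℂ, ℂ) σ x : E →L[ℂ] ℂ) e ≠ 0 := by
  by_contra! hcon
  have hω : (ω : WithTop ℕ∞) ≠ 0 := by simp
  let b := h.equiv (h.domChart x)
  let j : ℂ → E := fun a => h.equiv.symm (a, b.2)
  have hj : ContDiff ℂ ω j := h.equiv.symm.contDiff.comp (contDiff_id.prodMk contDiff_const)
  have hj0 : j b.1 = h.domChart x := h.equiv.symm_apply_apply _
  have hdt : h.domChart x ∈ h.domChart.target := h.domChart.map_source h.mem_domChart_source
  let γ : ℂ → M := fun a => h.domChart.symm (j a)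
  have hγ0 : γ b.1 = x := by
    simp only [γ, hj0]
    exact h.domChart.left_inv h.mem_domChart_source
  have hγ : MDifferentiableAt 𝓘(ℂ, ℂ) 𝓘(ℂ, E) γ b.1 := by
    refine ContMDiffAt.mdifferentiableAt ?_ hω
    refine ContMDiffAt.comp b.1 ?_ hj.contMDiff.contMDiffAt
    refine contMDiffAt_symm_of_mem_maximalAtlas (I := 𝓘(ℂ, E)) h.domChart_mem_maximalAtlas ?_
    rw [hj0]
    exact hdt
  have hk : MDifferentiableAt 𝓘(ℂ, ℂ) 𝓘(ℂ, ℂ) h.codChart (σ (γ b.1)) := by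
    rw [hγ0]
    exact (contMDiffAt_of_mem_maximalAtlas h.codChart_mem_maximalAtlas
      h.mem_codChart_source).mdifferentiableAt hω
  have hσγ : HasMFDerivAt 𝓘(ℂ, E) 𝓘(ℂ, ℂ) σ (γ b.1) (0 : E →L[ℂ] ℂ) := by
    rw [hγ0]
    have h1 := (h.contMDiffAt.mdifferentiableAt hω).hasMFDerivAt
    have h2 : (mfderiv 𝓘(ℂ, E) 𝓘(ℂ, ℂ) σ x : E →L[ℂ] ℂ) = 0 := ContinuousLinearMap.ext hcon
    rw [h2] at h1
    exact h1
  have h3 : (fun a : ℂ => a) =ᶠ[𝓝 b.1] fun a => h.codChart (σ (γ a)) := by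
    have h4 : ∀ᶠ a in 𝓝 b.1, j a ∈ h.domChart.target :=
      hj.continuous.continuousAt.eventually_mem (by
        rw [hj0]; exact h.domChart.open_target.mem_nhds hdt)
    filter_upwards [h4] with a ha
    have h5 := h.writtenInCharts
      (show j a ∈ (h.domChart.extend 𝓘(ℂ, E)).target by simpa using ha)
    simp only [Function.comp_apply, mfld_simps] at h5
    rw [h5]
    simp [j]
  obtain ⟨A, hA⟩ : ∃ A : ℂ →L[ℂ] ℂ, HasMFDerivAt 𝓘(ℂ, ℂ) 𝓘(ℂ, ℂ) h.codChart (σ (γ b.1)) A :=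
    ⟨_, hk.hasMFDerivAt⟩
  obtain ⟨B, hB⟩ : ∃ B : ℂ →L[ℂ] E, HasMFDerivAt 𝓘(ℂ, ℂ) 𝓘(ℂ, E) γ b.1 B :=
    ⟨_, hγ.hasMFDerivAt⟩
  have h6 : HasFDerivAt (fun a : ℂ => a) (A ∘L (0 : E →L[ℂ] ℂ) ∘L B) b.1 :=
    (hA.comp b.1 (hσγ.comp b.1 hB)).hasFDerivAt.congr_of_eventuallyEq h3
  rw [ContinuousLinearMap.zero_comp, ContinuousLinearMap.comp_zero] at h6
  have h7 : (0 : ℂ) = 1 := congrArg (fun T : ℂ →L[ℂ] ℂ => T 1) (h6.unique (hasFDerivAt_id b.1))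
  exact zero_ne_one h7

/-- A chart `Φ : M → ℂ × V` of the total space of the family `σ` in which `σ` is the projection to
`ℂ`. -/
structure IsAdaptedChart (σ : M → ℂ) (Φ : OpenPartialHomeomorph M (ℂ × V)) : Prop where
  fst_apply : ∀ x ∈ Φ.source, (Φ x).1 = σ x
  contMDiffOn : ContMDiffOn 𝓘(ℂ, E) 𝓘(ℂ, ℂ × V) ω Φ Φ.source
  contMDiffOn_symm : ContMDiffOn 𝓘(ℂ, ℂ × V) 𝓘(ℂ, E) ω Φ.symm Φ.target

variable [FiniteDimensional ℂ E]

/-- Adapted charts exist: complete `σ` to a local diffeomorphism by a linear left inverse `l` of a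
frame `r` of the relative tangent space. -/
theorem IsHolomorphicFamily.exists_isAdaptedChart [IsManifold 𝓘(ℂ, E) ω M] {σ : M → ℂ}
    (hσ : IsHolomorphicFamily (E := E) σ) (x : M) (r : RelFrame (E := E) V σ x) :
    ∃ Φ : OpenPartialHomeomorph M (ℂ × V), x ∈ Φ.source ∧ IsAdaptedChart (E := E) σ Φ := by
  have hω : (ω : WithTop ℕ∞) ≠ 0 := by simp
  have := FiniteDimensional.complete ℂ E
  let c := chartAt E x
  have hcx : x ∈ c.source := mem_chart_source E x
  have hσx : ContMDiffAt 𝓘(ℂ, E) 𝓘(ℂ, ℂ) ω σ x := hσ.submersion.contMDiff x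
  let d : E →L[ℂ] ℂ := mfderiv 𝓘(ℂ, E) 𝓘(ℂ, ℂ) σ x
  obtain ⟨e₀, he₀⟩ : ∃ e : E, d e ≠ 0 := (hσ.submersion.isSubmersionAt x).exists_mfderiv_ne_zero
  let R : V →ₗ[ℂ] E := (relTangentSpace (E := E) σ x).subtype ∘ₗ r.toLinearMap
  have hdR : ∀ v, d (R v) = 0 := fun v => (r v).2
  have hR : ∀ e, d e = 0 → ∃ v, R v = e := fun e he =>
    ⟨r.symm ⟨e, he⟩, congrArg Subtype.val (r.apply_symm_apply ⟨e, he⟩)⟩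
  obtain ⟨l, hl⟩ := R.exists_leftInverse_of_injective
    (LinearMap.ker_eq_bot.2 (Subtype.val_injective.comp r.injective))
  have hlR : ∀ v, l (R v) = v := fun v => LinearMap.congr_fun hl v
  let T : E →ₗ[ℂ] ℂ × V := d.toLinearMap.prod l
  have hT : Function.Bijective T := by
    constructor
    · rw [injective_iff_map_eq_zero]
      intro e he
      obtain ⟨v, rfl⟩ := hR e (congrArg Prod.fst he)
      have h1 : l (R v) = 0 := congrArg Prod.snd he
      rw [hlR] at h1
      rw [h1, map_zero]
    · rintro ⟨t, v⟩
      refine ⟨(t / d e₀) • e₀ + R (v - l ((t / d e₀) • e₀)), Prod.ext ?_ ?_⟩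
      · change d _ = t
        rw [map_add, hdR, map_smul, smul_eq_mul, div_mul_cancel₀ _ he₀, add_zero]
      · change l _ = v
        rw [map_add, hlR, add_sub_cancel]
  let T' : E ≃L[ℂ] ℂ × V := (LinearEquiv.ofBijective T hT).toContinuousLinearEquiv
  let f : E → ℂ × V := fun w => (σ (c.symm w), l w)
  have hcs : ContMDiffAt 𝓘(ℂ, E) 𝓘(ℂ, E) ω c.symm (c x) :=
    (contMDiffOn_chart_symm (I := 𝓘(ℂ, E)) (n := ω) (x := x)).contMDiffAt
      (c.open_target.mem_nhds (c.map_source hcx))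
  have hσc : ContDiffAt ℂ ω (fun w => σ (c.symm w)) (c x) := by
    refine ContMDiffAt.contDiffAt (ContMDiffAt.comp (c x) ?_ hcs)
    rw [c.left_inv hcx]
    exact hσx
  have hf : ContDiffAt ℂ ω f (c x) :=
    hσc.prodMk (LinearMap.toContinuousLinearMap l).contDiff.contDiffAt
  have hd : fderiv ℂ (fun w => σ (c.symm w)) (c x) = d := by
    have h1 := (hσx.mdifferentiableAt hω).mfderiv
    simp only [mfld_simps, fderivWithin_univ] at h1
    exact h1.symm
  have hf' : HasFDerivAt f (T' : E →L[ℂ] ℂ × V) (c x) := by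
    have h1 := hσc.differentiableAt_omega.hasFDerivAt
    rw [hd] at h1
    exact h1.prodMk (LinearMap.toContinuousLinearMap l).hasFDerivAt
  let e := hf.toOpenPartialHomeomorph f hf' hω
  have hex : c x ∈ e.source := hf.mem_toOpenPartialHomeomorph_source hf' hω
  have he : ∀ w, e w = f w := fun w => rfl
  have hes : ContDiffAt ℂ ω e.symm (e (c x)) := hf.to_localInverse hf' hω
  let U : Set E := {w | ContDiffAt ℂ ω f w ∧ ContDiffAt ℂ ω e.symm (e w)}
  have hU : U ∈ 𝓝 (c x) := by
    have h1 := (e.continuousAt hex).eventually hes.eventually_omega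
    exact hf.eventually_omega.and h1
  let e' := e.restr (interior U)
  have hex' : c x ∈ e'.source := by
    rw [e.restr_source' _ isOpen_interior]
    exact ⟨hex, mem_interior_iff_mem_nhds.2 hU⟩
  have he'U : ∀ w ∈ e'.source, w ∈ U := fun w hw => by
    rw [e.restr_source' _ isOpen_interior] at hw
    exact interior_subset hw.2
  refine ⟨c.trans e', ?_, ?_, ?_, ?_⟩
  · rw [OpenPartialHomeomorph.trans_source]
    exact ⟨hcx, hex'⟩
  · intro y hy
    rw [OpenPartialHomeomorph.trans_source] at hy
    change σ (c.symm (c y)) = σ y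
    rw [c.left_inv hy.1]
  · intro y hy
    rw [OpenPartialHomeomorph.trans_source] at hy
    refine ContMDiffAt.contMDiffWithinAt ?_
    have h1 : ContMDiffAt 𝓘(ℂ, E) 𝓘(ℂ, E) ω c y :=
      (contMDiffOn_chart (I := 𝓘(ℂ, E)) (n := ω) (x := x)).contMDiffAt
        (c.open_source.mem_nhds hy.1)
    exact ContMDiffAt.comp (g := f) y (he'U _ hy.2).1.contMDiffAt h1
  · intro z hz
    rw [OpenPartialHomeomorph.trans_target] at hz
    refine ContMDiffAt.contMDiffWithinAt ?_
    have h1 : ContMDiffAt 𝓘(ℂ, E) 𝓘(ℂ, E) ω c.symm (e'.symm z) :=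
      (contMDiffOn_chart_symm (I := 𝓘(ℂ, E)) (n := ω) (x := x)).contMDiffAt
        (c.open_target.mem_nhds hz.2)
    have h2 : ContDiffAt ℂ ω e.symm z := by
      have h3 := (he'U _ (e'.map_target hz.1)).2
      have h4 : e (e'.symm z) = z := e'.right_inv hz.1
      rwa [h4] at h3
    exact ContMDiffAt.comp (g := c.symm) (f := e'.symm) z h1 h2.contMDiffAt

end AdaptedCharts

/-! ### Frames in adapted charts -/

section AdaptedFrames

variable {E : Type*} [NormedAddCommGroup E] [NormedSpace ℂ E]
  {M : Type*} [TopologicalSpace M] [ChartedSpace E M]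
  {V : Type*} [NormedAddCommGroup V] [NormedSpace ℂ V]

/-- The frame `s x`, as a linear map to the model space `E`. -/
noncomputable def frameVector {σ : M → ℂ} (s : ∀ x : M, RelFrame (E := E) V σ x) (x : M) :
    V →ₗ[ℂ] E :=
  (relTangentSpace (E := E) σ x).subtype ∘ₗ (s x).toLinearMap

variable {σ : M → ℂ} {Φ : OpenPartialHomeomorph M (ℂ × V)}

namespace IsAdaptedChart

theorem apply_symm_fst (hΦ : IsAdaptedChart (E := E) σ Φ) {z : ℂ × V} (hz : z ∈ Φ.target) :
    σ (Φ.symm z) = z.1 := by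
  rw [← hΦ.fst_apply _ (Φ.map_target hz), Φ.right_inv hz]

theorem contMDiffAt (hΦ : IsAdaptedChart (E := E) σ Φ) {x : M} (hx : x ∈ Φ.source) :
    ContMDiffAt 𝓘(ℂ, E) 𝓘(ℂ, ℂ × V) ω Φ x :=
  hΦ.contMDiffOn.contMDiffAt (Φ.open_source.mem_nhds hx)

theorem contMDiffAt_symm (hΦ : IsAdaptedChart (E := E) σ Φ) {z : ℂ × V} (hz : z ∈ Φ.target) :
    ContMDiffAt 𝓘(ℂ, ℂ × V) 𝓘(ℂ, E) ω Φ.symm z :=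
  hΦ.contMDiffOn_symm.contMDiffAt (Φ.open_target.mem_nhds hz)

/-- The differential of the inverse of an adapted chart, as an isomorphism `ℂ × V → E`. -/
theorem exists_hasMFDerivAt_symm (hΦ : IsAdaptedChart (E := E) σ Φ) {z : ℂ × V}
    (hz : z ∈ Φ.target) : ∃ T : (ℂ × V) ≃L[ℂ] E,
      HasMFDerivAt 𝓘(ℂ, ℂ × V) 𝓘(ℂ, E) Φ.symm z (T : ℂ × V →L[ℂ] E) := by
  have hω : (ω : WithTop ℕ∞) ≠ 0 := by simp
  obtain ⟨A, hA⟩ : ∃ A : ℂ × V →L[ℂ] E, HasMFDerivAt 𝓘(ℂ, ℂ × V) 𝓘(ℂ, E) Φ.symm z A :=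
    ⟨_, ((hΦ.contMDiffAt_symm hz).mdifferentiableAt hω).hasMFDerivAt⟩
  obtain ⟨B, hB⟩ : ∃ B : E →L[ℂ] ℂ × V, HasMFDerivAt 𝓘(ℂ, E) 𝓘(ℂ, ℂ × V) Φ (Φ.symm z) B :=
    ⟨_, ((hΦ.contMDiffAt (Φ.map_target hz)).mdifferentiableAt hω).hasMFDerivAt⟩
  have h1 : HasFDerivAt (fun z : ℂ × V => z) (B ∘L A) z := by
    refine (hB.comp z hA).hasFDerivAt.congr_of_eventuallyEq ?_
    filter_upwards [Φ.open_target.mem_nhds hz] with z' hz'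
    exact (Φ.right_inv hz').symm
  have h2 : HasMFDerivAt 𝓘(ℂ, E) 𝓘(ℂ, E) (fun x : M => x) (Φ.symm z)
      (A ∘L B : E →L[ℂ] E) := by
    have hA' : HasMFDerivAt 𝓘(ℂ, ℂ × V) 𝓘(ℂ, E) Φ.symm (Φ (Φ.symm z)) A := by
      rw [Φ.right_inv hz]
      exact hA
    refine (hA'.comp (Φ.symm z) hB).congr_of_eventuallyEq ?_
    filter_upwards [Φ.open_source.mem_nhds (Φ.map_target hz)] with x hx
    exact (Φ.left_inv hx).symm
  have h3 : B ∘L A = ContinuousLinearMap.id ℂ (ℂ × V) := h1.unique (hasFDerivAt_id z)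
  have h4 : A ∘L B = ContinuousLinearMap.id ℂ E :=
    hasMFDerivAt_unique h2 (hasMFDerivAt_id (Φ.symm z))
  exact ⟨ContinuousLinearEquiv.equivOfInverse A B (fun w => congrArg (fun T => T w) h3)
    (fun w => congrArg (fun T => T w) h4), hA⟩

/-- The differential of `σ` is the projection to `ℂ` in an adapted chart; in particular the
differential of the inverse chart maps `{0} × V` to the relative tangent space. -/
theorem mfderiv_apply_mfderiv_symm (hΦ : IsAdaptedChart (E := E) σ Φ)
    (hσ : IsHolomorphicFamily (E := E) σ) {z : ℂ × V} (hz : z ∈ Φ.target) {T : ℂ × V →L[ℂ] E}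
    (hT : HasMFDerivAt 𝓘(ℂ, ℂ × V) 𝓘(ℂ, E) Φ.symm z T) (w : ℂ × V) :
    (mfderiv 𝓘(ℂ, E) 𝓘(ℂ, ℂ) σ (Φ.symm z) : E →L[ℂ] ℂ) (T w) = w.1 := by
  have hω : (ω : WithTop ℕ∞) ≠ 0 := by simp
  obtain ⟨A, hA, hA'⟩ : ∃ A : E →L[ℂ] ℂ, HasMFDerivAt 𝓘(ℂ, E) 𝓘(ℂ, ℂ) σ (Φ.symm z) A ∧
      (mfderiv 𝓘(ℂ, E) 𝓘(ℂ, ℂ) σ (Φ.symm z) : E →L[ℂ] ℂ) = A :=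
    ⟨_, ((hσ.submersion.contMDiff (Φ.symm z)).mdifferentiableAt hω).hasMFDerivAt, rfl⟩
  have h1 : HasFDerivAt (fun z : ℂ × V => z.1) (A ∘L T) z := by
    refine (hA.comp z hT).hasFDerivAt.congr_of_eventuallyEq ?_
    filter_upwards [Φ.open_target.mem_nhds hz] with z' hz'
    exact (hΦ.apply_symm_fst hz').symm
  rw [hA']
  exact congrArg (fun T : ℂ × V →L[ℂ] ℂ => T w) (h1.unique hasFDerivAt_fst)

variable [FiniteDimensional ℂ E] [FiniteDimensional ℂ V] [IsManifold 𝓘(ℂ, E) ω M]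

/-- A holomorphic frame field is given in an adapted chart by an analytic matrix `S`: its vectors
are the images of `(0, S(z) v)` under the differential of the inverse chart. -/
theorem exists_frame_matrix (hΦ : IsAdaptedChart (E := E) σ Φ)
    (hσ : IsHolomorphicFamily (E := E) σ) {s : ∀ x : M, RelFrame (E := E) V σ x} {U : Set M}
    (hU : IsOpen U) (hs : IsHolomorphicFrameFieldOn s U) :
    ∃ S : ℂ × V → V →L[ℂ] V, ∀ x ∈ Φ.source ∩ U, ContDiffAt ℂ ω S (Φ x) ∧ IsUnit (S (Φ x)) ∧
      ∀ T : ℂ × V →L[ℂ] E, HasMFDerivAt 𝓘(ℂ, ℂ × V) 𝓘(ℂ, E) Φ.symm (Φ x) T →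
        ∀ v, frameVector s x v = T (0, S (Φ x) v) := by
  have := FiniteDimensional.complete ℂ E
  have := FiniteDimensional.complete ℂ V
  -- The vector fields of the frame in the chart; their first component vanishes.
  let X : ∀ z : ℂ × V, V → ℂ × V := fun z v =>
    VectorField.mpullback 𝓘(ℂ, ℂ × V) 𝓘(ℂ, E) Φ.symm
      (fun x => (s x v : TangentSpace 𝓘(ℂ, E) x)) z
  have hX : ∀ z ∈ Φ.target, ∀ T : (ℂ × V) ≃L[ℂ] E,
      HasMFDerivAt 𝓘(ℂ, ℂ × V) 𝓘(ℂ, E) Φ.symm z (T : ℂ × V →L[ℂ] E) →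
      ∀ v, X z v = T.symm (frameVector s (Φ.symm z) v) := by
    intro z hz T hT v
    have h1 : ∀ A : ℂ × V →L[ℂ] E, A = T → A.inverse (frameVector s (Φ.symm z) v) =
        T.symm (frameVector s (Φ.symm z) v) := by
      rintro _ rfl
      rw [ContinuousLinearMap.inverse_equiv]
      rfl
    exact h1 _ hT.mfderiv
  have hXc : ∀ z ∈ Φ.target, Φ.symm z ∈ U → ∀ v, ContDiffAt ℂ ω (fun z => X z v) z := by
    intro z hz hzU v
    obtain ⟨T, hT⟩ := hΦ.exists_hasMFDerivAt_symm hz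
    refine contMDiffAt_vectorSpace_iff_contDiffAt.1 ?_
    refine ContMDiffAt.mpullback_vectorField_preimage (n := ω)
      ((hs v).contMDiffAt (hU.mem_nhds hzU)) (hΦ.contMDiffAt_symm hz) ?_ le_top
    rw [hT.mfderiv]
    exact ⟨T, rfl⟩
  have hX1 : ∀ z ∈ Φ.target, ∀ v, (X z v).1 = 0 := by
    intro z hz v
    obtain ⟨T, hT⟩ := hΦ.exists_hasMFDerivAt_symm hz
    rw [hX z hz T hT, ← hΦ.mfderiv_apply_mfderiv_symm hσ hz hT]
    have h1 : T (T.symm (frameVector s (Φ.symm z) v)) = frameVector s (Φ.symm z) v :=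
      T.apply_symm_apply _
    exact (congrArg (mfderiv 𝓘(ℂ, E) 𝓘(ℂ, ℂ) σ (Φ.symm z) : E →L[ℂ] ℂ) h1).trans
      (s (Φ.symm z) v).2
  let A : ℂ × V → (ℂ × V →L[ℂ] E) := fun z => mfderiv 𝓘(ℂ, ℂ × V) 𝓘(ℂ, E) Φ.symm z
  let S : ℂ × V → V →L[ℂ] V := fun z => LinearMap.toContinuousLinearMap
    (LinearMap.snd ℂ ℂ V ∘ₗ (A z).inverse.toLinearMap ∘ₗ frameVector s (Φ.symm z))
  have hS : ∀ z v, S z v = (X z v).2 := fun z v => rfl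
  have hSX : ∀ z ∈ Φ.target, ∀ v, X z v = (0, S z v) := fun z hz v =>
    Prod.ext (hX1 z hz v) (hS z v).symm
  have hopen : IsOpen (Φ.target ∩ Φ.symm ⁻¹' U) := Φ.symm.isOpen_inter_preimage hU
  have hSc : ContDiffOn ℂ ω S (Φ.target ∩ Φ.symm ⁻¹' U) := by
    rw [contDiffOn_clm_apply]
    intro v z hz
    simp only [hS]
    exact (hXc z hz.1 hz.2 v).snd.contDiffWithinAt
  refine ⟨S, fun x hx => ?_⟩
  have hz : Φ x ∈ Φ.target := Φ.map_source hx.1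
  obtain ⟨T, hT⟩ := hΦ.exists_hasMFDerivAt_symm hz
  have hTS : ∀ v, frameVector s x v = T (0, S (Φ x) v) := fun v => by
    rw [← hSX _ hz v, hX _ hz T hT, T.apply_symm_apply, Φ.left_inv hx.1]
  refine ⟨hSc.contDiffAt (hopen.mem_nhds ⟨hz, ?_⟩), ?_, fun T' hT' v => ?_⟩
  · rw [mem_preimage, Φ.left_inv hx.1]
    exact hx.2
  · rw [ContinuousLinearMap.isUnit_iff_bijective]
    have h1 : Function.Injective (S (Φ x)).toLinearMap := by
      rw [injective_iff_map_eq_zero]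
      intro v hv
      have h2 : frameVector s x v = 0 := by
        have h3 : S (Φ x) v = 0 := hv
        rw [hTS, h3]
        exact map_zero T
      have h3 : s x v = 0 := Subtype.ext h2
      exact (s x).map_eq_zero_iff.1 h3
    exact ⟨h1, LinearMap.injective_iff_surjective.1 h1⟩
  · rw [hTS, hasMFDerivAt_unique hT' hT]
    rfl

end IsAdaptedChart

end AdaptedFrames

/-! ### Charts on the fibres -/

section FibreCharts

variable {E : Type*} [NormedAddCommGroup E] [NormedSpace ℂ E]
  {M : Type*} [TopologicalSpace M] [ChartedSpace E M]
  {V : Type*} [NormedAddCommGroup V] [NormedSpace ℂ V]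
  {σ : M → ℂ} {Φ : OpenPartialHomeomorph M (ℂ × V)}

namespace IsAdaptedChart

/-- A local homeomorphism `χ` of `V` turns an adapted chart of `M` into a chart of the fibre over
`t`. -/
theorem exists_fibre_homeomorph (hΦ : IsAdaptedChart (E := E) σ Φ) {t : ℂ} (x₀ : σ ⁻¹' {t})
    (χ : OpenPartialHomeomorph V V) (hχ : ∀ y ∈ χ.source, (t, y) ∈ Φ.target) :
    ∃ φ : OpenPartialHomeomorph (σ ⁻¹' {t}) V,
      (∀ x, x ∈ φ.source ↔ (x : M) ∈ Φ.source ∧ (Φ x).2 ∈ χ.source) ∧ φ.target = χ.target ∧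
      ∀ w ∈ χ.target, (φ.symm w : M) = Φ.symm (t, χ.symm w) := by
  classical
  have hfib : ∀ w ∈ χ.target, Φ.symm (t, χ.symm w) ∈ σ ⁻¹' {t} := fun w hw =>
    hΦ.apply_symm_fst (hχ _ (χ.map_target hw))
  have hpair : ∀ x : σ ⁻¹' {t}, (x : M) ∈ Φ.source → (t, (Φ x).2) = Φ x := fun x hx =>
    Prod.ext ((hΦ.fst_apply _ hx).trans x.2).symm rfl
  let i : V → σ ⁻¹' {t} := fun w =>
    if hw : w ∈ χ.target then ⟨Φ.symm (t, χ.symm w), hfib w hw⟩ else x₀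
  have hi : ∀ w ∈ χ.target, (i w : M) = Φ.symm (t, χ.symm w) := fun w hw => by
    simp only [i, dif_pos hw]
  have hopen : IsOpen {x : σ ⁻¹' {t} | (x : M) ∈ Φ.source ∧ (Φ x).2 ∈ χ.source} := by
    have h1 : IsOpen (Φ.source ∩ Φ ⁻¹' (Prod.snd ⁻¹' χ.source)) :=
      Φ.isOpen_inter_preimage (χ.open_source.preimage continuous_snd)
    exact h1.preimage continuous_subtype_val
  refine ⟨{
    toFun := fun x => χ (Φ x).2
    invFun := i
    source := {x | (x : M) ∈ Φ.source ∧ (Φ x).2 ∈ χ.source}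
    target := χ.target
    map_source' := fun x hx => χ.map_source hx.2
    map_target' := fun w hw => ?_
    left_inv' := fun x hx => ?_
    right_inv' := fun w hw => ?_
    open_source := hopen
    open_target := χ.open_target
    continuousOn_toFun := ?_
    continuousOn_invFun := ?_ }, fun x => Iff.rfl, rfl, hi⟩
  · have h1 := hχ _ (χ.map_target hw)
    rw [mem_ofPred_eq, hi w hw, Φ.right_inv h1]
    exact ⟨Φ.map_target h1, χ.map_target hw⟩
  · refine Subtype.ext ?_
    rw [hi _ (χ.map_source hx.2), χ.left_inv hx.2, hpair x hx.1, Φ.left_inv hx.1]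
  · rw [hi w hw, Φ.right_inv (hχ _ (χ.map_target hw)), χ.right_inv hw]
  · intro x hx
    refine ContinuousAt.continuousWithinAt ?_
    have h1 : ContinuousAt (fun x : σ ⁻¹' {t} => (Φ x).2) x :=
      continuous_snd.continuousAt.comp
        ((Φ.continuousAt hx.1).comp continuous_subtype_val.continuousAt)
    exact ContinuousAt.comp (g := χ) (χ.continuousAt hx.2) h1
  · rw [continuousOn_iff_continuous_domRestrict, continuous_induced_rng]
    have h1 : ContinuousOn (fun w => Φ.symm (t, χ.symm w)) χ.target :=
      Φ.continuousOn_symm.comp (continuousOn_const.prodMk χ.continuousOn_symm)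
        fun w hw => hχ _ (χ.map_target hw)
    refine (continuousOn_iff_continuous_domRestrict.1 h1).congr fun w => (hi w w.2).symm

/-- The differential of `w ↦ Φ⁻¹(t, q w)`. -/
theorem hasMFDerivAt_symm_comp {t : ℂ} {q : V → V} {w : V} {T : ℂ × V →L[ℂ] E}
    {D : V →L[ℂ] V} (hT : HasMFDerivAt 𝓘(ℂ, ℂ × V) 𝓘(ℂ, E) Φ.symm (t, q w) T)
    (hq : HasFDerivAt q D w) {e : V → M} (he : e =ᶠ[𝓝 w] fun w => Φ.symm (t, q w)) :
    HasMFDerivAt 𝓘(ℂ, V) 𝓘(ℂ, E) e w (T ∘L (ContinuousLinearMap.inr ℂ ℂ V ∘L D) : V →L[ℂ] E) := by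
  have h1 : HasFDerivAt (fun w => (t, q w)) (ContinuousLinearMap.inr ℂ ℂ V ∘L D) w :=
    (hasFDerivAt_const t w).prodMk hq
  exact (hT.comp w h1.hasMFDerivAt).congr_of_eventuallyEq he

end IsAdaptedChart

variable [FiniteDimensional ℂ V]

/-- The inverse function theorem for analytic maps, with the derivatives of the local inverse. -/
theorem ContDiffAt.exists_openPartialHomeomorph_omega {q : V → V} {w₀ : V}
    (hq : ContDiffAt ℂ ω q w₀) (hq' : IsUnit (fderiv ℂ q w₀)) {N : Set V} (hN : N ∈ 𝓝 w₀) :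
    ∃ χ : OpenPartialHomeomorph V V, w₀ ∈ χ.source ∧ χ.source ⊆ N ∧ (∀ w, χ w = q w) ∧
      ∀ y ∈ χ.target, ContDiffAt ℂ ω χ.symm y ∧ fderiv ℂ q (χ.symm y) * fderiv ℂ χ.symm y = 1 ∧
        fderiv ℂ χ.symm y * fderiv ℂ q (χ.symm y) = 1 := by
  have hω : (ω : WithTop ℕ∞) ≠ 0 := by simp
  have := FiniteDimensional.complete ℂ V
  obtain ⟨D, hD⟩ : ∃ D : V ≃L[ℂ] V, (D : V →L[ℂ] V) = fderiv ℂ q w₀ := by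
    obtain ⟨u, hu⟩ := hq'
    exact ⟨ContinuousLinearEquiv.ofUnit u, hu⟩
  have hf' : HasFDerivAt q (D : V →L[ℂ] V) w₀ := by
    rw [hD]
    exact hq.differentiableAt_omega.hasFDerivAt
  let e := hq.toOpenPartialHomeomorph q hf' hω
  have hex : w₀ ∈ e.source := hq.mem_toOpenPartialHomeomorph_source hf' hω
  have hes : ContDiffAt ℂ ω e.symm (e w₀) := hq.to_localInverse hf' hω
  have hN' : N ∩ {w | ContDiffAt ℂ ω q w ∧ ContDiffAt ℂ ω e.symm (e w)} ∈ 𝓝 w₀ :=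
    inter_mem hN (hq.eventually_omega.and ((e.continuousAt hex).eventually hes.eventually_omega))
  let χ := e.restr (interior (N ∩ {w | ContDiffAt ℂ ω q w ∧ ContDiffAt ℂ ω e.symm (e w)}))
  have hχs : χ.source = _ := e.restr_source' _ isOpen_interior
  have hχ : ∀ w ∈ χ.source, w ∈ N ∩ {w | ContDiffAt ℂ ω q w ∧ ContDiffAt ℂ ω e.symm (e w)} :=
    fun w hw => interior_subset (hχs.subset hw).2
  have hsymm : ∀ y ∈ χ.target, ContDiffAt ℂ ω χ.symm y := fun y hy => by
    have h1 := (hχ _ (χ.map_target hy)).2.2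
    have h2 : e (χ.symm y) = y := χ.right_inv hy
    rw [h2] at h1
    exact h1
  refine ⟨χ, hχs.symm.subset ⟨hex, mem_interior_iff_mem_nhds.2 hN'⟩, fun w hw => (hχ w hw).1,
    fun w => rfl, fun y hy => ⟨hsymm y hy, ?_, ?_⟩⟩
  · have h1 := (hχ _ (χ.map_target hy)).2.1.differentiableAt_omega.hasFDerivAt.comp y
      (hsymm y hy).differentiableAt_omega.hasFDerivAt
    refine (h1.congr_of_eventuallyEq ?_).unique (hasFDerivAt_id y)
    filter_upwards [χ.open_target.mem_nhds hy] with y' hy'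
    exact (χ.right_inv hy').symm
  · have h0 : HasFDerivAt χ.symm (fderiv ℂ χ.symm y) (q (χ.symm y)) := by
      have h2 : q (χ.symm y) = y := χ.right_inv hy
      rw [h2]
      exact (hsymm y hy).differentiableAt_omega.hasFDerivAt
    have h1 := h0.comp (χ.symm y) (hχ _ (χ.map_target hy)).2.1.differentiableAt_omega.hasFDerivAt
    refine (h1.congr_of_eventuallyEq ?_).unique (hasFDerivAt_id _)
    filter_upwards [χ.open_source.mem_nhds (χ.map_target hy)] with w hw
    exact (χ.left_inv hw).symm

namespace IsAdaptedChart

variable {G : Subgroup (V →L[ℂ] V)ˣ}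
  {𝒢 : ∀ x : M, Set (RelFrame (E := E) V σ x)} {s : ∀ x : M, RelFrame (E := E) V σ x} {U : Set M}
  {S : ℂ × V → V →L[ℂ] V}

/-- Integrability on a fibre, in an adapted chart: the frames `S(t, ·)` that span the `G`-structure
are carried into `G` by local coordinates. -/
theorem exists_integrating_map (hΦ : IsAdaptedChart (E := E) σ Φ) (hU : IsOpen U)
    (hsG : ∀ y ∈ U, ∀ f : RelFrame (E := E) V σ y,
      f ∈ 𝒢 y ↔ ∃ g ∈ G, ∀ v : V, f v = s y ((g : V →L[ℂ] V) v))
    (hS : ∀ x ∈ Φ.source ∩ U, IsUnit (S (Φ x)) ∧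
      ∀ T : ℂ × V →L[ℂ] E, HasMFDerivAt 𝓘(ℂ, ℂ × V) 𝓘(ℂ, E) Φ.symm (Φ x) T →
        ∀ v, frameVector s x v = T (0, S (Φ x) v))
    {t : ℂ} {y₁ : V} (hy : (t, y₁) ∈ Φ.target) (hyU : Φ.symm (t, y₁) ∈ U)
    (hint : IsIntegrableAt G 𝒢 t) :
    ∃ ψ : V → V, ContDiffAt ℂ ω ψ y₁ ∧
      ∀ᶠ y in 𝓝 y₁, ∃ p ∈ G, (p : V →L[ℂ] V) = fderiv ℂ ψ y * S (t, y) := by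
  obtain ⟨𝒜, hcov, h𝒜⟩ := hint
  obtain ⟨φ, hφ, hxφ⟩ := hcov ⟨Φ.symm (t, y₁), hΦ.apply_symm_fst hy⟩
  obtain ⟨hφc, hφG⟩ := h𝒜 φ hφ
  let e : V → M := fun w => (φ.symm w : M)
  let q : V → V := fun w => (Φ (e w)).2
  let w₀ : V := φ ⟨Φ.symm (t, y₁), hΦ.apply_symm_fst hy⟩
  have hw₀ : w₀ ∈ φ.target := φ.map_source hxφ
  have he₀ : e w₀ = Φ.symm (t, y₁) := congrArg Subtype.val (φ.left_inv hxφ)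
  have hq₀ : q w₀ = y₁ := by
    simp only [q, he₀, Φ.right_inv hy]
  let W : Set V := φ.target ∩ e ⁻¹' (Φ.source ∩ U)
  have hec : ContinuousOn e φ.target := continuous_subtype_val.comp_continuousOn φ.continuousOn_symm
  have hW : IsOpen W := hec.isOpen_inter_preimage φ.open_target (Φ.open_source.inter hU)
  have hw₀W : w₀ ∈ W := ⟨hw₀, by
    rw [mem_preimage, he₀]
    exact ⟨Φ.map_target hy, hyU⟩⟩
  have hqΦ : ∀ w ∈ W, Φ (e w) = (t, q w) := fun w hw =>
    Prod.ext ((hΦ.fst_apply _ hw.2.1).trans (φ.symm w).2) rfl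
  have hqc : ∀ w ∈ W, ContDiffAt ℂ ω q w := fun w hw => by
    have h1 : ContMDiffAt 𝓘(ℂ, V) 𝓘(ℂ, E) ω e w :=
      hφc.holomorphic.contMDiffAt (φ.open_target.mem_nhds hw.1)
    exact (ContMDiffAt.contDiffAt (ContMDiffAt.comp w (hΦ.contMDiffAt hw.2.1) h1)).snd
  have hg : ∀ w ∈ W, ∃ g ∈ G, S (t, q w) = fderiv ℂ q w * (g : V →L[ℂ] V) := by
    intro w hw
    obtain ⟨g, hg, hgs⟩ := (hφG w hw.1 (s (e w))).1
      ((hsG (e w) hw.2.2 (s (e w))).2 ⟨1, G.one_mem, fun v => rfl⟩)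
    have hzt : (t, q w) ∈ Φ.target := by
      rw [← hqΦ w hw]
      exact Φ.map_source hw.2.1
    obtain ⟨T, hT⟩ := hΦ.exists_hasMFDerivAt_symm hzt
    have h1 := hasMFDerivAt_symm_comp (e := e) hT (hqc w hw).differentiableAt_omega.hasFDerivAt (by
      filter_upwards [hW.mem_nhds hw] with w' hw'
      rw [← hqΦ w' hw', Φ.left_inv hw'.2.1])
    have h2 := (hS (e w) hw.2).2
    rw [hqΦ w hw] at h2
    refine ⟨g, hg, ContinuousLinearMap.ext fun v => ?_⟩
    have h3 : frameVector s (e w) v = T (0, fderiv ℂ q w ((g : V →L[ℂ] V) v)) :=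
      (hgs v).trans (congrArg (fun A : V →L[ℂ] E => A ((g : V →L[ℂ] V) v)) h1.mfderiv)
    exact congrArg Prod.snd (T.injective ((h2 _ hT v).symm.trans h3))
  have hunit : IsUnit (fderiv ℂ q w₀) := by
    obtain ⟨g, -, hg⟩ := hg w₀ hw₀W
    have h1 := (hS (e w₀) hw₀W.2).1
    rw [hqΦ w₀ hw₀W, hg] at h1
    exact (Units.isUnit_mul_units _ g).1 h1
  obtain ⟨χ, hχ₀, hχW, hχq, hχ⟩ :=
    (hqc w₀ hw₀W).exists_openPartialHomeomorph_omega hunit (hW.mem_nhds hw₀W)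
  have hy₁ : y₁ ∈ χ.target := by
    rw [← hq₀, ← hχq]
    exact χ.map_source hχ₀
  refine ⟨χ.symm, (hχ y₁ hy₁).1, ?_⟩
  filter_upwards [χ.open_target.mem_nhds hy₁] with y hy
  obtain ⟨g, hgG, hg⟩ := hg _ (hχW (χ.map_target hy))
  rw [← hχq, χ.right_inv hy] at hg
  exact ⟨g, hgG, by rw [hg, ← mul_assoc, (hχ y hy).2.2, one_mul]⟩

/-- Local coordinates that carry the frames `S(t, ·)` into `G` define a chart of the fibre in which
the `G`-structure is the product one. -/
theorem exists_isFibreChart (hΦ : IsAdaptedChart (E := E) σ Φ) (hU : IsOpen U)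
    (hsG : ∀ y ∈ U, ∀ f : RelFrame (E := E) V σ y,
      f ∈ 𝒢 y ↔ ∃ g ∈ G, ∀ v : V, f v = s y ((g : V →L[ℂ] V) v))
    (hS : ∀ x ∈ Φ.source ∩ U, IsUnit (S (Φ x)) ∧
      ∀ T : ℂ × V →L[ℂ] E, HasMFDerivAt 𝓘(ℂ, ℂ × V) 𝓘(ℂ, E) Φ.symm (Φ x) T →
        ∀ v, frameVector s x v = T (0, S (Φ x) v))
    {t : ℂ} (x : σ ⁻¹' {t}) (hx : (x : M) ∈ Φ.source) (hxU : (x : M) ∈ U)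
    {ψ : V → V} (hψ : ContDiffAt ℂ ω ψ (Φ x).2)
    (hψG : ∀ᶠ y in 𝓝 (Φ x).2, ∃ p ∈ G, (p : V →L[ℂ] V) = fderiv ℂ ψ y * S (t, y)) :
    ∃ φ : OpenPartialHomeomorph (σ ⁻¹' {t}) V, x ∈ φ.source ∧ IsFibreChart (E := E) σ t φ ∧
      ∀ w ∈ φ.target, ∀ f : RelFrame (E := E) V σ (φ.symm w : M),
        f ∈ 𝒢 (φ.symm w) ↔ ∃ g ∈ G, ∀ v : V,
          (f v : TangentSpace 𝓘(ℂ, E) (φ.symm w : M)) =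
            mfderiv 𝓘(ℂ, V) 𝓘(ℂ, E) (fun w' : V => (φ.symm w' : M)) w ((g : V →L[ℂ] V) v) := by
  have hΦx : Φ x = (t, (Φ x).2) := Prod.ext ((hΦ.fst_apply _ hx).trans x.2) rfl
  let N : Set V := {y | ((t, y) ∈ Φ.target ∧ Φ.symm (t, y) ∈ U) ∧
    ∃ p ∈ G, (p : V →L[ℂ] V) = fderiv ℂ ψ y * S (t, y)}
  have hN : N ∈ 𝓝 (Φ x).2 := by
    refine Filter.Eventually.and ?_ hψG
    have h1 : Tendsto (fun y : V => (t, y)) (𝓝 (Φ x).2) (𝓝 (t, (Φ x).2)) :=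
      (Continuous.prodMk_right t).continuousAt
    refine h1.eventually ((Φ.symm.isOpen_inter_preimage hU).mem_nhds ?_)
    rw [← hΦx]
    refine ⟨Φ.map_source hx, ?_⟩
    rw [mem_preimage, Φ.left_inv hx]
    exact hxU
  have hunit : IsUnit (fderiv ℂ ψ (Φ x).2) := by
    obtain ⟨p, -, hp⟩ := hψG.self_of_nhds
    obtain ⟨u, hu⟩ := (hS x ⟨hx, hxU⟩).1
    rw [← hΦx, ← hu] at hp
    exact (Units.isUnit_mul_units _ u).1 (hp ▸ p.isUnit)
  obtain ⟨χ, hχ₀, hχN, hχψ, hχ⟩ := hψ.exists_openPartialHomeomorph_omega hunit hN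
  obtain ⟨φ, hφs, hφt, hφ⟩ := hΦ.exists_fibre_homeomorph x χ fun y hy => (hχN hy).1.1
  let e : V → M := fun w => (φ.symm w : M)
  -- The differential of the inverse chart.
  have he : ∀ w ∈ χ.target, ∃ T : (ℂ × V) ≃L[ℂ] E,
      HasMFDerivAt 𝓘(ℂ, ℂ × V) 𝓘(ℂ, E) Φ.symm (t, χ.symm w) (T : ℂ × V →L[ℂ] E) ∧
      ∀ u, (mfderiv 𝓘(ℂ, V) 𝓘(ℂ, E) e w : V →L[ℂ] E) u = T (0, fderiv ℂ χ.symm w u) := by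
    intro w hw
    obtain ⟨T, hT⟩ := hΦ.exists_hasMFDerivAt_symm (hχN (χ.map_target hw)).1.1
    have h1 := hasMFDerivAt_symm_comp (e := e) hT
      (hχ w hw).1.differentiableAt_omega.hasFDerivAt (by
        filter_upwards [χ.open_target.mem_nhds hw] with w' hw'
        exact hφ w' hw')
    exact ⟨T, hT, fun u => congrArg (fun A : V →L[ℂ] E => A u) h1.mfderiv⟩
  refine ⟨φ, (hφs x).2 ⟨hx, hχ₀⟩, ⟨fun w hw => ?_, fun w hw => ?_⟩, fun w hw f => ?_⟩
  · rw [hφt] at hw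
    refine ContMDiffAt.contMDiffWithinAt ?_
    have h1 : ContMDiffAt 𝓘(ℂ, V) 𝓘(ℂ, ℂ × V) ω (fun w => (t, χ.symm w)) w :=
      (contDiffAt_const.prodMk (hχ w hw).1).contMDiffAt
    refine (ContMDiffAt.comp w (hΦ.contMDiffAt_symm (hχN (χ.map_target hw)).1.1)
      h1).congr_of_eventuallyEq ?_
    filter_upwards [χ.open_target.mem_nhds hw] with w' hw'
    exact hφ w' hw'
  · rw [hφt] at hw
    obtain ⟨T, -, hT⟩ := he w hw
    intro u u' huu
    have h1 : fderiv ℂ χ.symm w u = fderiv ℂ χ.symm w u' :=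
      congrArg Prod.snd (T.injective ((hT u).symm.trans (huu.trans (hT u'))))
    have h2 : ∀ u, fderiv ℂ ψ (χ.symm w) (fderiv ℂ χ.symm w u) = u := fun u =>
      congrArg (fun A : V →L[ℂ] V => A u) (hχ w hw).2.1
    rw [← h2 u, h1, h2 u']
  · rw [hφt] at hw
    obtain ⟨T, hT, hTe⟩ := he w hw
    obtain ⟨⟨hzt, hzU⟩, p, hp, hpS⟩ := hχN (χ.map_target hw)
    have hew : Φ (e w) = (t, χ.symm w) := (congrArg Φ (hφ w hw)).trans (Φ.right_inv hzt)
    have hemem : e w ∈ Φ.source ∩ U := by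
      have h1 : e w = Φ.symm (t, χ.symm w) := hφ w hw
      rw [h1]
      exact ⟨Φ.map_target hzt, hzU⟩
    have hSw := (hS (e w) hemem).2
    rw [hew] at hSw
    have hpv : ∀ v, fderiv ℂ χ.symm w ((p : V →L[ℂ] V) v) = S (t, χ.symm w) v := fun v => by
      rw [hpS]
      exact congrArg (fun A : V →L[ℂ] V => A (S (t, χ.symm w) v)) (hχ w hw).2.2
    have hs : ∀ v, frameVector s (e w) v =
        (mfderiv 𝓘(ℂ, V) 𝓘(ℂ, E) e w : V →L[ℂ] E) ((p : V →L[ℂ] V) v) := fun v => by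
      rw [hSw _ hT v, ← hpv v]
      exact (hTe _).symm
    refine (hsG (e w) hemem.2 f).trans ⟨?_, ?_⟩
    · rintro ⟨g, hg, hgf⟩
      exact ⟨p * g, G.mul_mem hp hg, fun v => (congrArg Subtype.val (hgf v)).trans (hs _)⟩
    · rintro ⟨g, hg, hgf⟩
      refine ⟨p⁻¹ * g, G.mul_mem (G.inv_mem hp) hg, fun v => Subtype.ext ((hgf v).trans ?_)⟩
      refine Eq.trans ?_ (hs _).symm
      refine congrArg (mfderiv 𝓘(ℂ, V) 𝓘(ℂ, E) e w : V →L[ℂ] E) ?_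
      exact (congrArg (fun A : V →L[ℂ] V => A ((g : V →L[ℂ] V) v)) p.mul_inv).symm

end IsAdaptedChart

end FibreCharts

theorem proposition2
    {V : Type*} [NormedAddCommGroup V] [NormedSpace ℂ V] [FiniteDimensional ℂ V]
    {F : Type*} [NormedAddCommGroup F] [NormedSpace ℂ F] [FiniteDimensional ℂ F]
    {H : Type*} [Group H] [TopologicalSpace H] [ChartedSpace F H] [LieGroup 𝓘(ℂ, F) ω H]
    [SecondCountableTopology H]
    (ι : H →* (V →L[ℂ] V)ˣ) (hι : IsComplexLieSubgroup (F := F) ι)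
    (hfin : IsOfFiniteType (lieSubgroupAlgebra (F := F) ι))
    {E : Type*} [NormedAddCommGroup E] [NormedSpace ℂ E] [FiniteDimensional ℂ E]
    {M : Type*} [TopologicalSpace M] [ChartedSpace E M] [IsManifold 𝓘(ℂ, E) ω M]
    (σ : M → ℂ) (hσ : IsHolomorphicFamily (E := E) σ)
    (𝒢 : ∀ x : M, Set (RelFrame (E := E) V σ x))
    (h𝒢 : IsHolomorphicFamilyOfGStructures ι.range 𝒢)
    (hint : ∀ t ∈ Metric.ball (0 : ℂ) 1, t ≠ 0 → IsIntegrableAt ι.range 𝒢 t) :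
    IsIntegrableAt ι.range 𝒢 0 := by
  obtain ⟨κ, hκ⟩ := hι.exists_isSubgroupChart
  obtain ⟨n, ⟨S⟩⟩ := exists_prolongedAlgebra (fun _ hA _ hB => hκ.lie_mem hA hB) hfin
  -- The atlas of all charts in which the `G`-structure is the product one.
  refine ⟨{φ | IsFibreChart (E := E) σ 0 φ ∧
      ∀ w ∈ φ.target, ∀ f : RelFrame (E := E) V σ (φ.symm w : M),
        f ∈ 𝒢 (φ.symm w) ↔ ∃ g ∈ ι.range, ∀ v : V,
          (f v : TangentSpace 𝓘(ℂ, E) (φ.symm w : M)) =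
            mfderiv 𝓘(ℂ, V) 𝓘(ℂ, E) (fun w' : V => (φ.symm w' : M)) w ((g : V →L[ℂ] V) v)},
    fun x => ?_, fun φ hφ => hφ⟩
  obtain ⟨U, hU, hxU, s, hs, hsG⟩ := h𝒢 x
  obtain ⟨Φ, hx, hΦ⟩ := hσ.exists_isAdaptedChart (x : M) (s x)
  obtain ⟨T, hT⟩ := hΦ.exists_frame_matrix hσ hU hs
  have hT' := fun y hy => (hT y hy).2
  have hΦx : ((0 : ℂ), (Φ x).2) = Φ x := Prod.ext ((hΦ.fst_apply _ hx).trans x.2).symm rfl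
  have hev : ∀ᶠ z in 𝓝 ((0 : ℂ), (Φ x).2), z ∈ Φ.target ∧ Φ.symm z ∈ U := by
    refine (Φ.symm.isOpen_inter_preimage hU).mem_nhds ?_
    rw [hΦx]
    refine ⟨Φ.map_source hx, ?_⟩
    rw [mem_preimage, Φ.left_inv hx]
    exact hxU
  obtain ⟨ψ, hψ, hψG⟩ := S.exists_integrating_map_zero hκ (s := T) (y₀ := (Φ x).2)
    (by rw [hΦx]; exact (hT x ⟨hx, hxU⟩).1) (by rw [hΦx]; exact (hT x ⟨hx, hxU⟩).2.1) (by
      filter_upwards [hev] with z hz hz0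
      refine hΦ.exists_integrating_map hU hsG hT' hz.1 hz.2 (hint z.1 ?_ hz0)
      rw [← hΦ.apply_symm_fst hz.1]
      exact hσ.mem_disk _)
  obtain ⟨φ, hxφ, hφ⟩ := hΦ.exists_isFibreChart hU hsG hT' x hx hxU hψ hψG
  exact ⟨φ, hφ, hxφ⟩
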